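/- \textbf{Notation.} The Lagrange spectrum $L$ is the set of finite values of $\limsup_{|p|,|q|\to\infty}\frac1{|q(q\alpha-p)|}$ over irrational $\alpha$, and the Markov spectrum $M$ is the set of finite values of $\sqrt{b^2-4ac}\,/\inf_{(x,y)\in\mathbb Z^2\setminus\{0\}}|ax^2+bxy+cy^2|$ over real indefinite binary quadratic forms. For a bi-infinite sequence $S=(S_n)_{n\in\mathbb Z}$ of positive integers let $\lambda_0(S)=[S_0;S_1,S_2,\dots]+[0;S_{-1},S_{-2},\dots]$. A word with a bar at the left (right) end of a sequence is repeated periodically to the left (right); a bar over the whole sequence means periodic in both directions. The letter just before an asterisk is in position $0$. $w^T$ is the word $w$ read backwards, and $[0;s]$ is the finite continued fraction of a word $s$, with $[0;s]=0$ for the empty word. Let $\omega_1=212332111$ and $\omega_1^*=21233^*2111$, and put $$j_0=\lambda_0(\overline{21233^*2111}),\qquad j=\lambda_0(\overline{\omega_1}\,\omega_1\,\omega_1^*\,\omega_1\,2122\,\overline{12}),\qquad J=\lambda_0(\overline{21}\,1111\,\omega_1\,\omega_1^*\,\omega_1\,\omega_1\,2122\,1212\,\overline{333212}).$$ Let $\tilde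 F_1=\{13,\,232,\,323,\,322,\,333211,\,332112,\,3321111,\,\omega_1 22,\,\omega_1 23,\,21\omega_1 2,\,1\omega_1 211\}$ and let the set of forbidden words be $\tilde F_2=\tilde F_1\cup\tilde F_1^T\cup\{2111\,\omega_1\,2123,\ 3212\,\omega_1^T\,1112\}$. \textbf{Theorem.} We have $j_0<j<J$, $M\cap(j_0,j)=\emptyset$ and $L\cap(j_0,J)=\emptyset$. Moreover $$(M\setminus L)\cap[j,J)=C\cup D\cup X,$$ where $$C=\{\lambda_0(\overline{\omega_1}\,\omega_1^*\,\omega_1\,21221212\,S)\ :\ S\in\{1,2,3\}^{\mathbb N},\ 21221212\,S\text{ contains no word of }\tilde F_2\},$$ $$D=\{\lambda_0(\overline{\omega_1}\,\omega_1^*\,\omega_1\,21221212\,s\,21212212\,\omega_1^T\,\overline{\omega_1^T})\ :\ s\text{ a finite, possibly empty, word over }\{1,2,3\},\ 21221212\,s\,21212212\text{ contains no word of }\tilde F_2,\ [0;s]\le[0;s^T]\},$$ $$X=\{\lambda_0(\overline{\omega_1}\,\omega_1^*\,\omega_1\,2122\,u\,2212\,\omega_1^T\,\overline{\omega_1^T})\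 :\ u\in\{121,\ 12121,\ 1212121\}\}.$$ The set $C$ is a Cantor set (non-empty, compact, perfect and totally disconnected), $D$ is a countable set all of whose points are isolated points of $M\setminus L$, and $X$ has exactly three elements. -/

import Mathlib

open Filter Set Topology
open scoped ENNReal

namespace MarkovLagrange

noncomputable section

/-! ### The Lagrange and Markov spectra -/

/-- The best constant of Diophantine approximation of `α`: the limit superior of
`1 / |q (q α - p)|` as the integers `p` and `q` both tend to infinity in absolute value. It is
taken in `[0, ∞]`. -/
def lagrangeValue (α : ℝ) : ℝ≥0∞ :=
  limsup (fun v : ℤ × ℤ => ENNReal.ofReal (1 / |(v.2 : ℝ) * ((v.2 : ℝ) * α - (v.1 : ℝ))|))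
    (cofinite ×ˢ cofinite)

/-- The Lagrange spectrum: the finite values of `lagrangeValue` at irrational numbers. -/
def lagrangeSpectrum : Set ℝ :=
  {x | ∃ α : ℝ, Irrational α ∧ lagrangeValue α ≠ ⊤ ∧ x = (lagrangeValue α).toReal}

/-- The infimum of `|a x² + b x y + c y²|` over the integer vectors `(x, y) ≠ (0, 0)`. -/
def formInf (a b c : ℝ) : ℝ :=
  ⨅ v : {v : ℤ × ℤ // v ≠ 0},
    |a * (v.1.1 : ℝ) ^ 2 + b * (v.1.1 : ℝ) * (v.1.2 : ℝ) + c * (v.1.2 : ℝ) ^ 2|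

/-- The Markov spectrum: the finite values of `√Δ(q) / inf |q|`, where `q` runs through the
indefinite real binary quadratic forms. -/
def markovSpectrum : Set ℝ :=
  {x | ∃ a b c : ℝ, 0 < b ^ 2 - 4 * a * c ∧ 0 < formInf a b c ∧
    x = √(b ^ 2 - 4 * a * c) / formInf a b c}

/-! ### Continued fractions -/

/-- The finite continued fraction `[a 0; a 1, …, a n]`. -/
def cfConvergent : ℕ → (ℕ → ℕ) → ℝ
  | 0, a => (a 0 : ℝ)
  | n + 1, a => (a 0 : ℝ) + 1 / cfConvergent n (fun i => a (i + 1))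

/-- The infinite continued fraction `[a 0; a 1, a 2, …]` (used for positive integers `a i`, for
which the limit exists). -/
def cfValue (a : ℕ → ℕ) : ℝ := limUnder atTop (fun n => cfConvergent n a)

/-- The finite continued fraction `[0; s₁, …, sₙ]` of a word `s₁ … sₙ`. -/
def cfWord : List ℕ → ℝ
  | [] => 0
  | a :: s => 1 / ((a : ℝ) + cfWord s)

/-- `λ₀(S) = [S 0; S 1, S 2, …] + [0; S (-1), S (-2), …]` for a bi-infinite sequence `S`. -/
def lambda0 (S : ℤ → ℕ) : ℝ :=
  cfValue (fun n => S (n : ℤ)) + 1 / cfValue (fun n => S (-(n : ℤ) - 1))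

/-! ### Words and sequences -/

/-- The right-infinite periodic sequence `w w w …`. -/
def periodic (w : List ℕ) : ℕ → ℕ := fun n => w.getD (n % w.length) 0

/-- The right-infinite sequence `w x`: the word `w` followed by the sequence `x`. -/
def prepend (w : List ℕ) (x : ℕ → ℕ) : ℕ → ℕ :=
  fun n => if n < w.length then w.getD n 0 else x (n - w.length)

/-- The bi-infinite sequence `… p p p w x` (`p` repeated periodically to the left, then the word
`w`, then the right-infinite sequence `x`), indexed so that position zero is the letter number `k`
of `w`, where the letters of `w` are counted from `0`. -/
def biSeq (p w : List ℕ) (k : ℕ) (x : ℕ → ℕ) : ℤ → ℕ := fun n =>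
  if n + k < 0 then p.getD ((n + k) % (p.length : ℤ)).toNat 0
  else prepend w x (n + k).toNat

/-- The word `w` occurs in the right-infinite sequence `x` as a block of consecutive letters. -/
def OccursIn (w : List ℕ) (x : ℕ → ℕ) : Prop :=
  ∃ n : ℕ, (List.range w.length).map (fun i => x (n + i)) = w

/-! ### The objects of the theorem -/

/-- The word `ω₁ = 212332111`. In `ω₁* = 21233*2111` the letter number `4` is marked. -/
def omega1 : List ℕ := [2, 1, 2, 3, 3, 2, 1, 1, 1]

/-- `j₀ = λ₀` of the periodic sequence with period `21233*2111`. -/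
def j0 : ℝ := lambda0 (biSeq omega1 omega1 4 (periodic omega1))

/-- `j = λ₀(… ω₁ ω₁ ω₁* ω₁ 2122 12 12 12 …)`, with `ω₁` repeated periodically to the left. -/
def jM : ℝ :=
  lambda0 (biSeq omega1 (omega1 ++ omega1 ++ omega1 ++ [2, 1, 2, 2]) 13 (periodic [1, 2]))

/-- `J = λ₀(… 21 21 1111 ω₁ ω₁* ω₁ ω₁ 2122 1212 333212 333212 …)`. -/
def jL : ℝ :=
  lambda0 (biSeq [2, 1]
    ([1, 1, 1, 1] ++ omega1 ++ omega1 ++ omega1 ++ omega1 ++ [2, 1, 2, 2] ++ [1, 2, 1, 2]) 17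
    (periodic [3, 3, 3, 2, 1, 2]))

/-- The list `13, 232, 323, 322, 333211, 332112, 3321111, ω₁22, ω₁23, 21ω₁2, 1ω₁211`. -/
def forbiddenBase : List (List ℕ) :=
  [[1, 3], [2, 3, 2], [3, 2, 3], [3, 2, 2], [3, 3, 3, 2, 1, 1], [3, 3, 2, 1, 1, 2],
    [3, 3, 2, 1, 1, 1, 1], omega1 ++ [2, 2], omega1 ++ [2, 3], [2, 1] ++ omega1 ++ [2],
    [1] ++ omega1 ++ [2, 1, 1]]

/-- The self-replicating word `2111 ω₁ 2123`. -/
def selfRep : List ℕ := [2, 1, 1, 1] ++ omega1 ++ [2, 1, 2, 3]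

/-- The full list of forbidden words: the words of `forbiddenBase` and `selfRep`, together with
their transposes (the words read backwards). -/
def forbidden : List (List ℕ) :=
  forbiddenBase ++ forbiddenBase.map List.reverse ++ [selfRep, selfRep.reverse]

/-- The word `21221212`. -/
def wordP : List ℕ := [2, 1, 2, 2, 1, 2, 1, 2]

/-- The values `λ₀(… ω₁ ω₁ ω₁* ω₁ 21221212 S)`, where `S` is a right-infinite sequence over
`{1, 2, 3}` such that `21221212 S` contains no forbidden word. -/
def setC : Set ℝ :=
  {x | ∃ S : ℕ → ℕ, (∀ n, S n ∈ ({1, 2, 3} : Set ℕ)) ∧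
    (∀ w ∈ forbidden, ¬ OccursIn w (prepend wordP S)) ∧
    x = lambda0 (biSeq omega1 (omega1 ++ omega1 ++ wordP) 4 S)}

/-- The values `λ₀(… ω₁ ω₁ ω₁* ω₁ 21221212 s 21212212 ω₁ᵀ ω₁ᵀ ω₁ᵀ …)`, where `s` is a finite
(possibly empty) word over `{1, 2, 3}` such that `21221212 s 21212212` contains no forbidden word
and `[0; s] ≤ [0; sᵀ]`. -/
def setD : Set ℝ :=
  {x | ∃ s : List ℕ, (∀ a ∈ s, a ∈ ({1, 2, 3} : Set ℕ)) ∧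
    (∀ w ∈ forbidden, ¬ w <:+: wordP ++ s ++ wordP.reverse) ∧
    cfWord s ≤ cfWord s.reverse ∧
    x = lambda0 (biSeq omega1
      (omega1 ++ omega1 ++ wordP ++ s ++ wordP.reverse ++ omega1.reverse) 4
      (periodic omega1.reverse))}

/-- The value `λ₀(… ω₁ ω₁ ω₁* ω₁ 2122 u 2212 ω₁ᵀ ω₁ᵀ ω₁ᵀ …)`. -/
def pointX (u : List ℕ) : ℝ :=
  lambda0 (biSeq omega1
    (omega1 ++ omega1 ++ [2, 1, 2, 2] ++ u ++ [2, 2, 1, 2] ++ omega1.reverse) 4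
    (periodic omega1.reverse))

/-- The three exceptional points, with middle words `121`, `12121` and `1212121`. -/
def setX : Set ℝ :=
  {pointX [1, 2, 1], pointX [1, 2, 1, 2, 1], pointX [1, 2, 1, 2, 1, 2, 1]}

end

end MarkovLagrange

open Filter Set Topology
open scoped ENNReal

namespace MarkovLagrange

/-! ### Infinite continued fractions with positive entries -/

/-! An element of `M` is a supremum of the values `λᵢ(S)` over a bi-infinite sequence `S` of
positive integers (`exists_isSupLam`; conversely, attained suprema lie in `M` by
`lam_mem_markovSpectrum`). An element of `L` is the limit superior of these values towards one end.
Below `J < 4` only the letters 1, 2, 3 matter, and the problem becomes combinatorics of ternary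
words.

A finite window of letters confines `λ` to a rational interval. An exhaustive search over windows
shows that each word of `F̃₁` forces some `λᵢ ≥ J`. A second search (`centre_search`) shows that,
once these words and their transposes are excluded, `λ_p > j₀` is possible only if `2111ω₁2123` or
its transpose is centred at `p`. This word is self-replicating (`Below.selfRep_sub`): nine places to
its left stands another copy. The search leaves only one other continuation to the left, which
forces the long word `wordJ`. There `λ` is minimised by explicit extremal tails, and the minimum is
`J` (`jL_le_lam_of_wordJ`).

Hence, up to reversal, a sequence with all `λᵢ < J` and some `λᵢ > j₀` is `ω₁`-periodic to the left.
To the right the blocks either never stop, so that no `λᵢ` exceeds `j₀`, or they stop at `21221212`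
(`Below.str_of_selfRep`). In the latter case, called `Str`, the value at the centre of the last but
one block dominates all earlier ones and is at least `j`. Beyond `21221212` no copy of the
self-replicating word can stand, because it would replicate to the left over the letters `22`. If
its transpose does not occur there either, the tail is constrained only by the forbidden words,
which gives `C`. If the transpose occurs, the mirrored argument makes the right end `ω₁ᵀ`-periodic
and leaves a finite middle word. This gives `D`, where `[0; s] ≤ [0; sᵀ]` says that the left centre
has the larger value, or `X`, where `21221212` and its transpose overlap.

For `L`, compactness carries replication over to a one-sided sequence far out. A limit of shifts has
the structure above, so both `22` and copies of the self-replicating word, or both transposed, recur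
arbitrarily far out. A copy beyond a `22` then replicates back over it, or a transposed copy before
a `22` replicates forward over it, which is impossible. So `L` misses `(j₀, J)` and every point of
`C`, `D`, `X` lies in `M \ L`.

`C` is the injective continuous image of the compact space of admissible tails. It is perfect
because every admissible prefix has two different admissible continuations. Points of `D` are
isolated because the transposed word at a fixed place can occur in only finitely many of the
competing sequences. -/

/-- `x n = [a n; a (n + 1), …]` expressed by the recursion for complete quotients. -/
def IsCF (a : ℕ → ℕ) (x : ℕ → ℝ) : Prop :=
  ∀ n, 1 ≤ x n ∧ x n = a n + 1 / x (n + 1)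

lemma IsCF.shift {a : ℕ → ℕ} {x : ℕ → ℝ} (h : IsCF a x) (k : ℕ) :
    IsCF (fun n => a (n + k)) (fun n => x (n + k)) := fun n => by
  have := h (n + k)
  rwa [show n + k + 1 = n + 1 + k by ring] at this

/-- Two continued fraction steps contract by a factor 4. All convergence, uniqueness and continuity
statements below rest on this. -/
lemma abs_two_step_le {p q s t : ℝ} (hq : 1 ≤ q) (hs : 1 ≤ s) (ht : 1 ≤ t) :
    |(p + 1 / (q + 1 / s)) - (p + 1 / (q + 1 / t))| ≤ |s - t| / 4 := by
  have h1 : (p + 1 / (q + 1 / s)) - (p + 1 / (q + 1 / t)) =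
      (s - t) / ((q * s + 1) * (q * t + 1)) := by
    have : 0 < q * s + 1 := by positivity
    have : 0 < q * t + 1 := by positivity
    field_simp
    ring
  have h2 : (4 : ℝ) ≤ (q * s + 1) * (q * t + 1) := by
    have h3 : 1 ≤ q * s := by nlinarith
    have h4 : 1 ≤ q * t := by nlinarith
    nlinarith
  rw [h1, abs_div, abs_of_pos (by linarith : (0 : ℝ) < (q * s + 1) * (q * t + 1))]
  exact div_le_div_of_nonneg_left (abs_nonneg _) (by norm_num) h2

lemma cfConvergent_bounds {a : ℕ → ℕ} (ha : ∀ n, 1 ≤ a n) (n : ℕ) :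
    (a 0 : ℝ) ≤ cfConvergent n a ∧ cfConvergent n a ≤ a 0 + 1 := by
  induction n generalizing a with
  | zero => simp [cfConvergent]
  | succ n ih =>
    have h := (ih (a := fun i => a (i + 1)) (fun n => ha _)).1
    have h1 : (1 : ℝ) ≤ a (0 + 1) := by exact_mod_cast ha _
    have h2 : 1 ≤ cfConvergent n (fun i => a (i + 1)) := h1.trans h
    have h3 : 1 / cfConvergent n (fun i => a (i + 1)) ≤ 1 := by
      rw [div_le_one (by linarith)]; exact h2
    have h4 : 0 ≤ 1 / cfConvergent n (fun i => a (i + 1)) := by positivity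
    simp only [cfConvergent]
    constructor <;> linarith

lemma one_le_cfConvergent {a : ℕ → ℕ} (ha : ∀ n, 1 ≤ a n) (n : ℕ) :
    1 ≤ cfConvergent n a :=
  le_trans (by exact_mod_cast ha 0) (cfConvergent_bounds ha n).1

lemma abs_cfConvergent_sub_le {a : ℕ → ℕ} (ha : ∀ n, 1 ≤ a n) (N m n : ℕ)
    (hm : 2 * N ≤ m) (hn : 2 * N ≤ n) :
    |cfConvergent m a - cfConvergent n a| ≤ (1 / 4) ^ N := by
  induction N generalizing a m n with
  | zero =>
    have h1 := cfConvergent_bounds ha m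
    have h2 := cfConvergent_bounds ha n
    rw [abs_le]; constructor <;> simp <;> linarith
  | succ N ih =>
    obtain ⟨m, rfl⟩ : ∃ k, m = k + 2 := ⟨m - 2, by omega⟩
    obtain ⟨n, rfl⟩ : ∃ k, n = k + 2 := ⟨n - 2, by omega⟩
    have hp : ∀ n, 1 ≤ (fun i => a (i + 1 + 1)) n := fun n => ha _
    have h := ih hp m n (by omega) (by omega)
    have h2 := abs_two_step_le (p := a 0) (q := a 1) (by exact_mod_cast ha 1)
      (one_le_cfConvergent hp m) (one_le_cfConvergent hp n)
    simp only [cfConvergent]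
    refine h2.trans ?_
    rw [pow_succ]
    linarith

lemma tendsto_cfConvergent {a : ℕ → ℕ} (ha : ∀ n, 1 ≤ a n) :
    Tendsto (fun n => cfConvergent n a) atTop (𝓝 (cfValue a)) := by
  have hc : CauchySeq (fun n => cfConvergent n a) := by
    rw [Metric.cauchySeq_iff]
    intro ε hε
    obtain ⟨N, hN⟩ := exists_pow_lt_of_lt_one hε (by norm_num : (1 / 4 : ℝ) < 1)
    exact ⟨2 * N, fun m hm n hn =>
      lt_of_le_of_lt (abs_cfConvergent_sub_le ha N m n hm hn) hN⟩
  obtain ⟨l, hl⟩ := cauchySeq_tendsto_of_complete hc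
  rw [cfValue, hl.limUnder_eq]
  exact hl

lemma cfValue_ge {a : ℕ → ℕ} (ha : ∀ n, 1 ≤ a n) : (a 0 : ℝ) ≤ cfValue a :=
  ge_of_tendsto' (tendsto_cfConvergent ha) fun n => (cfConvergent_bounds ha n).1

lemma one_le_cfValue {a : ℕ → ℕ} (ha : ∀ n, 1 ≤ a n) : 1 ≤ cfValue a :=
  le_trans (by exact_mod_cast ha 0) (cfValue_ge ha)

lemma cfValue_eq {a : ℕ → ℕ} (ha : ∀ n, 1 ≤ a n) :
    cfValue a = a 0 + 1 / cfValue (fun i => a (i + 1)) := by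
  have h1 := (tendsto_cfConvergent ha).comp (tendsto_add_atTop_nat 1)
  have h2 := tendsto_cfConvergent (a := fun i => a (i + 1)) (fun n => ha _)
  have h3 : cfValue (fun i => a (i + 1)) ≠ 0 := by
    have := one_le_cfValue (a := fun i => a (i + 1)) (fun n => ha _)
    linarith
  have h4 := (h2.inv₀ h3).const_add (a 0 : ℝ)
  refine tendsto_nhds_unique h1 ?_
  simpa [cfConvergent, Function.comp_def] using h4

lemma isCF_cfValue {a : ℕ → ℕ} (ha : ∀ n, 1 ≤ a n) :
    IsCF a (fun n => cfValue (fun i => a (i + n))) := fun n => by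
  refine ⟨one_le_cfValue fun _ => ha _, ?_⟩
  have := cfValue_eq (a := fun i => a (i + n)) (fun _ => ha _)
  simpa only [zero_add, add_assoc, add_comm 1 n] using this

lemma one_lt_cfValue {a : ℕ → ℕ} (ha : ∀ n, 1 ≤ a n) : 1 < cfValue a := by
  have h := cfValue_eq ha
  have h1 := one_le_cfValue (a := fun i => a (i + 1)) (fun n => ha _)
  have h2 : 0 < 1 / cfValue (fun i => a (i + 1)) := by positivity
  have h3 : (1 : ℝ) ≤ a 0 := by exact_mod_cast ha 0
  linarith

lemma cfValue_lt {a : ℕ → ℕ} (ha : ∀ n, 1 ≤ a n) : cfValue a < a 0 + 1 := by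
  have h := cfValue_eq ha
  have h1 := one_lt_cfValue (a := fun i => a (i + 1)) (fun n => ha _)
  have h2 : 1 / cfValue (fun i => a (i + 1)) < 1 := by
    rw [div_lt_one (by linarith)]; exact h1
  linarith

lemma IsCF.abs_sub_le {a b : ℕ → ℕ} {x y : ℕ → ℝ} (ha : ∀ n, 1 ≤ a n) (hx : IsCF a x)
    (hy : IsCF b y) (N : ℕ) (hab : ∀ i < 2 * N + 1, a i = b i) :
    |x 0 - y 0| ≤ (1 / 4) ^ N := by
  induction N generalizing a b x y with
  | zero =>
    have h1 : 0 ≤ 1 / x 1 ∧ 1 / x 1 ≤ 1 := by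
      have := (hx 1).1
      exact ⟨by positivity, by rw [div_le_one (by linarith)]; exact this⟩
    have h2 : 0 ≤ 1 / y 1 ∧ 1 / y 1 ≤ 1 := by
      have := (hy 1).1
      exact ⟨by positivity, by rw [div_le_one (by linarith)]; exact this⟩
    rw [(hx 0).2, (hy 0).2, hab 0 (by omega), abs_le]
    simp only [zero_add, pow_zero]
    constructor <;> linarith
  | succ N ih =>
    have h := ih (fun n => ha (n + 2)) (hx.shift 2) (hy.shift 2)
      (fun i hi => hab (i + 2) (by omega))
    have h2 := abs_two_step_le (p := a 0) (q := a 1) (by exact_mod_cast ha 1)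
      (hx 2).1 (hy 2).1
    simp only [zero_add] at h
    rw [(hx 0).2, (hy 0).2, ← hab 0 (by omega), (hx (0 + 1)).2, (hy (0 + 1)).2,
      ← hab (0 + 1) (by omega)]
    simp only [zero_add, Nat.reduceAdd]
    refine h2.trans ?_
    rw [pow_succ]
    linarith

/-- By contraction the recursion for the complete quotients has only one solution with all terms at
least 1. It identifies the complete quotients of a real number and later forces a conjugate root
that never becomes negative to coincide with the first root. -/
lemma IsCF.eq_cfValue {a : ℕ → ℕ} {x : ℕ → ℝ} (ha : ∀ n, 1 ≤ a n) (hx : IsCF a x) :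
    x 0 = cfValue a := by
  have h : ∀ N, |x 0 - cfValue a| ≤ (1 / 4) ^ N := fun N => by
    simpa using hx.abs_sub_le ha (isCF_cfValue ha) N (fun _ _ => rfl)
  by_contra hne
  obtain ⟨N, hN⟩ := exists_pow_lt_of_lt_one (abs_pos.2 (sub_ne_zero.2 hne))
    (by norm_num : (1 / 4 : ℝ) < 1)
  exact absurd (h N) (not_le.2 hN)

lemma abs_cfValue_sub_le {a b : ℕ → ℕ} (ha : ∀ n, 1 ≤ a n) (hb : ∀ n, 1 ≤ b n) (N : ℕ)
    (hab : ∀ i < 2 * N + 1, a i = b i) : |cfValue a - cfValue b| ≤ (1 / 4) ^ N := by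
  simpa using (isCF_cfValue ha).abs_sub_le ha (isCF_cfValue hb) N hab

/-- Continued fractions are ordered by the alternating lexicographic order. -/
lemma cfValue_lt_of_prefix {a b : ℕ → ℕ} (ha : ∀ n, 1 ≤ a n) (hb : ∀ n, 1 ≤ b n) (n : ℕ)
    (hab : ∀ i < n, a i = b i)
    (h : cfValue (fun i => a (i + n)) < cfValue (fun i => b (i + n))) :
    (Even n → cfValue a < cfValue b) ∧ (Odd n → cfValue b < cfValue a) := by
  induction n generalizing a b with
  | zero => simpa using h
  | succ n ih =>
    have h1 := ih (a := fun i => a (i + 1)) (b := fun i => b (i + 1)) (fun n => ha _)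
      (fun n => hb _) (fun i hi => hab (i + 1) (by omega))
      (by simpa only [add_assoc, add_comm 1 n] using h)
    have h2 := one_le_cfValue (a := fun i => a (i + 1)) (fun n => ha _)
    have h3 := one_le_cfValue (a := fun i => b (i + 1)) (fun n => hb _)
    rw [cfValue_eq ha, cfValue_eq hb, hab 0 (by omega)]
    constructor
    · intro he
      have := h1.2 (by rw [← Nat.not_even_iff_odd]; intro h; exact (Nat.even_add_one.1 he) h)
      have := one_div_lt_one_div_of_lt (by linarith) this
      linarith
    · intro he
      have := h1.1 (by
        rw [← Nat.not_odd_iff_even]; intro h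
        exact (Nat.not_even_iff_odd.2 he) (h.add_odd odd_one))
      have := one_div_lt_one_div_of_lt (by linarith) this
      linarith

lemma cfValue_lt_of_lt {a b : ℕ → ℕ} (ha : ∀ n, 1 ≤ a n) (hb : ∀ n, 1 ≤ b n) (n : ℕ)
    (hab : ∀ i < n, a i = b i) (h : a n < b n) :
    (Even n → cfValue a < cfValue b) ∧ (Odd n → cfValue b < cfValue a) := by
  refine cfValue_lt_of_prefix ha hb n hab ?_
  have h1 := cfValue_lt (a := fun i => a (i + n)) (fun _ => ha _)
  have h2 := cfValue_ge (a := fun i => b (i + n)) (fun _ => hb _)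
  have h3 : (a (0 + n) : ℝ) + 1 ≤ b (0 + n) := by
    rw [zero_add]; exact_mod_cast h
  linarith

lemma cfValue_le_of_prefix {a b : ℕ → ℕ} (ha : ∀ n, 1 ≤ a n) (hb : ∀ n, 1 ≤ b n) (n : ℕ)
    (hab : ∀ i < n, a i = b i)
    (h : cfValue (fun i => a (i + n)) ≤ cfValue (fun i => b (i + n))) :
    (Even n → cfValue a ≤ cfValue b) ∧ (Odd n → cfValue b ≤ cfValue a) := by
  rcases h.lt_or_eq with h | h
  · have := cfValue_lt_of_prefix ha hb n hab h
    exact ⟨fun he => (this.1 he).le, fun he => (this.2 he).le⟩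
  · suffices cfValue a = cfValue b by simp [this]
    clear * - ha hb hab h
    induction n generalizing a b with
    | zero => simpa using h
    | succ n ih =>
      rw [cfValue_eq ha, cfValue_eq hb, hab 0 (by omega),
        ih (a := fun i => a (i + 1)) (b := fun i => b (i + 1)) (fun n => ha _)
          (fun n => hb _) (fun i hi => hab (i + 1) (by omega))
          (by simpa only [add_assoc, add_comm 1 n] using h)]

lemma cfValue_injective {a b : ℕ → ℕ} (ha : ∀ n, 1 ≤ a n) (hb : ∀ n, 1 ≤ b n)
    (h : cfValue a = cfValue b) : a = b := by
  by_contra hne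
  have hex : ∃ n, a n ≠ b n := by
    by_contra! hh; exact hne (funext hh)
  classical
  have hn := Nat.find_spec hex
  have hlt : ∀ i < Nat.find hex, a i = b i := fun i hi => by
    simpa using Nat.find_min hex hi
  rcases Nat.lt_or_gt_of_ne hn with h1 | h1
  · have := cfValue_lt_of_lt ha hb _ hlt h1
    rcases Nat.even_or_odd (Nat.find hex) with he | he
    · exact absurd h (this.1 he).ne
    · exact absurd h (this.2 he).ne'
  · have := cfValue_lt_of_lt hb ha _ (fun i hi => (hlt i hi).symm) h1
    rcases Nat.even_or_odd (Nat.find hex) with he | he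
    · exact absurd h (this.1 he).ne'
    · exact absurd h (this.2 he).ne

/-! ### Bi-infinite sequences -/

/-- The sequence `S i, S (i + 1), …`. -/
def rightSeq (S : ℤ → ℕ) (i : ℤ) : ℕ → ℕ := fun n => S (i + n)

/-- The sequence `S i, S (i - 1), …`. -/
def leftSeq (S : ℤ → ℕ) (i : ℤ) : ℕ → ℕ := fun n => S (i - n)

/-- The reversed sequence. -/
def rev (S : ℤ → ℕ) : ℤ → ℕ := fun n => S (-n)

/-- `λᵢ(S)`. -/
noncomputable def lam (S : ℤ → ℕ) (i : ℤ) : ℝ :=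
  cfValue (rightSeq S i) + 1 / cfValue (leftSeq S (i - 1))

lemma lambda0_eq_lam (S : ℤ → ℕ) : lambda0 S = lam S 0 := by
  have h1 : rightSeq S 0 = fun n : ℕ => S (n : ℤ) := by
    funext n; simp [rightSeq]
  have h2 : leftSeq S (0 - 1) = fun n : ℕ => S (-(n : ℤ) - 1) := by
    funext n; simp only [leftSeq]; congr 1; ring
  rw [lambda0, lam, h1, h2]

lemma rightSeq_add (S : ℤ → ℕ) (i : ℤ) (k : ℕ) :
    (fun n => rightSeq S i (n + k)) = rightSeq S (i + k) := by
  funext n; simp only [rightSeq]; congr 1; push_cast; ring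

lemma leftSeq_add (S : ℤ → ℕ) (i : ℤ) (k : ℕ) :
    (fun n => leftSeq S i (n + k)) = leftSeq S (i - k) := by
  funext n; simp only [leftSeq]; congr 1; push_cast; ring

lemma rightSeq_rev (S : ℤ → ℕ) (i : ℤ) : rightSeq (rev S) i = leftSeq S (-i) := by
  funext n; simp only [rightSeq, leftSeq, rev]; congr 1; ring

lemma leftSeq_rev (S : ℤ → ℕ) (i : ℤ) : leftSeq (rev S) i = rightSeq S (-i) := by
  funext n; simp only [rightSeq, leftSeq, rev]; congr 1; ring

@[simp] lemma rev_rev (S : ℤ → ℕ) : rev (rev S) = S := by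
  funext n; simp [rev]

section
variable {S : ℤ → ℕ}

lemma cfValue_rightSeq (hS : ∀ i, 1 ≤ S i) (i : ℤ) :
    cfValue (rightSeq S i) = S i + 1 / cfValue (rightSeq S (i + 1)) := by
  rw [cfValue_eq (a := rightSeq S i) (fun n => hS _)]
  have := rightSeq_add S i 1
  simp only [Nat.cast_one] at this
  rw [this]
  simp [rightSeq]

lemma cfValue_leftSeq (hS : ∀ i, 1 ≤ S i) (i : ℤ) :
    cfValue (leftSeq S i) = S i + 1 / cfValue (leftSeq S (i - 1)) := by
  rw [cfValue_eq (a := leftSeq S i) (fun n => hS _)]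
  have := leftSeq_add S i 1
  simp only [Nat.cast_one] at this
  rw [this]
  simp [leftSeq]

lemma lam_eq (hS : ∀ i, 1 ≤ S i) (i : ℤ) :
    lam S i = S i + 1 / cfValue (rightSeq S (i + 1)) + 1 / cfValue (leftSeq S (i - 1)) := by
  rw [lam, cfValue_rightSeq hS]

lemma lam_rev (hS : ∀ i, 1 ≤ S i) (i : ℤ) : lam (rev S) i = lam S (-i) := by
  rw [lam_eq (S := rev S) (fun i => hS _), lam_eq hS, rightSeq_rev, leftSeq_rev]
  rw [show -(i + 1) = -i - 1 by ring, show -(i - 1) = -i + 1 by ring]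
  simp only [rev]
  ring

lemma lam_shift (S : ℤ → ℕ) (k i : ℤ) : lam (fun n => S (n + k)) i = lam S (i + k) := by
  have h1 : rightSeq (fun n => S (n + k)) i = rightSeq S (i + k) := by
    funext n; simp only [rightSeq]; congr 1; ring
  have h2 : leftSeq (fun n => S (n + k)) (i - 1) = leftSeq S (i + k - 1) := by
    funext n; simp only [leftSeq]; congr 1; ring
  rw [lam, lam, h1, h2]

end

/-! ### Occurrences of finite words -/

/-- The word `w` stands in `S` at the positions `i, i + 1, …`. -/
def At (S : ℤ → ℕ) : ℤ → List ℕ → Prop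
  | _, [] => True
  | i, a :: w => S i = a ∧ At S (i + 1) w

/-- The word `w` is read in `S` at the positions `i, i - 1, …`. -/
def AtL (S : ℤ → ℕ) : ℤ → List ℕ → Prop
  | _, [] => True
  | i, a :: w => S i = a ∧ AtL S (i - 1) w

lemma at_append (S : ℤ → ℕ) (i : ℤ) (v w : List ℕ) :
    At S i (v ++ w) ↔ At S i v ∧ At S (i + v.length) w := by
  induction v generalizing i with
  | nil => simp [At]
  | cons a v ih =>
    simp only [List.cons_append, At, ih, List.length_cons, and_assoc]
    rw [show i + 1 + (v.length : ℤ) = i + ((v.length + 1 : ℕ) : ℤ) by push_cast; ring]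

lemma atL_append (S : ℤ → ℕ) (i : ℤ) (v w : List ℕ) :
    AtL S i (v ++ w) ↔ AtL S i v ∧ AtL S (i - v.length) w := by
  induction v generalizing i with
  | nil => simp [AtL]
  | cons a v ih =>
    simp only [List.cons_append, AtL, ih, List.length_cons, and_assoc]
    rw [show i - 1 - (v.length : ℤ) = i - ((v.length + 1 : ℕ) : ℤ) by push_cast; ring]

lemma atL_reverse (S : ℤ → ℕ) (i : ℤ) (w : List ℕ) :
    AtL S i w.reverse ↔ At S (i + 1 - w.length) w := by
  induction w generalizing i with
  | nil => simp [At, AtL]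
  | cons a w ih =>
    simp only [List.reverse_cons, atL_append, ih, List.length_reverse, AtL, and_true, At,
      List.length_cons]
    rw [show i + 1 - ((w.length + 1 : ℕ) : ℤ) + 1 = i + 1 - w.length by push_cast; ring,
      show i + 1 - ((w.length + 1 : ℕ) : ℤ) = i - w.length by push_cast; ring]
    exact and_comm

lemma at_rev (S : ℤ → ℕ) (i : ℤ) (w : List ℕ) : At (rev S) i w ↔ AtL S (-i) w := by
  induction w generalizing i with
  | nil => simp [At, AtL]
  | cons a w ih =>
    simp only [At, AtL, ih, rev]
    rw [show -(i + 1) = -i - 1 by ring]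

lemma at_rev_reverse (S : ℤ → ℕ) (i : ℤ) (w : List ℕ) :
    At (rev S) i w.reverse ↔ At S (-i + 1 - w.length) w := by
  rw [at_rev, atL_reverse]

lemma at_iff_getD (S : ℤ → ℕ) (i : ℤ) (w : List ℕ) :
    At S i w ↔ ∀ k < w.length, S (i + k) = w.getD k 0 := by
  induction w generalizing i with
  | nil => simp [At]
  | cons a w ih =>
    simp only [At, ih, List.length_cons]
    constructor
    · rintro ⟨h1, h2⟩ (_ | k) hk
      · simpa using h1
      · have := h2 k (by omega)
        simp only [List.getD_cons_succ, ← this]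
        congr 1; push_cast; ring
    · intro h
      refine ⟨by simpa using h 0 (by omega), fun k hk => ?_⟩
      have := h (k + 1) (by omega)
      simp only [List.getD_cons_succ] at this
      rw [← this]
      congr 1; push_cast; ring

lemma at_shift (S : ℤ → ℕ) (k i : ℤ) (w : List ℕ) :
    At (fun n => S (n + k)) i w ↔ At S (i + k) w := by
  induction w generalizing i with
  | nil => simp [At]
  | cons a w ih =>
    simp only [At, ih]
    rw [show i + 1 + k = i + k + 1 by ring]

lemma at_congr {S S' : ℤ → ℕ} {i i' : ℤ} {w : List ℕ}
    (h : ∀ k : ℕ, k < w.length → S (i + k) = S' (i' + k)) : At S i w ↔ At S' i' w := by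
  rw [at_iff_getD, at_iff_getD]
  exact forall₂_congr fun k hk => by rw [h k hk]

lemma At.isPrefixOf {S : ℤ → ℕ} {i : ℤ} {f w : List ℕ} (hf : At S i f) (hw : At S i w)
    (hl : f.length ≤ w.length) : f.isPrefixOf w = true := by
  induction f generalizing i w with
  | nil => simp
  | cons a f ih =>
    cases w with
    | nil => simp at hl
    | cons b w =>
      simp only [List.isPrefixOf, Bool.and_eq_true, beq_iff_eq]
      exact ⟨hf.1.symm.trans hw.1, ih hf.2 hw.2 (by simpa using hl)⟩

lemma At.of_isPrefixOf {S : ℤ → ℕ} {i : ℤ} {f w : List ℕ} (h : f.isPrefixOf w = true)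
    (hw : At S i w) : At S i f := by
  rw [List.isPrefixOf_iff_prefix] at h
  obtain ⟨t, rfl⟩ := h
  exact ((at_append S i f t).1 hw).1

lemma At.drop {S : ℤ → ℕ} {i : ℤ} {w : List ℕ} (hw : At S i w) (d : ℕ) (hd : d ≤ w.length) :
    At S (i + d) (w.drop d) := by
  have := (at_append S i (w.take d) (w.drop d)).1 (by rwa [List.take_append_drop])
  simpa [List.length_take, min_eq_left hd] using this.2

lemma At.take {S : ℤ → ℕ} {i : ℤ} {w : List ℕ} (hw : At S i w) (d : ℕ) :
    At S i (w.take d) :=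
  ((at_append S i (w.take d) (w.drop d)).1 (by rwa [List.take_append_drop])).1

/-- `f` is a block of `w`. -/
def infx (f : List ℕ) : List ℕ → Bool
  | [] => f.isPrefixOf []
  | a :: w => f.isPrefixOf (a :: w) || infx f w

lemma At.of_infx {S : ℤ → ℕ} {i : ℤ} {f w : List ℕ} (h : infx f w = true) (hw : At S i w) :
    ∃ k, At S k f := by
  induction w generalizing i with
  | nil => exact ⟨i, At.of_isPrefixOf h hw⟩
  | cons a w ih =>
    simp only [infx, Bool.or_eq_true] at h
    rcases h with h | h
    · exact ⟨i, At.of_isPrefixOf h hw⟩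
    · exact ih h hw.2

/-! ### Bounds from finite windows -/

/-- Bounds (numerator, denominator, numerator, denominator) of `[0; r, …]` for continuations
of `r` with letters `1`, `2`, `3`. -/
def cfB : List ℕ → ℕ × ℕ × ℕ × ℕ
  -- With letters at most 3 an unknown tail is at least `1/4`, hence at most `1/(1 + 1/4) = 4/5`.
  -- Each further letter inverts, so lower and upper bound change places.
  | [] => (1, 4, 4, 5)
  | a :: r => match cfB r with
    | (n₁, d₁, n₂, d₂) => (d₂, a * d₂ + n₂, d₁, a * d₁ + n₁)

/-- The letters of `S` are `1`, `2`, `3`. -/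
def Ternary (S : ℤ → ℕ) : Prop := ∀ i, S i = 1 ∨ S i = 2 ∨ S i = 3

lemma Ternary.pos {S : ℤ → ℕ} (hS : Ternary S) (i : ℤ) : 1 ≤ S i := by
  rcases hS i with h | h | h <;> omega

lemma Ternary.le {S : ℤ → ℕ} (hS : Ternary S) (i : ℤ) : S i ≤ 3 := by
  rcases hS i with h | h | h <;> omega

lemma Ternary.reversed {S : ℤ → ℕ} (hS : Ternary S) : Ternary (rev S) := fun _ => hS _

lemma cfValue_rightSeq_bounds {S : ℤ → ℕ} (hS : Ternary S) (i : ℤ) :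
    1 / 4 ≤ 1 / cfValue (rightSeq S i) ∧ 1 / cfValue (rightSeq S i) ≤ 4 / 5 := by
  have key : ∀ i, 1 / 4 ≤ 1 / cfValue (rightSeq S i) := fun i => by
    have h1 := cfValue_lt (a := rightSeq S i) (fun n => hS.pos _)
    have h2 := one_le_cfValue (a := rightSeq S i) (fun n => hS.pos _)
    have h3 : (rightSeq S i 0 : ℝ) ≤ 3 := by exact_mod_cast hS.le _
    exact one_div_le_one_div_of_le (by linarith) (by linarith)
  refine ⟨key i, ?_⟩
  have h1 : (1 : ℝ) ≤ S i := by exact_mod_cast hS.pos i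
  have h2 := key (i + 1)
  rw [cfValue_rightSeq hS.pos, div_le_div_iff₀ (by linarith) (by norm_num)]
  linarith

lemma cfB_spec {S : ℤ → ℕ} (hS : Ternary S) (i : ℤ) (r : List ℕ) (hr : At S i r) :
    0 < (cfB r).1 ∧ 0 < (cfB r).2.1 ∧ 0 < (cfB r).2.2.1 ∧ 0 < (cfB r).2.2.2 ∧
    ((cfB r).1 : ℝ) / (cfB r).2.1 ≤ 1 / cfValue (rightSeq S i) ∧
    1 / cfValue (rightSeq S i) ≤ ((cfB r).2.2.1 : ℝ) / (cfB r).2.2.2 := by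
  induction r generalizing i with
  | nil =>
    have := cfValue_rightSeq_bounds hS i
    simp only [cfB]
    norm_num
    norm_num at this
    exact this
  | cons a r ih =>
    obtain ⟨h0, h1, h2, h3, h4, h5⟩ := ih (i + 1) hr.2
    have ha : 1 ≤ a := hr.1 ▸ hS.pos i
    rw [cfValue_rightSeq hS.pos, hr.1]
    simp only [cfB]
    generalize cfB r = c at *
    obtain ⟨n₁, d₁, n₂, d₂⟩ := c
    simp only at *
    have ha' : (1 : ℝ) ≤ a := by exact_mod_cast ha
    have hd1 : (0 : ℝ) < d₁ := by exact_mod_cast h1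
    have hd2 : (0 : ℝ) < d₂ := by exact_mod_cast h3
    have hn1 : (0 : ℝ) < n₁ := by exact_mod_cast h0
    have hn2 : (0 : ℝ) < n₂ := by exact_mod_cast h2
    refine ⟨h3, by positivity, h1, by positivity, ?_, ?_⟩
    · have : (d₂ : ℝ) / ((a * d₂ + n₂ : ℕ) : ℝ) = 1 / (a + n₂ / d₂) := by
        push_cast; field_simp
      rw [this]
      exact one_div_le_one_div_of_le (by have := one_lt_cfValue (a := rightSeq S (i+1)) (fun n => hS.pos _); positivity) (by linarith)
    · have : (d₁ : ℝ) / ((a * d₁ + n₁ : ℕ) : ℝ) = 1 / (a + n₁ / d₁) := by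
        push_cast; field_simp
      rw [this]
      exact one_div_le_one_div_of_le (by positivity) (by linarith)

lemma cfB_spec_left {S : ℤ → ℕ} (hS : Ternary S) (i : ℤ) (l : List ℕ) (hl : AtL S i l) :
    0 < (cfB l).2.1 ∧ 0 < (cfB l).2.2.2 ∧
    ((cfB l).1 : ℝ) / (cfB l).2.1 ≤ 1 / cfValue (leftSeq S i) ∧
    1 / cfValue (leftSeq S i) ≤ ((cfB l).2.2.1 : ℝ) / (cfB l).2.2.2 := by
  have h := cfB_spec hS.reversed (-i) l (by rw [at_rev]; simpa using hl)
  rw [rightSeq_rev, neg_neg] at h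
  exact ⟨h.2.1, h.2.2.2.1, h.2.2.2.2⟩

/-- The window with centre `a`, left part `l` (read to the left) and right part `r` forces
`λ ≥ N / D`. -/
def lamGe (N D : ℕ) (l : List ℕ) (a : ℕ) (r : List ℕ) : Bool :=
  match cfB l, cfB r with
  | (n₁, d₁, _, _), (m₁, e₁, _, _) => Nat.ble (N * (d₁ * e₁)) (D * (a * (d₁ * e₁) + (n₁ * e₁ + m₁ * d₁)))

/-- The window with centre `a`, left part `l` (read to the left) and right part `r` forces
`λ ≤ N / D`. -/
def lamLe (N D : ℕ) (l : List ℕ) (a : ℕ) (r : List ℕ) : Bool :=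
  match cfB l, cfB r with
  | (_, _, n₂, d₂), (_, _, m₂, e₂) => Nat.ble (D * (a * (d₂ * e₂) + (n₂ * e₂ + m₂ * d₂))) (N * (d₂ * e₂))

lemma lamGe_spec {S : ℤ → ℕ} (hS : Ternary S) {N D : ℕ} (hD : 0 < D) {i : ℤ} {l r : List ℕ}
    {a : ℕ} (ha : S i = a) (hl : AtL S (i - 1) l) (hr : At S (i + 1) r)
    (h : lamGe N D l a r = true) : (N : ℝ) / D ≤ lam S i := by
  obtain ⟨h1, -, h2, -⟩ := cfB_spec_left hS _ l hl
  obtain ⟨-, h3, -, -, h4, -⟩ := cfB_spec hS _ r hr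
  rw [lam_eq hS.pos, ha]
  refine le_trans ?_ (by linarith : (a : ℝ) + ((cfB r).1 : ℝ) / (cfB r).2.1 +
    ((cfB l).1 : ℝ) / (cfB l).2.1 ≤ _)
  rcases hc : cfB l with ⟨n₁, d₁, n₂, d₂⟩
  rcases he : cfB r with ⟨m₁, e₁, m₂, e₂⟩
  rw [hc] at h1 h2
  rw [he] at h3 h4
  simp only [lamGe, hc, he] at h
  simp only at *
  replace h := Nat.le_of_ble_eq_true h
  have h' : (N : ℝ) * (d₁ * e₁) ≤ D * (a * (d₁ * e₁) + (n₁ * e₁ + m₁ * d₁)) := by exact_mod_cast h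
  have hd1 : (0 : ℝ) < d₁ := by exact_mod_cast h1
  have he1 : (0 : ℝ) < e₁ := by exact_mod_cast h3
  have hD' : (0 : ℝ) < D := by exact_mod_cast hD
  have : (a : ℝ) + (m₁ : ℝ) / e₁ + n₁ / d₁ = (a * (d₁ * e₁) + (n₁ * e₁ + m₁ * d₁)) / (d₁ * e₁) := by
    field_simp; ring
  rw [this, div_le_div_iff₀ hD' (by positivity)]
  linarith

lemma lamLe_spec {S : ℤ → ℕ} (hS : Ternary S) {N D : ℕ} (hD : 0 < D) {i : ℤ} {l r : List ℕ}
    {a : ℕ} (ha : S i = a) (hl : AtL S (i - 1) l) (hr : At S (i + 1) r)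
    (h : lamLe N D l a r = true) : lam S i ≤ (N : ℝ) / D := by
  obtain ⟨-, h1, -, h2⟩ := cfB_spec_left hS _ l hl
  obtain ⟨-, -, -, h3, -, h4⟩ := cfB_spec hS _ r hr
  rw [lam_eq hS.pos, ha]
  refine le_trans (by linarith : _ ≤ (a : ℝ) + ((cfB r).2.2.1 : ℝ) / (cfB r).2.2.2 +
    ((cfB l).2.2.1 : ℝ) / (cfB l).2.2.2) ?_
  rcases hc : cfB l with ⟨n₂, d₂, n₁, d₁⟩
  rcases he : cfB r with ⟨m₂, e₂, m₁, e₁⟩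
  rw [hc] at h1 h2
  rw [he] at h3 h4
  simp only [lamLe, hc, he] at h
  simp only at *
  replace h := Nat.le_of_ble_eq_true h
  have h' : D * (a * (d₁ * e₁) + (n₁ * e₁ + m₁ * d₁)) ≤ (N : ℝ) * (d₁ * e₁) := by exact_mod_cast h
  have hd1 : (0 : ℝ) < d₁ := by exact_mod_cast h1
  have he1 : (0 : ℝ) < e₁ := by exact_mod_cast h3
  have hD' : (0 : ℝ) < D := by exact_mod_cast hD
  have : (a : ℝ) + (m₁ : ℝ) / e₁ + n₁ / d₁ = (a * (d₁ * e₁) + (n₁ * e₁ + m₁ * d₁)) / (d₁ * e₁) := by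
    field_simp; ring
  rw [this, div_le_div_iff₀ (by positivity) hD']
  linarith

/-- Some letter `3` of the window has `λ ≥ N / D`. -/
def lamHits (N D : ℕ) : List ℕ → List ℕ → Bool
  | _, [] => false
  -- Only a letter 3 can reach `J`: elsewhere `λ ≤ 2 + 4/5 + 4/5 = 3.6`.
  | l, a :: r => (Nat.beq a 3 && lamGe N D l a r) || lamHits N D (a :: l) r

lemma lamHits_spec {S : ℤ → ℕ} (hS : Ternary S) {N D : ℕ} (hD : 0 < D) {i : ℤ} {l r : List ℕ}
    (hl : AtL S (i - 1) l) (hr : At S i r)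
    (h : lamHits N D l r = true) : ∃ k, (N : ℝ) / D ≤ lam S k := by
  induction r generalizing i l with
  | nil => simp [lamHits] at h
  | cons a r ih =>
    simp only [lamHits, Bool.or_eq_true, Bool.and_eq_true] at h
    rcases h with h | h
    · exact ⟨i, lamGe_spec hS hD hr.1 hl hr.2 h.2⟩
    · exact ih (i := i + 1) (l := a :: l)
        (show AtL S (i + 1 - 1) (a :: l) by rw [add_sub_cancel_right]; exact ⟨hr.1, hl⟩) hr.2 h

/-! ### Exhaustive search over windows -/

/-- Starting from the window `w` with centre at offset `c`, extend it letter by letter, to the left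
(`true`) or to the right (`false`) as the schedule says; every branch has to end in a window
with the property `leaf`. -/
def search (leaf : ℕ → List ℕ → Bool) : List Bool → ℕ → List ℕ → Bool
  | [], c, w => leaf c w
  | true :: s, c, w => leaf c w ||
    (search leaf s (c + 1) (1 :: w) && search leaf s (c + 1) (2 :: w) &&
      search leaf s (c + 1) (3 :: w))
  | false :: s, c, w => leaf c w ||
    (search leaf s c (w ++ [1]) && search leaf s c (w ++ [2]) && search leaf s c (w ++ [3]))

lemma search_spec {S : ℤ → ℕ} (hS : Ternary S) {leaf : ℕ → List ℕ → Bool} {p : ℤ} {Q : Prop}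
    (hend : ∀ (c : ℕ) w, At S (p - c) w → leaf c w = true → Q) (s : List Bool) (c : ℕ) (w : List ℕ)
    (hw : At S (p - c) w) (h : search leaf s c w = true) : Q := by
  induction s generalizing c w with
  | nil => exact hend c w hw h
  | cons b s ih =>
    cases b
    · simp only [search, Bool.or_eq_true, Bool.and_eq_true] at h
      rcases h with h | ⟨⟨h1, h2⟩, h3⟩
      · exact hend c w hw h
      · have key : ∀ a, S (p - c + w.length) = a → At S (p - c) (w ++ [a]) := fun a ha => by
          rw [at_append]; exact ⟨hw, ha, trivial⟩
        rcases hS (p - c + w.length) with h' | h' | h'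
        · exact ih c _ (key _ h') h1
        · exact ih c _ (key _ h') h2
        · exact ih c _ (key _ h') h3
    · simp only [search, Bool.or_eq_true, Bool.and_eq_true] at h
      rcases h with h | ⟨⟨h1, h2⟩, h3⟩
      · exact hend c w hw h
      · have key : ∀ a, S (p - (c + 1 : ℕ)) = a → At S (p - (c + 1 : ℕ)) (a :: w) := fun a ha =>
          ⟨ha, by rwa [show p - ((c + 1 : ℕ) : ℤ) + 1 = p - c by push_cast; ring]⟩
        rcases hS (p - (c + 1 : ℕ)) with h' | h' | h'
        · exact ih (c + 1) _ (key _ h') h1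
        · exact ih (c + 1) _ (key _ h') h2
        · exact ih (c + 1) _ (key _ h') h3

instance decidableAt (S : ℤ → ℕ) : ∀ (i : ℤ) (w : List ℕ), Decidable (At S i w)
  | _, [] => isTrue trivial
  | i, a :: w => @instDecidableAnd (S i = a) (At S (i + 1) w) _ (decidableAt S (i + 1) w)

/-- Window test: the window `w` with centre at offset `c` forces `λ ≤ N / D` at the centre. -/
def centreLe (N D c : ℕ) (w : List ℕ) : Bool :=
  match w.drop c with
  | [] => false
  | a :: r => lamLe N D (w.take c).reverse a r

lemma window_split {S : ℤ → ℕ} {p : ℤ} {c : ℕ} {w r : List ℕ} {a : ℕ}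
    (hw : At S (p - c) w) (h : w.drop c = a :: r) :
    S p = a ∧ AtL S (p - 1) (w.take c).reverse ∧ At S (p + 1) r := by
  have hc : c < w.length := by
    by_contra hc
    rw [List.drop_eq_nil_of_le (by omega)] at h
    cases h
  rw [← List.take_append_drop c w, at_append, h, List.length_take, min_eq_left hc.le,
    sub_add_cancel] at hw
  refine ⟨hw.2.1, ?_, hw.2.2⟩
  rw [atL_reverse, List.length_take, min_eq_left hc.le, sub_add_cancel]
  exact hw.1

lemma centreLe_spec {S : ℤ → ℕ} (hS : Ternary S) {N D : ℕ} (hD : 0 < D) {p : ℤ} {c : ℕ}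
    {w : List ℕ} (hw : At S (p - c) w) (h : centreLe N D c w = true) : lam S p ≤ (N : ℝ) / D := by
  rcases hd : w.drop c with _ | ⟨a, r⟩
  · simp [centreLe, hd] at h
  · obtain ⟨h1, h2, h3⟩ := window_split hw hd
    simp only [centreLe, hd] at h
    exact lamLe_spec hS hD h1 h2 h3 h

/-- Window test: the window `w` with centre at offset `c` forces `λ ≥ N / D` at the centre. -/
def centreGe (N D c : ℕ) (w : List ℕ) : Bool :=
  match w.drop c with
  | [] => false
  | a :: r => lamGe N D (w.take c).reverse a r

lemma centreGe_spec {S : ℤ → ℕ} (hS : Ternary S) {N D : ℕ} (hD : 0 < D) {p : ℤ} {c : ℕ}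
    {w : List ℕ} (hw : At S (p - c) w) (h : centreGe N D c w = true) : (N : ℝ) / D ≤ lam S p := by
  rcases hd : w.drop c with _ | ⟨a, r⟩
  · simp [centreGe, hd] at h
  · obtain ⟨h1, h2, h3⟩ := window_split hw hd
    simp only [centreGe, hd] at h
    exact lamGe_spec hS hD h1 h2 h3 h

/-- The word `f` stands in the window `w` at the offset `c - k`. -/
def hasAt (f : List ℕ) (k c : ℕ) (w : List ℕ) : Bool :=
  Nat.ble k c && f.isPrefixOf (w.drop (c - k))

lemma hasAt_spec {S : ℤ → ℕ} {p : ℤ} {f w : List ℕ} {k c : ℕ} (hf : f ≠ [])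
    (hw : At S (p - c) w) (h : hasAt f k c w = true) : At S (p - k) f := by
  simp only [hasAt, Bool.and_eq_true] at h
  have hk := Nat.le_of_ble_eq_true h.1
  have hl : c - k ≤ w.length := by
    by_contra hl
    rw [List.drop_eq_nil_of_le (by omega), List.isPrefixOf_iff_prefix, List.prefix_nil] at h
    exact hf h.2
  have := hw.drop (c - k) hl
  rw [show p - (c : ℤ) + ((c - k : ℕ) : ℤ) = p - k by push_cast [hk]; ring] at this
  exact this.of_isPrefixOf h.2

/-- The word `f` stands in the window `w` at the offset `c + k`. -/
def hasAfter (f : List ℕ) (k c : ℕ) (w : List ℕ) : Bool := f.isPrefixOf (w.drop (c + k))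

lemma hasAfter_spec {S : ℤ → ℕ} {p : ℤ} {f w : List ℕ} {k c : ℕ} (hf : f ≠ [])
    (hw : At S (p - c) w) (h : hasAfter f k c w = true) : At S (p + k) f := by
  simp only [hasAfter] at h
  have hl : c + k ≤ w.length := by
    by_contra hl
    rw [List.drop_eq_nil_of_le (by omega), List.isPrefixOf_iff_prefix, List.prefix_nil] at h
    exact hf h
  have := hw.drop (c + k) hl
  rw [show p - (c : ℤ) + ((c + k : ℕ) : ℤ) = p + k by push_cast; ring] at this
  exact this.of_isPrefixOf h

/-! ### The eventually periodic sequences of the theorem -/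

lemma mem_ternary_getD {p : List ℕ} (hp : ∀ a ∈ p, a = 1 ∨ a = 2 ∨ a = 3) {k : ℕ}
    (hk : k < p.length) : p.getD k 0 = 1 ∨ p.getD k 0 = 2 ∨ p.getD k 0 = 3 := by
  rw [List.getD_eq_getElem _ _ hk]
  exact hp _ (List.getElem_mem hk)

lemma ternary_biSeq {p w : List ℕ} {k : ℕ} {x : ℕ → ℕ} (hp0 : p ≠ [])
    (hp : ∀ a ∈ p, a = 1 ∨ a = 2 ∨ a = 3) (hw : ∀ a ∈ w, a = 1 ∨ a = 2 ∨ a = 3)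
    (hx : ∀ n, x n = 1 ∨ x n = 2 ∨ x n = 3) : Ternary (biSeq p w k x) := by
  intro n
  have hlen : 0 < p.length := List.length_pos_iff.2 hp0
  simp only [biSeq, prepend]
  split_ifs with h1 h2
  · have h3 := Int.emod_nonneg (n + k) (b := (p.length : ℤ)) (by omega)
    have h4 := Int.emod_lt_of_pos (n + k) (b := (p.length : ℤ)) (by omega)
    exact mem_ternary_getD hp (by omega)
  · exact mem_ternary_getD hw h2
  · exact hx _

lemma ternary_periodic {p : List ℕ} (hp0 : p ≠ []) (hp : ∀ a ∈ p, a = 1 ∨ a = 2 ∨ a = 3) (n : ℕ) :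
    periodic p n = 1 ∨ periodic p n = 2 ∨ periodic p n = 3 :=
  mem_ternary_getD hp (Nat.mod_lt _ (List.length_pos_iff.2 hp0))

/-- The `ω₁`-periodic sequence. -/
def seq0 : ℤ → ℕ := biSeq omega1 omega1 4 (periodic omega1)

/-- The sequence defining `J`. -/
def seqJ : ℤ → ℕ :=
  biSeq [2, 1] ([1, 1, 1, 1] ++ omega1 ++ omega1 ++ omega1 ++ omega1 ++ [2, 1, 2, 2] ++ [1, 2, 1, 2])
    17 (periodic [3, 3, 3, 2, 1, 2])

/-- The sequence defining `j`. -/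
def seqj : ℤ → ℕ :=
  biSeq omega1 (omega1 ++ omega1 ++ omega1 ++ [2, 1, 2, 2]) 13 (periodic [1, 2])

lemma ternary_seq0 : Ternary seq0 :=
  ternary_biSeq (by decide) (by decide) (by decide) (ternary_periodic (by decide) (by decide))

lemma ternary_seqJ : Ternary seqJ :=
  ternary_biSeq (by decide) (by decide) (by decide) (ternary_periodic (by decide) (by decide))

lemma ternary_seqj : Ternary seqj :=
  ternary_biSeq (by decide) (by decide) (by decide) (ternary_periodic (by decide) (by decide))

/-- The window of radius `m` of `S` around `0`. -/
def windowOf (S : ℤ → ℕ) (m : ℕ) : List ℕ := (List.range (2 * m + 1)).map fun n : ℕ => S ((n : ℤ) - m)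

lemma at_windowOf (S : ℤ → ℕ) (m : ℕ) : At S (0 - (m : ℕ)) (windowOf S m) := by
  rw [at_iff_getD]
  intro k hk
  simp only [windowOf, List.length_map, List.length_range] at hk
  simp only [windowOf, List.getD_eq_getElem?_getD, List.getElem?_map, List.getElem?_range hk]
  simp only [Option.map_some, Option.getD_some]
  congr 1; ring

/-- Denominator of the rational approximations. -/
def scale : ℕ := 1000000000000000000000
/-- `J` rounded up. -/
def numJ : ℕ := 3676699417255182253921
/-- `j₀` rounded down. -/
def num0 : ℕ := 3676699417246755742047
/-- A number between `j₀` and `j`. -/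
def numMid : ℕ := 3676699417250000000000

/-! ### Rational bounds separating `j₀`, `j` and `J`. -/

lemma scale_pos : 0 < scale := by decide

lemma jL_eq : jL = lam seqJ 0 := lambda0_eq_lam _
lemma j0_eq : j0 = lam seq0 0 := lambda0_eq_lam _
lemma jM_eq : jM = lam seqj 0 := lambda0_eq_lam _

lemma jL_le : jL ≤ (numJ : ℝ) / scale := by
  rw [jL_eq]
  exact centreLe_spec ternary_seqJ scale_pos (at_windowOf _ 50) (by decide +kernel)

lemma le_j0 : (num0 : ℝ) / scale ≤ j0 := by
  rw [j0_eq]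
  exact centreGe_spec ternary_seq0 scale_pos (at_windowOf _ 50) (by decide +kernel)

lemma j0_lt_mid : j0 ≤ (numMid : ℝ) / scale := by
  rw [j0_eq]
  exact centreLe_spec ternary_seq0 scale_pos (at_windowOf _ 30) (by decide +kernel)

lemma mid_lt_jM : ((numMid + 1 : ℕ) : ℝ) / scale ≤ jM := by
  rw [jM_eq]
  exact centreGe_spec ternary_seqj scale_pos (at_windowOf _ 30) (by decide +kernel)

/-- A lower bound for `J` that separates it from the values of the theorem. -/
def numJlow : ℕ := 3676699417255182253000

lemma le_jL : (numJlow : ℝ) / scale ≤ jL := by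
  rw [jL_eq]
  exact centreGe_spec ternary_seqJ scale_pos (at_windowOf _ 40) (by decide +kernel)

lemma jM_lt : jM ≤ ((numJlow - 1 : ℕ) : ℝ) / scale := by
  rw [jM_eq]
  exact centreLe_spec ternary_seqj scale_pos (at_windowOf _ 40) (by decide +kernel)

lemma j0_lt_jM : j0 < jM := by
  refine j0_lt_mid.trans_lt (lt_of_lt_of_le ?_ mid_lt_jM)
  have : (0 : ℝ) < scale := by exact_mod_cast scale_pos
  gcongr
  omega

lemma jM_lt_jL : jM < jL := by
  refine jM_lt.trans_lt (lt_of_lt_of_le ?_ le_jL)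
  have : (0 : ℝ) < scale := by exact_mod_cast scale_pos
  gcongr
  decide

/-! ### The finite checks -/

/-- The words of the list `F̃₁` and their transposes. -/
def forbiddenSym : List (List ℕ) := forbiddenBase ++ forbiddenBase.map List.reverse

/-- `S` contains none of the words of `forbiddenSym`. -/
def Avoids (S : ℤ → ℕ) : Prop := ∀ f ∈ forbiddenSym, ∀ k, ¬ At S k f

def schedRL : ℕ → List Bool
  | 0 => []
  | n + 1 => false :: true :: schedRL n

def schedLR : ℕ → List Bool
  | 0 => []
  | n + 1 => true :: false :: schedLR n

/-- `S` is ternary with all `λᵢ(S) < J`. -/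
def Below (S : ℤ → ℕ) : Prop := Ternary S ∧ ∀ i, lam S i < jL

lemma Below.reversed {S : ℤ → ℕ} (h : Below S) : Below (rev S) :=
  ⟨h.1.reversed, fun i => by rw [lam_rev h.1.pos]; exact h.2 _⟩

lemma Below.not_hits {S : ℤ → ℕ} (h : Below S) {i : ℤ} {w : List ℕ} (hw : At S i w) :
    lamHits numJ scale [] w = false := by
  by_contra hne
  rw [Bool.not_eq_false] at hne
  obtain ⟨k, hk⟩ := lamHits_spec h.1 scale_pos (i := i) (l := []) trivial hw hne
  exact absurd (h.2 k) (not_lt.2 (jL_le.trans hk))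

/-- With at most five more letters on either side, every continuation of a word of the list contains
a 3 at which `λ` reaches the upper approximation of `J`. -/
lemma forbiddenBase_search :
    ∀ f ∈ forbiddenBase, search (fun _ w => lamHits numJ scale [] w) (schedRL 5) 0 f = true := by
  decide +kernel

lemma Below.not_at_base {S : ℤ → ℕ} (h : Below S) {f : List ℕ} (hf : f ∈ forbiddenBase) (k : ℤ) :
    ¬ At S k f := fun hk =>
  search_spec (p := k) h.1
    (fun c w hw hs => by
      have := h.not_hits hw
      rw [this] at hs; cases hs)
    _ 0 f (by simpa using hk) (forbiddenBase_search f hf)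

lemma Below.avoids {S : ℤ → ℕ} (h : Below S) : Avoids S := by
  intro f hf k hk
  rcases List.mem_append.1 hf with hf | hf
  · exact h.not_at_base hf k hk
  · obtain ⟨g, hg, rfl⟩ := List.mem_map.1 hf
    refine h.reversed.not_at_base hg (-k + 1 - g.reverse.length) ?_
    have := (at_rev_reverse S (-k + 1 - g.reverse.length) g.reverse)
    rw [List.reverse_reverse] at this
    rw [this]
    convert hk using 1
    ring

lemma forbiddenSym_reverse {f : List ℕ} (hf : f ∈ forbiddenSym) : f.reverse ∈ forbiddenSym := by
  rcases List.mem_append.1 hf with hf | hf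
  · exact List.mem_append.2 (Or.inr (List.mem_map_of_mem hf))
  · obtain ⟨g, hg, rfl⟩ := List.mem_map.1 hf
    rw [List.reverse_reverse]
    exact List.mem_append.2 (Or.inl hg)

lemma Avoids.reversed {S : ℤ → ℕ} (h : Avoids S) : Avoids (rev S) := fun f hf k hk => by
  have := at_rev_reverse S k f.reverse
  rw [List.reverse_reverse] at this
  exact h _ (forbiddenSym_reverse hf) _ (this.1 hk)

lemma Avoids.not_infx {S : ℤ → ℕ} (h : Avoids S) {i : ℤ} {w : List ℕ} (hw : At S i w) :
    (forbiddenSym.any fun f => infx f w) = false := by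
  by_contra hne
  rw [Bool.not_eq_false, List.any_eq_true] at hne
  obtain ⟨f, hf, hfw⟩ := hne
  obtain ⟨k, hk⟩ := hw.of_infx hfw
  exact h f hf k hk

/-- A branch ends with a forbidden word, with a bound below `j₀` at the centre, or with the
self-replicating word or its transpose around the centre. The number 8 is the offset of the starred
3 in `2111ω₁2123`. The word has 17 letters, so the offset is the same in the transpose. -/
def centreStop (c : ℕ) (w : List ℕ) : Bool :=
  (forbiddenSym.any fun f => infx f w) || centreLe num0 scale c w ||
    hasAt selfRep 8 c w || hasAt selfRep.reverse 8 c w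

lemma centre_search : ([1, 2, 3].all fun a => search centreStop (schedRL 8) 0 [a]) = true := by
  decide +kernel

/-- Values above `j₀` are taken only at the centres of the self-replicating word and of its
transpose. -/
lemma selfRep_of_lt_lam {S : ℤ → ℕ} (hS : Ternary S) (hA : Avoids S) {p : ℤ} (h : j0 < lam S p) :
    At S (p - 8) selfRep ∨ At S (p - 8) selfRep.reverse := by
  refine search_spec (p := p) hS (leaf := centreStop) ?_ (schedRL 8) 0 [S p] (by simp [At]) ?_
  · intro c w hw hs
    simp only [centreStop, Bool.or_eq_true, hA.not_infx hw] at hs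
    rcases hs with ((hs | hs) | hs) | hs
    · cases hs
    · exact absurd h (not_lt.2 ((centreLe_spec hS scale_pos hw hs).trans le_j0))
    · exact Or.inl (hasAt_spec (by decide) hw hs)
    · exact Or.inr (hasAt_spec (by decide) hw hs)
  · have := List.all_eq_true.1 centre_search (S p)
      (by rcases hS p with h | h | h <;> simp [h])
    exact this

/-- The word on which the exact comparison with `J` takes place. -/
def wordJ : List ℕ :=
  [1, 1, 1, 1] ++ omega1 ++ omega1 ++ omega1 ++ omega1 ++ wordP

/-- The shift 9 is one block `ω₁`. Besides contradictions, only two endings are accepted: a copy of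
the word one block further left, or `wordJ`, in which `1111` precedes the blocks. -/
def repStop (c : ℕ) (w : List ℕ) : Bool :=
  (forbiddenSym.any fun f => infx f w) || lamHits numJ scale [] w ||
    hasAt selfRep 9 c w || hasAt wordJ 9 c w

lemma rep_search : search repStop (schedLR 24) 0 selfRep = true := by
  decide +kernel

/-- Continuation to the right. The known blocks end at 13, where one more block must follow; after
it comes either `2123`, which completes the copy of the self-replicating word starting at 9, or
`21221212`. -/
def nextStop (c : ℕ) (w : List ℕ) : Bool :=
  (forbiddenSym.any fun f => infx f w) || lamHits numJ scale [] w ||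
    hasAfter selfRep 9 c w || hasAfter (omega1 ++ wordP) 13 c w

lemma next_search : search nextStop (List.replicate 15 false) 14
    (omega1 ++ omega1 ++ omega1 ++ [2, 1, 2, 3]) = true := by
  decide +kernel

lemma Below.selfRep_or_wordJ {S : ℤ → ℕ} (h : Below S) {k : ℤ} (hk : At S k selfRep) :
    At S (k - 9) selfRep ∨ At S (k - 9) wordJ := by
  refine search_spec (p := k) h.1 (leaf := repStop) ?_ _ 0 selfRep (by simpa using hk) rep_search
  intro c w hw hs
  simp only [repStop, Bool.or_eq_true, h.avoids.not_infx hw, h.not_hits hw] at hs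
  rcases hs with ((hs | hs) | hs) | hs
  · cases hs
  · cases hs
  · exact Or.inl (hasAt_spec (by decide) hw hs)
  · exact Or.inr (hasAt_spec (by decide) hw hs)

lemma Below.next {S : ℤ → ℕ} (h : Below S) {k : ℤ}
    (hk : At S (k - 14) (omega1 ++ omega1 ++ omega1 ++ [2, 1, 2, 3])) :
    At S (k + 9) selfRep ∨ At S (k + 13) (omega1 ++ wordP) := by
  refine search_spec (p := k) h.1 (leaf := nextStop) ?_ _ 14 _ (by simpa using hk) next_search
  intro c w hw hs
  simp only [nextStop, Bool.or_eq_true, h.avoids.not_infx hw, h.not_hits hw] at hs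
  rcases hs with ((hs | hs) | hs) | hs
  · cases hs
  · cases hs
  · exact Or.inl (hasAfter_spec (by decide) hw hs)
  · exact Or.inr (hasAfter_spec (by decide) hw hs)

/-! ### Extremal tails -/

/-- In the alternating order small letters are wanted at even and large ones at odd places. The
greedy choice is 1, then 2, because `13` is excluded. -/
lemma cfValue_periodic12_le {x : ℕ → ℕ} (hx : ∀ n, x n = 1 ∨ x n = 2 ∨ x n = 3)
    (h13 : ∀ n, x n = 1 → x (n + 1) ≠ 3) : cfValue (periodic [1, 2]) ≤ cfValue x := by
  by_cases hex : ∃ n, periodic [1, 2] n ≠ x n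
  · classical
    set n := Nat.find hex with hn
    have h1 : periodic [1, 2] n ≠ x n := Nat.find_spec hex
    have h2 : ∀ i < n, periodic [1, 2] i = x i := fun i hi => by
      simpa using Nat.find_min hex hi
    have hp : ∀ n, 1 ≤ periodic [1, 2] n := fun n => by
      rcases ternary_periodic (p := [1, 2]) (by decide) (by decide) n with h | h | h <;> omega
    have hx1 : ∀ n, 1 ≤ x n := fun n => by rcases hx n with h | h | h <;> omega
    rcases Nat.even_or_odd n with he | ho
    · have h3 : periodic [1, 2] n = 1 := by
        simp [periodic, Nat.even_iff.1 he]
      exact ((cfValue_lt_of_lt hp hx1 n h2 (by have := hx1 n; omega)).1 he).le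
    · have h3 : periodic [1, 2] n = 2 := by
        simp [periodic, Nat.odd_iff.1 ho]
      have h4 : periodic [1, 2] (n - 1) = 1 := by
        simp [periodic, show (n - 1) % 2 = 0 by have := Nat.odd_iff.1 ho; omega]
      have hpos : 0 < n := ho.pos
      have h5 := h13 (n - 1) ((h2 (n - 1) (by omega)).symm.trans h4)
      rw [Nat.sub_add_cancel hpos] at h5
      have h6 : x n < periodic [1, 2] n := by rcases hx n with h | h | h <;> omega
      exact ((cfValue_lt_of_lt hx1 hp n (fun i hi => (h2 i hi).symm) h6).2 ho).le
  · push Not at hex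
    rw [funext hex]

lemma Avoids.not_at {S : ℤ → ℕ} (h : Avoids S) (k : ℤ) (f : List ℕ) (hf : f ∈ forbiddenSym) :
    ¬ At S k f := h f hf k

/-- Greedy maximisation: the largest letter at even and the smallest at odd places. The excluded
words `31`, `232`, `322`, `323`, `333211` block every better choice. The preceding letter 2 is what
makes `232` apply at the second place of the first period; later periods end in 2 themselves. -/
lemma cfValue_le_periodic333212 {S : ℤ → ℕ} (hS : Ternary S) (hA : Avoids S) {i : ℤ}
    (hi : S (i - 1) = 2) : cfValue (rightSeq S i) ≤ cfValue (periodic [3, 3, 3, 2, 1, 2]) := by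
  set p := periodic [3, 3, 3, 2, 1, 2] with hpdef
  by_cases hex : ∃ n, p n ≠ rightSeq S i n
  · classical
    set n := Nat.find hex with hn
    have h1 : p n ≠ rightSeq S i n := Nat.find_spec hex
    have h2 : ∀ j < n, p j = rightSeq S i j := fun j hj => by
      simpa using Nat.find_min hex hj
    have hp : ∀ n, 1 ≤ p n := fun n => by
      rcases ternary_periodic (p := [3, 3, 3, 2, 1, 2]) (by decide) (by decide) n with h | h | h <;>
        rw [hpdef] <;> omega
    have hx1 : ∀ n, 1 ≤ rightSeq S i n := fun n => hS.pos _
    have hprev : ∀ d, d ≤ n → 1 ≤ d → S (i + n - d) = p (n - d) := fun d hd hd1 => by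
      rw [h2 (n - d) (by omega), rightSeq]
      congr 1; push_cast [hd]; ring
    have hval : ∀ m, p m = [3, 3, 3, 2, 1, 2].getD (m % 6) 0 := fun m => rfl
    have lt_case : Even n → rightSeq S i n < p n → cfValue (rightSeq S i) ≤ cfValue p :=
      fun he hl => ((cfValue_lt_of_lt hx1 hp n (fun i hi => (h2 i hi).symm) hl).1 he).le
    have gt_case : Odd n → p n < rightSeq S i n → cfValue (rightSeq S i) ≤ cfValue p :=
      fun he hl => ((cfValue_lt_of_lt hp hx1 n h2 hl).2 he).le
    have hSn : rightSeq S i n = S (i + n) := rfl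
    have h3 := hS (i + n)
    have hr : n % 6 < 6 := Nat.mod_lt _ (by norm_num)
    interval_cases hr6 : n % 6
    · have hpn : p n = 3 := by rw [hval, hr6]; rfl
      exact lt_case (by rw [Nat.even_iff]; omega) (by omega)
    · exfalso
      have hpn : p n = 3 := by rw [hval, hr6]; rfl
      have h4 : S (i + n - 1) = 3 := by
        have := hprev 1 (by omega) le_rfl
        rwa [hval, show (n - 1) % 6 = 0 by omega] at this
      have h5 : S (i + n - 2) = 2 := by
        rcases Nat.lt_or_ge n 2 with hlt | hge
        · have : n = 1 := by omega
          rw [← hi]; congr 1; rw [this]; push_cast; ring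
        · have := hprev 2 hge (by omega)
          rwa [hval, show (n - 2) % 6 = 5 by omega] at this
      rcases h3 with h | h | h
      · exact hA.not_at (i + n - 1) [3, 1] (by decide) ⟨h4, by simpa using h, trivial⟩
      · refine hA.not_at (i + n - 2) [2, 3, 2] (by decide) ⟨h5, ?_, ?_, trivial⟩
        · rw [← h4]; congr 1; ring
        · rw [← h]; congr 1; ring
      · omega
    · have hpn : p n = 3 := by rw [hval, hr6]; rfl
      exact lt_case (by rw [Nat.even_iff]; omega) (by omega)
    · have hpn : p n = 2 := by rw [hval, hr6]; rfl
      have h4 : S (i + n - 1) = 3 := by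
        have := hprev 1 (by omega) le_rfl
        rwa [hval, show (n - 1) % 6 = 2 by omega] at this
      rcases h3 with h | h | h
      · exact absurd ⟨h4, by simpa using h, trivial⟩
          (hA.not_at (i + n - 1) [3, 1] (by decide))
      · omega
      · exact gt_case (by rw [Nat.odd_iff]; omega) (by omega)
    · exfalso
      have hpn : p n = 1 := by rw [hval, hr6]; rfl
      have h4 : S (i + n - 1) = 2 := by
        have := hprev 1 (by omega) le_rfl
        rwa [hval, show (n - 1) % 6 = 3 by omega] at this
      have h5 : S (i + n - 2) = 3 := by
        have := hprev 2 (by omega) (by omega)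
        rwa [hval, show (n - 2) % 6 = 2 by omega] at this
      have h6 : S (i + n - 2 + 1) = 2 := by rw [← h4]; congr 1; ring
      have h7 : S (i + n - 2 + 1 + 1) = S (i + n) := by congr 1; ring
      rcases h3 with h | h | h
      · omega
      · exact hA.not_at (i + n - 2) [3, 2, 2] (by decide) ⟨h5, h6, h7.trans h, trivial⟩
      · exact hA.not_at (i + n - 2) [3, 2, 3] (by decide) ⟨h5, h6, h7.trans h, trivial⟩
    · have hpn : p n = 2 := by rw [hval, hr6]; rfl
      rcases h3 with h | h | h
      · exfalso
        refine hA.not_at (i + n - 5) [3, 3, 3, 2, 1, 1] (by decide) ?_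
        rw [at_iff_getD]
        intro k hk
        simp only [List.length_cons, List.length_nil] at hk
        rcases Nat.lt_or_ge k 5 with hk5 | hk5
        · have := hprev (5 - k) (by omega) (by omega)
          rw [hval, show (n - (5 - k)) % 6 = k by omega] at this
          rw [show i + (n : ℤ) - 5 + k = i + n - ((5 - k : ℕ) : ℤ) by push_cast [hk5.le]; ring, this]
          interval_cases k <;> rfl
        · obtain rfl : k = 5 := by omega
          rw [show i + (n : ℤ) - 5 + (5 : ℕ) = i + n by push_cast; ring, h]
          rfl
      · omega
      · exact gt_case (by rw [Nat.odd_iff]; omega) (by omega)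
  · push Not at hex
    rw [funext hex]

lemma Avoids.leftSeq_ne {S : ℤ → ℕ} (hA : Avoids S) (i : ℤ) (n : ℕ) (h : leftSeq S i n = 1) :
    leftSeq S i (n + 1) ≠ 3 := fun h3 => by
  refine hA.not_at (i - (n + 1 : ℕ)) [3, 1] (by decide) ⟨h3, ?_, trivial⟩
  exact (congrArg S (by push_cast; ring)).trans h

lemma Avoids.rightSeq_ne {S : ℤ → ℕ} (hA : Avoids S) (i : ℤ) (n : ℕ) (h : rightSeq S i n = 1) :
    rightSeq S i (n + 1) ≠ 3 := fun h3 => by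
  refine hA.not_at (i + n) [1, 3] (by decide) ⟨h, ?_, trivial⟩
  rw [← h3, rightSeq]; congr 1; push_cast; ring

/-! ### The exact comparison with `J` -/

lemma at_biSeq (p w : List ℕ) (k : ℕ) (x : ℕ → ℕ) : At (biSeq p w k x) (-k) w := by
  rw [at_iff_getD]
  intro n hn
  simp [biSeq, prepend, hn]

lemma rightSeq_biSeq (p w : List ℕ) (k : ℕ) (x : ℕ → ℕ) :
    rightSeq (biSeq p w k x) (w.length - k) = x := by
  funext n
  have h : (w.length : ℤ) - k + n + k = w.length + n := by ring
  simp only [rightSeq, biSeq, prepend, h]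
  rw [if_neg (by omega), if_neg (by omega)]
  congr 1; omega

/-- Two sequences with the same word `w` at `i` and `i'`: comparison of `λ` inside the word. -/
lemma lam_le_lam {S S' : ℤ → ℕ} (hS' : ∀ i, 1 ≤ S' i) {i i' : ℤ}
    (h1 : cfValue (rightSeq S i) ≤ cfValue (rightSeq S' i'))
    (h2 : cfValue (leftSeq S' (i' - 1)) ≤ cfValue (leftSeq S (i - 1))) : lam S i ≤ lam S' i' := by
  have := one_lt_cfValue (a := leftSeq S' (i' - 1)) (fun n => hS' _)
  have := one_div_le_one_div_of_le (by linarith) h2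
  rw [lam, lam]
  linarith

lemma At.eq_at {S S' : ℤ → ℕ} {i i' : ℤ} {w : List ℕ} (h : At S i w) (h' : At S' i' w)
    {k : ℕ} (hk : k < w.length) : S (i + k) = S' (i' + k) := by
  rw [at_iff_getD] at h h'
  rw [h k hk, h' k hk]

/-- No finite window can decide this branch, since `seqJ` itself contains `wordJ` and has value `J`
there. Instead the tails are compared exactly: those of `seqJ` are extremal among tails without
forbidden words. The place 17 is the centre of the second block. -/
lemma jL_le_lam_of_wordJ {S : ℤ → ℕ} (hS : Ternary S) (hA : Avoids S) {k : ℤ}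
    (hk : At S k wordJ) : jL ≤ lam S (k + 17) := by
  rw [jL_eq]
  have hJ : At seqJ (-17) wordJ := at_biSeq _ _ _ _
  have hlen : wordJ.length = 48 := by decide
  have heq : ∀ m : ℕ, m < 48 → seqJ (-17 + m) = S (k + m) := fun m hm =>
    hJ.eq_at hk (by omega)
  have hlast : S (k + 48 - 1) = 2 := by
    have := (at_iff_getD _ _ _).1 hk 47 (by omega)
    rw [show k + 48 - 1 = k + (47 : ℕ) by push_cast; ring, this]
    decide
  refine lam_le_lam hS.pos ?_ ?_
  -- From the centre on there are 31 common letters, and 17 before it. Both numbers are odd, so the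
  -- order is reversed: the largest right tail gives the smallest right part. On the left the
  -- smallest tail gives the largest continued fraction, and hence the smallest reciprocal.
  · refine (cfValue_le_of_prefix (a := rightSeq S (k + 17)) (b := rightSeq seqJ 0)
      (fun n => hS.pos _) (fun n => ternary_seqJ.pos _) 31 ?_ ?_).2 (by decide)
    · intro m hm
      have := heq (m + 17) (by omega)
      simp only [rightSeq]
      rw [show (0 : ℤ) + m = -17 + (m + 17 : ℕ) by push_cast; ring, this]
      congr 1; push_cast; ring
    · rw [rightSeq_add, rightSeq_add]
      have h1 : rightSeq seqJ (0 + (31 : ℕ)) = periodic [3, 3, 3, 2, 1, 2] :=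
        rightSeq_biSeq [2, 1] _ 17 _
      rw [h1, show k + 17 + ((31 : ℕ) : ℤ) = k + 48 by push_cast; ring]
      exact cfValue_le_periodic333212 hS hA hlast
  · refine (cfValue_le_of_prefix (a := leftSeq seqJ (0 - 1)) (b := leftSeq S (k + 17 - 1))
      (fun n => ternary_seqJ.pos _) (fun n => hS.pos _) 17 ?_ ?_).2 (by decide)
    · intro m hm
      have := heq (16 - m) (by omega)
      simp only [leftSeq]
      rw [show (0 : ℤ) - 1 - m = -17 + (16 - m : ℕ) by push_cast [show m ≤ 16 by omega]; ring, this]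
      congr 1; push_cast [show m ≤ 16 by omega]; ring
    · rw [leftSeq_add, leftSeq_add]
      have h1 : leftSeq seqJ (0 - 1 - (17 : ℕ)) = periodic [1, 2] := by
        funext n
        simp only [leftSeq, seqJ, biSeq, periodic]
        rw [if_pos (by push_cast; omega)]
        rcases Nat.mod_two_eq_zero_or_one n with h | h
        · rw [show ((0 - 1 - ((17 : ℕ) : ℤ) - n + (17 : ℕ)) % (([2, 1] : List ℕ).length : ℤ)).toNat = 1 by
            simp only [List.length_cons, List.length_nil]; push_cast; omega]
          simp [h]
        · rw [show ((0 - 1 - ((17 : ℕ) : ℤ) - n + (17 : ℕ)) % (([2, 1] : List ℕ).length : ℤ)).toNat = 0 by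
            simp only [List.length_cons, List.length_nil]; push_cast; omega]
          simp [h]
      rw [h1]
      exact cfValue_periodic12_le (fun n => hS _) (fun n => hA.leftSeq_ne _ n)

/-- The word `2111 ω₁ 2123` replicates itself to the left. -/
lemma Below.selfRep_sub {S : ℤ → ℕ} (h : Below S) {k : ℤ} (hk : At S k selfRep) :
    At S (k - 9) selfRep := by
  rcases h.selfRep_or_wordJ hk with h1 | h1
  · exact h1
  · exact absurd (h.2 _) (not_lt.2 (jL_le_lam_of_wordJ h.1 h.avoids h1))

/-! ### Sequences that are `ω₁`-periodic to the left -/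

/-- The `ω₁`-periodic sequence with a block starting at `0`. -/
def per9 (n : ℤ) : ℕ := omega1.getD (n % 9).toNat 0

lemma per9_add (n m : ℤ) : per9 (n + 9 * m) = per9 n := by simp [per9]

/-- To the left of `q` the sequence `S` is `… ω₁ ω₁ ω₁`. -/
def LeftPer (S : ℤ → ℕ) (q : ℤ) : Prop := ∀ n < q, S n = per9 (n - q)

lemma per9_omega1 : At per9 0 omega1 := by decide

lemma LeftPer.add {S : ℤ → ℕ} {q : ℤ} (h : LeftPer S q) (h1 : At S q omega1) :
    LeftPer S (q + 9) := fun n hn => by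
  rw [← per9_add (n - (q + 9)) 1]
  rcases lt_or_ge n q with hq | hq
  · rw [h n hq]; congr 1; ring
  · have := h1.eq_at per9_omega1 (k := (n - q).toNat) (by
      simp only [omega1, List.length_cons, List.length_nil]; omega)
    rw [show q + ((n - q).toNat : ℤ) = n by omega] at this
    rw [this]; congr 1; omega

lemma LeftPer.at_iff {S : ℤ → ℕ} {q k : ℤ} {f : List ℕ} (h : LeftPer S q)
    (hk : k + f.length ≤ q) : At S k f ↔ At per9 ((k - q) % 9) f :=
  at_congr fun m hm => by
    rw [h _ (by omega), ← per9_add ((k - q) % 9 + m) ((k - q) / 9)]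
    congr 1; omega

/-- Four blocks `ω₁`. -/
def fourBlocks : List ℕ := omega1 ++ omega1 ++ omega1 ++ omega1

lemma per9_fourBlocks : At per9 0 fourBlocks := by decide

lemma LeftPer.at_fourBlocks {S : ℤ → ℕ} {q : ℤ} (h : LeftPer S q) : At S (q - 36) fourBlocks := by
  rw [h.at_iff (by simp [fourBlocks, omega1])]
  rw [show (q - 36 - q) % 9 = 0 by omega]
  exact per9_fourBlocks

lemma LeftPer.isPrefixOf {S : ℤ → ℕ} {q k : ℤ} {f : List ℕ} (h : LeftPer S q)
    (hk : k + f.length ≤ q) (hf : f.length ≤ 17) (hat : At S k f) :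
    f.isPrefixOf (fourBlocks.drop ((k - q) % 9).toNat) = true := by
  have h1 := (h.at_iff hk).1 hat
  have h2 := per9_fourBlocks.drop ((k - q) % 9).toNat (by simp [fourBlocks, omega1]; omega)
  rw [zero_add, show (((k - q) % 9).toNat : ℤ) = (k - q) % 9 by omega] at h2
  exact h1.isPrefixOf h2 (by simp [fourBlocks, omega1]; omega)

/-- `S = … ω₁ ω₁ ω₁ 21221212 …`, where `21221212` stands at `q`. -/
def Str (S : ℤ → ℕ) (q : ℤ) : Prop := LeftPer S q ∧ At S q wordP

lemma Str.at_window {S : ℤ → ℕ} {q : ℤ} (h : Str S q) : At S (q - 36) (fourBlocks ++ wordP) := by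
  rw [at_append]
  refine ⟨h.1.at_fourBlocks, ?_⟩
  rw [show q - 36 + (fourBlocks.length : ℤ) = q by simp [fourBlocks, omega1]]
  exact h.2

lemma infx_of_isPrefixOf_drop {f w : List ℕ} (hf : f ≠ []) (d : ℕ)
    (h : f.isPrefixOf (w.drop d) = true) : infx f w = true := by
  induction w generalizing d with
  | nil =>
    rw [List.drop_nil, List.isPrefixOf_iff_prefix, List.prefix_nil] at h
    exact absurd h hf
  | cons a w ih =>
    simp only [infx, Bool.or_eq_true]
    cases d with
    | zero => exact Or.inl h
    | succ d => exact Or.inr (ih d h)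

/-- A word across the border of the periodic part lies in a known window. -/
lemma Str.cross {S : ℤ → ℕ} {q k : ℤ} {f : List ℕ} (h : Str S q) (hk : k < q)
    (hkf : q < k + f.length) (hf : f.length ≤ 17) (hP : infx wordP f = false) (hat : At S k f) :
    k + f.length ≤ q + 8 ∧
      f.isPrefixOf ((fourBlocks ++ wordP).drop (k - q + 36).toNat) = true := by
  have hle : k + f.length ≤ q + 8 := by
    by_contra hgt
    have h1 := hat.drop (q - k).toNat (by omega)
    rw [show k + ((q - k).toNat : ℤ) = q by omega] at h1
    have h2 := h.2.isPrefixOf h1 (by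
      rw [List.length_drop, show wordP.length = 8 from rfl]; omega)
    rw [infx_of_isPrefixOf_drop (by decide) _ h2] at hP
    cases hP
  refine ⟨hle, ?_⟩
  have h1 := h.at_window.drop (k - q + 36).toNat (by
    simp [fourBlocks, omega1, wordP]; omega)
  rw [show q - 36 + ((k - q + 36).toNat : ℤ) = k by omega] at h1
  exact hat.isPrefixOf h1 (by simp [fourBlocks, omega1, wordP]; omega)

/-- The test that the word `f` cannot start in the periodic part of a sequence
`… ω₁ ω₁ 21221212 …`. -/
def noCross (f : List ℕ) : Bool :=
  Nat.ble f.length 17 && !infx wordP f &&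
    (List.range 9).all (fun d => !f.isPrefixOf (fourBlocks.drop d)) &&
    -- A word of at most 17 letters that crosses the border starts at one of the 17 places before
    -- it. The periodic part of the window has 36 letters, so the first of these places has offset
    -- 19.
    (List.range 17).all (fun d => !f.isPrefixOf ((fourBlocks ++ wordP).drop (d + 19)))

lemma Str.not_at {S : ℤ → ℕ} {q k : ℤ} {f : List ℕ} (h : Str S q) (hf : noCross f = true)
    (hk : k < q) : ¬ At S k f := by
  intro hat
  simp only [noCross, Bool.and_eq_true, List.all_eq_true, List.mem_range, Bool.not_eq_true'] at hf
  obtain ⟨⟨⟨h1, h2⟩, h3⟩, h4⟩ := hf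
  replace h1 := Nat.le_of_ble_eq_true h1
  rcases le_or_gt (k + f.length) q with hle | hgt
  · have := h.1.isPrefixOf hle h1 hat
    rw [h3 _ (by omega)] at this
    cases this
  · have := (h.cross hk hgt h1 h2 hat).2
    have h5 := h4 (k - q + 17).toNat (by omega)
    rw [show (k - q + 17).toNat + 19 = (k - q + 36).toNat by omega, this] at h5
    cases h5

/-- Consequently admissibility of a `Str` sequence concerns only the part from `21221212` on, which
is why `C` and `D` test no more than that. -/
lemma noCross_forbiddenSym : ∀ f ∈ forbiddenSym, noCross f = true := by decide +kernel

lemma noCross_selfRep_reverse : noCross selfRep.reverse = true := by decide +kernel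

lemma selfRep_periodic_residue : ∀ d < 9,
    selfRep.isPrefixOf (fourBlocks.drop d) = true → d = 5 := by decide +kernel

lemma selfRep_reverse_periodic : ∀ d < 9,
    selfRep.reverse.isPrefixOf (fourBlocks.drop d) = false := by decide +kernel

lemma selfRep_cross : ∀ d < 36,
    selfRep.isPrefixOf ((fourBlocks ++ wordP).drop d) = true → d = 5 ∨ d = 14 := by decide +kernel

lemma Str.selfRep_pos {S : ℤ → ℕ} {q k : ℤ} (h : Str S q) (hk : k < q) (hat : At S k selfRep) :
    ∃ m : ℕ, k = q - 22 - 9 * m := by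
  have hl : selfRep.length = 17 := by decide
  rcases le_or_gt (k + selfRep.length) q with hle | hgt
  · have := selfRep_periodic_residue _ (by omega) (h.1.isPrefixOf hle hl.le hat)
    exact ⟨((q - 22 - k) / 9).toNat, by omega⟩
  · have := (h.cross hk hgt hl.le (by decide) hat).2
    rcases selfRep_cross _ (by omega) this with h | h
    · exact ⟨1, by omega⟩
    · exact ⟨0, by omega⟩

/-! ### The structure theorem -/

lemma Below.selfRep_sub_mul {S : ℤ → ℕ} (h : Below S) {k : ℤ} (hk : At S k selfRep) (m : ℕ) :
    At S (k - 9 * m) selfRep := by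
  induction m with
  | zero => simpa using hk
  | succ m ih =>
    have := h.selfRep_sub ih
    rwa [show k - 9 * (m : ℤ) - 9 = k - 9 * ((m + 1 : ℕ) : ℤ) by push_cast; ring] at this

/-- The blocks `ω₁` inside the copies, each starting four letters into its copy, tile the line to
the left without gaps. The block of the first copy ends before `k + 13`. -/
lemma leftPer_of_selfRep {S : ℤ → ℕ} {k : ℤ} (hk : ∀ m : ℕ, At S (k - 9 * m) selfRep) :
    LeftPer S (k + 13) := by
  intro n hn
  have h1 : At S (k - 9 * ((k + 12 - n) / 9).toNat + 4) omega1 := by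
    have := (hk ((k + 12 - n) / 9).toNat).drop 4 (by decide)
    exact At.of_isPrefixOf (by decide) this
  have := h1.eq_at per9_omega1 (k := ((n - k - 4) % 9).toNat) (by
    rw [show omega1.length = 9 from rfl]; omega)
  rw [show k - 9 * (((k + 12 - n) / 9).toNat : ℤ) + 4 + (((n - k - 4) % 9).toNat : ℤ) = n by omega]
    at this
  rw [this, ← per9_add (n - (k + 13)) (((k + 12 - n) / 9 + 1))]
  congr 1
  omega

lemma seq0_eq (n : ℤ) : seq0 n = per9 (n + 4) := by
  simp only [seq0, biSeq, prepend, per9, periodic]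
  split_ifs with h1 h2
  · rfl
  · rw [show omega1.length = 9 from rfl] at h2
    congr 1; omega
  · rw [show omega1.length = 9 from rfl] at h2 ⊢
    congr 1
    push_cast at *
    omega

/-- A sequence with all `λᵢ < J` and some `λᵢ > j₀` in which the self-replicating word occurs. -/
lemma Below.str_of_selfRep {S : ℤ → ℕ} (h : Below S) {k : ℤ} (hk : At S k selfRep) {i : ℤ}
    (hi : j0 < lam S i) : ∃ q, Str S q := by
  -- If the copies also continue for ever to the right, `S` is `ω₁`-periodic. A place with `λ > j₀`
  -- must then be the centre of a block, where the value is exactly `j₀`, or of a transposed word,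
  -- which the periodic sequence does not contain. Otherwise the last copy is followed by a block
  -- and `21221212`.
  by_cases hall : ∀ m : ℕ, At S (k + 9 * m) selfRep
  · exfalso
    have hL : ∀ m : ℕ, LeftPer S (k + 9 * m + 13) := fun m =>
      leftPer_of_selfRep (h.selfRep_sub_mul (hall m))
    have hL' := hL (i + 30 - k).toNat
    have hl : selfRep.length = 17 := by decide
    have hl' : selfRep.reverse.length = 17 := by decide
    rcases selfRep_of_lt_lam h.1 h.avoids hi with h1 | h1
    · have h2 := selfRep_periodic_residue _ (by omega) (hL'.isPrefixOf (by omega) hl.le h1)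
      have heq : (fun n => S (n + i)) = seq0 := by
        funext n
        have hL2 := hL (i + 30 - k + n.natAbs).toNat
        rw [seq0_eq, hL2 (n + i) (by omega), per9, per9]
        congr 2
        omega
      have := lam_shift S i 0
      rw [heq, ← j0_eq, zero_add] at this
      exact absurd hi (by rw [this]; exact lt_irrefl _)
    · have := hL'.isPrefixOf (by omega) hl'.le h1
      rw [selfRep_reverse_periodic _ (by omega)] at this
      cases this
  · push Not at hall
    classical
    obtain ⟨m, hm1, hm2⟩ : ∃ m : ℕ, At S (k + 9 * m) selfRep ∧ ¬ At S (k + 9 * m + 9) selfRep := by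
      set m := Nat.find hall with hm
      have h1 : ¬ At S (k + 9 * m) selfRep := Nat.find_spec hall
      have h0 : m ≠ 0 := fun h0 => h1 (by simpa [h0] using hk)
      refine ⟨m - 1, not_not.1 (Nat.find_min hall (m := m - 1) (by omega)), ?_⟩
      rwa [show k + 9 * ((m - 1 : ℕ) : ℤ) + 9 = k + 9 * m by
        push_cast [Nat.one_le_iff_ne_zero.2 h0]; ring]
    set k' := k + 9 * (m : ℤ)
    have hL : LeftPer S (k' + 13) := leftPer_of_selfRep (h.selfRep_sub_mul hm1)
    have h1 : At S (k' - 14) (omega1 ++ omega1 ++ omega1 ++ [2, 1, 2, 3]) := by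
      rw [at_append]
      constructor
      · have := hL.at_fourBlocks.drop 9 (by decide)
        rw [show k' + 13 - 36 + ((9 : ℕ) : ℤ) = k' - 14 by push_cast; ring] at this
        exact this
      · have := hm1.drop 13 (by decide)
        rw [show k' - 14 + ((omega1 ++ omega1 ++ omega1).length : ℤ) = k' + (13 : ℕ) by
          simp [omega1]; ring]
        exact this
    rcases h.next h1 with h2 | h2
    · exact absurd h2 hm2
    · rw [at_append] at h2
      refine ⟨k' + 13 + 9, hL.add h2.1, ?_⟩
      simpa [omega1] using h2.2

lemma at_rev_of_at {S : ℤ → ℕ} {i : ℤ} {w : List ℕ} (h : At S i w) :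
    At (rev S) (-i + 1 - w.length) w.reverse := by
  rw [at_rev_reverse]
  convert h using 1
  ring

/-- Classification of the sequences with all `λᵢ < J` and some `λᵢ > j₀`. -/
lemma Below.str_or_str_rev {S : ℤ → ℕ} (h : Below S) {i : ℤ} (hi : j0 < lam S i) :
    (∃ q, Str S q) ∨ ∃ q, Str (rev S) q := by
  rcases selfRep_of_lt_lam h.1 h.avoids hi with h1 | h1
  · exact Or.inl (h.str_of_selfRep h1 hi)
  · refine Or.inr (h.reversed.str_of_selfRep (k := -(i - 8) + 1 - selfRep.reverse.length) ?_ (i := -i) ?_)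
    · simpa using at_rev_of_at h1
    · rw [lam_rev h.1.pos]; simpa using hi

/-! ### Values at the centres -/

section
variable {S : ℤ → ℕ} {q : ℤ}

lemma Str.lam_lt_jL (hS : Ternary S) (h : Str S q) : lam S (q - 14) < jL := by
  have hw := h.at_window
  rw [show q - 36 = q - 14 - (22 : ℕ) by push_cast; ring] at hw
  have h1 := centreLe_spec hS (N := numJlow - 1) scale_pos hw (by decide +kernel)
  refine h1.trans_lt (lt_of_lt_of_le ?_ le_jL)
  have : (0 : ℝ) < scale := by exact_mod_cast scale_pos
  gcongr
  decide

lemma LeftPer.leftSeq_eq {S' : ℤ → ℕ} {q' i i' : ℤ} (h : LeftPer S q) (h' : LeftPer S' q')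
    (hi : i < q) (hi' : i' < q') (heq : (i - q) % 9 = (i' - q') % 9) :
    leftSeq S i = leftSeq S' i' := by
  funext n
  simp only [leftSeq]
  rw [h _ (by omega), h' _ (by omega), per9, per9]
  congr 2
  omega

lemma leftPer_seqj : LeftPer seqj 14 := by
  have h0 : LeftPer seqj (-13) := fun n hn => by
    simp only [seqj, biSeq, per9]
    rw [if_pos (by push_cast; omega)]
    congr 2
  have h1 : At seqj (-13) (omega1 ++ omega1 ++ omega1 ++ [2, 1, 2, 2]) := at_biSeq _ _ _ _
  rw [at_append, at_append, at_append] at h1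
  exact ((h0.add h1.1.1.1).add h1.1.1.2).add h1.1.2

/-- The pasts agree, and so do the 18 letters from the centre through `2122`. After this even number
of letters the smallest tail gives the smallest value, and this tail is `1212…`. -/
lemma Str.jM_le_lam (hS : Ternary S) (hA : Avoids S) (h : Str S q) : jM ≤ lam S (q - 14) := by
  rw [jM_eq]
  refine lam_le_lam hS.pos ?_ ?_
  · refine (cfValue_le_of_prefix (a := rightSeq seqj 0) (b := rightSeq S (q - 14))
      (fun n => ternary_seqj.pos _) (fun n => hS.pos _) 18 ?_ ?_).1 (by decide)
    · intro m hm
      simp only [rightSeq]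
      rcases lt_or_ge m 14 with hm1 | hm1
      · rw [leftPer_seqj _ (by omega), h.1 _ (by omega)]
        congr 1; ring
      · have h1 : At seqj 14 [2, 1, 2, 2] := by decide
        have h2 : At S q [2, 1, 2, 2] := At.of_isPrefixOf (by decide) h.2
        have := h1.eq_at h2 (k := m - 14) (by simp; omega)
        rw [show (14 : ℤ) + (m - 14 : ℕ) = 0 + m by omega] at this
        rw [this]
        congr 1; omega
    · rw [rightSeq_add, rightSeq_add]
      have h1 : rightSeq seqj (0 + (18 : ℕ)) = periodic [1, 2] :=
        rightSeq_biSeq omega1 _ 13 _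
      rw [h1]
      exact cfValue_periodic12_le (fun n => hS _) (fun n => hA.rightSeq_ne _ n)
  · exact (congrArg cfValue (h.1.leftSeq_eq leftPer_seqj (by omega) (by omega) (by omega))).le

/-- Earlier centres have the same past. The first difference on the right is at the odd index 17,
where the last but one block sees the 2 of `2122` and the earlier ones see the 3 of `2123`. -/
lemma Str.lam_le (hS : Ternary S) (h : Str S q) (m : ℕ) :
    lam S (q - 14 - 9 * m) ≤ lam S (q - 14) := by
  rcases Nat.eq_zero_or_pos m with rfl | hm
  · simp
  refine lam_le_lam hS.pos ?_ ?_
  · refine ((cfValue_lt_of_lt (a := rightSeq S (q - 14)) (b := rightSeq S (q - 14 - 9 * m))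
      (fun n => hS.pos _) (fun n => hS.pos _) 17 ?_ ?_).2 (by decide)).le
    · intro k hk
      simp only [rightSeq]
      have hp : S (q - 14 - 9 * m + k) = per9 (k - 14) := by
        rw [h.1 _ (by omega), ← per9_add (k - 14) (-m)]
        congr 1; ring
      rw [hp]
      rcases lt_or_ge k 14 with hk1 | hk1
      · rw [h.1 _ (by omega)]
        congr 1; ring
      · have h1 : At per9 0 [2, 1, 2] := by decide
        have h2 : At S q [2, 1, 2] := At.of_isPrefixOf (by decide) h.2
        have := h2.eq_at h1 (k := k - 14) (by simp; omega)
        rw [show q + ((k - 14 : ℕ) : ℤ) = q - 14 + k by omega] at this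
        rw [this]
        congr 1; omega
    · simp only [rightSeq]
      rw [h.1 (q - 14 - 9 * m + (17 : ℕ)) (by push_cast; omega)]
      have h1 : S (q - 14 + (17 : ℕ)) = 2 := by
        have := (at_iff_getD _ _ _).1 h.2 3 (by decide)
        rw [show q - 14 + ((17 : ℕ) : ℤ) = q + (3 : ℕ) by push_cast; ring, this]
        decide
      rw [h1, show q - 14 - 9 * (m : ℤ) + (17 : ℕ) - q = 3 + 9 * (-m) by push_cast; ring, per9_add]
      decide
  · exact (congrArg cfValue (h.1.leftSeq_eq h.1 (by omega) (by omega) (by omega))).le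

lemma Str.j0_lt_lam (hS : Ternary S) (hA : Avoids S) (h : Str S q) : j0 < lam S (q - 14) :=
  j0_lt_jM.trans_le (h.jM_le_lam hS hA)

end

/-! ### Maximality of the centres -/

lemma length_selfRep : selfRep.length = 17 := by decide

lemma length_selfRep_reverse : selfRep.reverse.length = 17 := by decide

lemma at_rev_selfRep_reverse {S : ℤ → ℕ} {k : ℤ} (h : At S k selfRep) :
    At (rev S) (-k - 16) selfRep.reverse := by
  have := at_rev_of_at h
  rw [length_selfRep] at this
  convert this using 1
  push_cast; ring

lemma at_rev_selfRep {S : ℤ → ℕ} {k : ℤ} (h : At S k selfRep.reverse) :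
    At (rev S) (-k - 16) selfRep := by
  have := at_rev_of_at h
  rw [length_selfRep_reverse, List.reverse_reverse] at this
  convert this using 1
  push_cast; ring

lemma Str.lam_le_of_right {S : ℤ → ℕ} {q : ℤ} (hS : Ternary S) (hA : Avoids S) (h : Str S q)
    (h1 : ∀ k ≥ q, ¬ At S k selfRep) (h2 : ∀ k ≥ q, ¬ At S k selfRep.reverse) (i : ℤ) :
    lam S i ≤ lam S (q - 14) := by
  by_contra! hlt
  have hj := h.j0_lt_lam hS hA
  rcases selfRep_of_lt_lam hS hA (hj.trans hlt) with h3 | h3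
  · rcases lt_or_ge (i - 8) q with hk | hk
    · obtain ⟨m, hm⟩ := h.selfRep_pos hk h3
      rw [show i = q - 14 - 9 * m by omega] at hlt
      exact absurd (h.lam_le hS m) (not_le.2 hlt)
    · exact h1 _ hk h3
  · rcases lt_or_ge (i - 8) q with hk | hk
    · exact h.not_at noCross_selfRep_reverse hk h3
    · exact h2 _ hk h3

/-- A value above `j₀` needs the self-replicating word or its transpose. In the left periodic end
the last but one block dominates, in the right one its mirror image at `14 - q'`, and the middle
contains neither word. -/
lemma Str.lam_le_of_two {S : ℤ → ℕ} {q q' : ℤ} (hS : Ternary S) (hA : Avoids S) (h : Str S q)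
    (h' : Str (rev S) q') (h1 : ∀ k ≥ q, k + 16 ≤ -q' → ¬ At S k selfRep)
    (h2 : ∀ k ≥ q, k + 16 ≤ -q' → ¬ At S k selfRep.reverse)
    (hle : lam S (14 - q') ≤ lam S (q - 14)) (i : ℤ) : lam S i ≤ lam S (q - 14) := by
  by_contra! hlt
  have hj := h.j0_lt_lam hS hA
  rcases selfRep_of_lt_lam hS hA (hj.trans hlt) with h3 | h3
  · rcases lt_or_ge (i - 8) q with hk | hk
    · obtain ⟨m, hm⟩ := h.selfRep_pos hk h3
      rw [show i = q - 14 - 9 * m by omega] at hlt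
      exact absurd (h.lam_le hS m) (not_le.2 hlt)
    · rcases le_or_gt (i - 8 + 16) (-q') with hk2 | hk2
      · exact h1 _ hk hk2 h3
      · exact h'.not_at noCross_selfRep_reverse (by omega) (at_rev_selfRep_reverse h3)
  · rcases lt_or_ge (i - 8) q with hk | hk
    · exact h.not_at noCross_selfRep_reverse hk h3
    · rcases le_or_gt (i - 8 + 16) (-q') with hk2 | hk2
      · exact h2 _ hk hk2 h3
      · obtain ⟨m, hm⟩ := h'.selfRep_pos (by omega) (at_rev_selfRep h3)
        have := h'.lam_le hS.reversed m
        rw [lam_rev hS.pos, lam_rev hS.pos, show -(q' - 14 - 9 * (m : ℤ)) = i by omega,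
          show -(q' - 14) = 14 - q' by ring] at this
        linarith

lemma Str.avoids_of_right {S : ℤ → ℕ} {q : ℤ} (h : Str S q)
    (h1 : ∀ f ∈ forbiddenSym, ∀ k ≥ q, ¬ At S k f) : Avoids S := fun f hf k => by
  rcases lt_or_ge k q with hk | hk
  · exact h.not_at (noCross_forbiddenSym f hf) hk
  · exact h1 f hf k hk

lemma Str.avoids_of_two {S : ℤ → ℕ} {q q' : ℤ} (h : Str S q) (h' : Str (rev S) q')
    (h1 : ∀ f ∈ forbiddenSym, ∀ k ≥ q, k + f.length ≤ -q' + 1 → ¬ At S k f) : Avoids S :=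
  h.avoids_of_right fun f hf k hk hat => by
    rcases le_or_gt (k + f.length : ℤ) (-q' + 1) with hk2 | hk2
    · exact h1 f hf k hk hk2 hat
    · exact h'.not_at (noCross_forbiddenSym _ (forbiddenSym_reverse hf)) (by omega)
        (at_rev_of_at hat)

/-! ### No copies of the self-replicating word beyond `21221212`. -/

lemma per9_no22 (n : ℤ) (h1 : per9 n = 2) : per9 (n + 1) ≠ 2 := by
  have key : ∀ d < 9, omega1.getD d 0 = 2 → omega1.getD ((d + 1) % 9) 0 ≠ 2 := by decide
  have := key (n % 9).toNat (by omega) h1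
  rw [per9]
  convert this using 3
  omega

lemma Str.two_two {S : ℤ → ℕ} {q : ℤ} (h : Str S q) : S (q + 2) = 2 ∧ S (q + 3) = 2 := by
  have h2 := (at_iff_getD _ _ _).1 h.2
  exact ⟨h2 2 (by decide), h2 3 (by decide)⟩

/-- Such a copy would replicate to the left and make `S` periodic across the letters `22` of
`21221212`, while the periodic sequence has no `22`. -/
lemma Below.not_selfRep_of_str {S : ℤ → ℕ} {q : ℤ} (h : Below S) (hq : Str S q) (k : ℤ)
    (hk : k ≥ q) : ¬ At S k selfRep := fun hat => by
  have hL := leftPer_of_selfRep (h.selfRep_sub_mul hat)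
  obtain ⟨h1, h2⟩ := hq.two_two
  rw [hL _ (by omega)] at h1 h2
  refine per9_no22 _ h1 ?_
  rw [← h2]; congr 1; ring

lemma Below.not_selfRep_reverse_of_str {S : ℤ → ℕ} {q' : ℤ} (h : Below S) (hq : Str (rev S) q')
    (k : ℤ) (hk : k + 16 ≤ -q') : ¬ At S k selfRep.reverse := fun hat =>
  h.reversed.not_selfRep_of_str hq _ (by omega) (at_rev_selfRep hat)

/-! ### The sequences of the theorem -/

lemma leftPer_biSeq (w : List ℕ) (x : ℕ → ℕ) :
    LeftPer (biSeq omega1 (omega1 ++ omega1 ++ w) 4 x) 14 := by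
  have h0 : LeftPer (biSeq omega1 (omega1 ++ omega1 ++ w) 4 x) (-4) := fun n hn => by
    simp only [biSeq, per9]
    rw [if_pos (by push_cast; omega)]
    congr 2
  have h1 := at_biSeq omega1 (omega1 ++ omega1 ++ w) 4 x
  rw [at_append, at_append] at h1
  exact (h0.add h1.1.1).add h1.1.2

lemma at_biSeq_word (w : List ℕ) (x : ℕ → ℕ) :
    At (biSeq omega1 (omega1 ++ omega1 ++ w) 4 x) 14 w := by
  have h1 := at_biSeq omega1 (omega1 ++ omega1 ++ w) 4 x
  rw [at_append] at h1
  exact h1.2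

lemma rightSeq_biSeq_word (w : List ℕ) (x : ℕ → ℕ) :
    rightSeq (biSeq omega1 (omega1 ++ omega1 ++ w) 4 x) (14 + w.length) = x := by
  have := rightSeq_biSeq omega1 (omega1 ++ omega1 ++ w) 4 x
  convert this using 2
  simp [omega1]; ring

/-- The sequence `… ω₁ ω₁ w x` with the centre in the second to last block `ω₁`. -/
def seqC (x : ℕ → ℕ) : ℤ → ℕ := biSeq omega1 (omega1 ++ omega1 ++ wordP) 4 x

/-- The sequence `… ω₁ ω₁ w ω₁ᵀ ω₁ᵀ …` with the centre in the second to last block `ω₁`. -/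
def seqD (w : List ℕ) : ℤ → ℕ :=
  biSeq omega1 (omega1 ++ omega1 ++ (w ++ omega1.reverse)) 4 (periodic omega1.reverse)

lemma str_seqC (x : ℕ → ℕ) : Str (seqC x) 14 := ⟨leftPer_biSeq _ _, at_biSeq_word _ _⟩

lemma rightSeq_seqC (x : ℕ → ℕ) : rightSeq (seqC x) 22 = x := rightSeq_biSeq_word wordP x

lemma leftPer_seqD (w : List ℕ) : LeftPer (seqD w) 14 := leftPer_biSeq _ _

lemma at_seqD (w : List ℕ) : At (seqD w) 14 w :=
  ((at_append _ _ _ _).1 (at_biSeq_word (w ++ omega1.reverse) (periodic omega1.reverse))).1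

lemma per9_neg : ∀ d < 9, omega1.reverse.getD d 0 = per9 (-1 - d) := by decide

lemma leftPer_rev_seqD (w : List ℕ) : LeftPer (rev (seqD w)) (-(13 + w.length)) := by
  intro n hn
  have h1 := (at_append _ _ _ _).1 (at_biSeq_word (w ++ omega1.reverse) (periodic omega1.reverse))
  have h2 := rightSeq_biSeq_word (w ++ omega1.reverse) (periodic omega1.reverse)
  have hl : omega1.reverse.length = 9 := by decide
  obtain ⟨t, ht⟩ : ∃ t : ℕ, -n = 14 + w.length + t := ⟨(-n - 14 - w.length).toNat, by omega⟩
  have hval : seqD w (-n) = omega1.reverse.getD (t % 9) 0 := by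
    rw [ht]
    rcases Nat.lt_or_ge t 9 with h9 | h9
    · have := (at_iff_getD _ _ _).1 h1.2 t (by omega)
      rw [Nat.mod_eq_of_lt h9, ← this]
      rfl
    · have := congrFun h2 (t - 9)
      rw [periodic, hl, rightSeq, List.length_append, hl] at this
      rw [← Nat.mod_eq_sub_mod h9] at this
      rw [← this, seqD]
      congr 1
      push_cast [h9]; ring
  rw [rev, hval, per9_neg _ (Nat.mod_lt _ (by norm_num)), per9, per9]
  congr 2
  omega

lemma leftPer_ext {S S' : ℤ → ℕ} {q : ℤ} (h : LeftPer S q) (h' : LeftPer S' 14) (n : ℤ)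
    (hn : n < 14) : S (n + (q - 14)) = S' n := by
  rw [h _ (by omega), h' _ hn]
  congr 1; ring

lemma Str.eq_seqC {S : ℤ → ℕ} {q : ℤ} (h : Str S q) :
    (fun n => S (n + (q - 14))) = seqC (rightSeq S (q + 8)) := by
  funext n
  rcases lt_or_ge n 14 with hn | hn
  · exact leftPer_ext h.1 (str_seqC _).1 n hn
  · rcases lt_or_ge n 22 with hn2 | hn2
    · have := h.2.eq_at (str_seqC (rightSeq S (q + 8))).2 (k := (n - 14).toNat)
        (by rw [show wordP.length = 8 from rfl]; omega)
      rw [show (14 : ℤ) + ((n - 14).toNat : ℤ) = n by omega] at this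
      rw [← this]; congr 1; omega
    · have := congrFun (rightSeq_seqC (rightSeq S (q + 8))) (n - 22).toNat
      rw [rightSeq, rightSeq, show (22 : ℤ) + ((n - 22).toNat : ℤ) = n by omega] at this
      rw [this]; congr 1; omega

lemma eq_seqD {S : ℤ → ℕ} {q : ℤ} {w : List ℕ} (h : LeftPer S q) (hw : At S q w)
    (h' : LeftPer (rev S) (-(q + w.length - 1))) : (fun n => S (n + (q - 14))) = seqD w := by
  funext n
  rcases lt_or_ge n 14 with hn | hn
  · exact leftPer_ext h (leftPer_seqD w) n hn
  · rcases lt_or_ge n (14 + w.length) with hn2 | hn2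
    · have := hw.eq_at (at_seqD w) (k := (n - 14).toNat) (by omega)
      rw [show (14 : ℤ) + ((n - 14).toNat : ℤ) = n by omega] at this
      rw [← this]; congr 1; omega
    · have h1 := h' (-(n + (q - 14))) (by omega)
      have h2 := leftPer_rev_seqD w (-n) (by omega)
      rw [rev, neg_neg] at h1 h2
      rw [h1, h2]; congr 1; ring

lemma lam_eq_seqD {S : ℤ → ℕ} {q : ℤ} {w : List ℕ} (h : LeftPer S q) (hw : At S q w)
    (h' : LeftPer (rev S) (-(q + w.length - 1))) : lam S (q - 14) = lam (seqD w) 0 := by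
  rw [← eq_seqD h hw h', lam_shift, zero_add]

lemma Str.lam_eq_seqC {S : ℤ → ℕ} {q : ℤ} (h : Str S q) :
    lam S (q - 14) = lam (seqC (rightSeq S (q + 8))) 0 := by
  rw [← h.eq_seqC, lam_shift, zero_add]

/-! ### Comparison of finite words -/

lemma cfWord_bounds {s : List ℕ} (hs : ∀ a ∈ s, 1 ≤ a) : 0 ≤ cfWord s ∧ cfWord s ≤ 1 := by
  induction s with
  | nil => simp [cfWord]
  | cons a s ih =>
    have h := ih fun b hb => hs b (List.mem_cons_of_mem _ hb)
    have ha : (1 : ℝ) ≤ a := by exact_mod_cast hs a List.mem_cons_self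
    simp only [cfWord]
    exact ⟨by have := h.1; positivity, by rw [div_le_one (by linarith)]; linarith⟩

lemma At.one_le {S : ℤ → ℕ} (hS : ∀ i, 1 ≤ S i) {i : ℤ} {w : List ℕ} (h : At S i w) :
    ∀ a ∈ w, 1 ≤ a := by
  induction w generalizing i with
  | nil => simp
  | cons b w ih =>
    intro a ha
    rcases List.mem_cons.1 ha with rfl | ha
    · exact h.1 ▸ hS i
    · exact ih h.2 a ha

/-- Both sides follow the alternating order at the first differing letter. Equal length excludes
that one word is a proper prefix of the other. One side is a reciprocal, so the inequality turns
round, and the two sequences swap roles in the induction. -/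
lemma cfValue_lt_of_cfWord_lt {S S' : ℤ → ℕ} (hS : ∀ i, 1 ≤ S i) (hS' : ∀ i, 1 ≤ S' i) {i i' : ℤ}
    {s s' : List ℕ} (hl : s.length = s'.length) (h : At S i s) (h' : At S' i' s')
    (hlt : cfWord s < cfWord s') : cfValue (rightSeq S' i') < cfValue (rightSeq S i) := by
  obtain ⟨n, hn⟩ : ∃ n, s.length = n := ⟨_, rfl⟩
  induction n generalizing S S' i i' s s' with
  | zero =>
    rw [hn] at hl
    rw [List.length_eq_zero_iff.1 hl.symm, List.length_eq_zero_iff.1 hn] at hlt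
    exact absurd hlt (lt_irrefl _)
  | succ n ih =>
    match s, s', hl, hn, h, h', hlt with
    | a :: t, a' :: t', hl, hn, h, h', hlt =>
      have hc := cfWord_bounds (h.2.one_le hS)
      have hc' := cfWord_bounds (h'.2.one_le hS')
      have ha : (1 : ℝ) ≤ a := by exact_mod_cast h.1 ▸ hS i
      have ha' : (1 : ℝ) ≤ a' := by exact_mod_cast h'.1 ▸ hS' i'
      simp only [cfWord] at hlt
      have hlt2 : (a' : ℝ) + cfWord t' < a + cfWord t :=
        lt_of_one_div_lt_one_div (by linarith) hlt
      have h1 := one_lt_cfValue (a := rightSeq S (i + 1)) fun n => hS _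
      have h2 := one_lt_cfValue (a := rightSeq S' (i' + 1)) fun n => hS' _
      rw [cfValue_rightSeq hS, cfValue_rightSeq hS', h.1, h'.1]
      rcases lt_trichotomy a' a with hlt3 | heq | hgt
      · have h3 : (a' : ℝ) + 1 ≤ a := by exact_mod_cast hlt3
        have h4 : 1 / cfValue (rightSeq S' (i' + 1)) < 1 := by
          rw [div_lt_one (by linarith)]; exact h2
        have h5 : 0 < 1 / cfValue (rightSeq S (i + 1)) := by positivity
        linarith
      · subst heq
        have h3 := ih hS' hS (s := t') (s' := t) (by simpa using hl.symm) h'.2 h.2 (by linarith)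
          (by simp only [List.length_cons] at hl hn; omega)
        have := one_div_lt_one_div_of_lt (by linarith) h3
        linarith
      · have h3 : (a : ℝ) + 1 ≤ a' := by exact_mod_cast hgt
        linarith [hc.2, hc'.1]

/-- The pasts agree and so do 22 = 14 + 8 letters from the centre, an even number. So the smaller
`[0; s]` has the larger `λ`; this is the source of the condition `[0; s] ≤ [0; sᵀ]`. -/
lemma Str.lam_lt_of_cfWord_lt {S S' : ℤ → ℕ} {q q' : ℤ} (hS : ∀ i, 1 ≤ S i) (hS' : ∀ i, 1 ≤ S' i)
    (h : Str S q) (h' : Str S' q') {s s' : List ℕ} (hl : s.length = s'.length)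
    (hs : At S (q + 8) s) (hs' : At S' (q' + 8) s') (hlt : cfWord s < cfWord s') :
    lam S' (q' - 14) < lam S (q - 14) := by
  have h1 := cfValue_lt_of_cfWord_lt hS hS' hl hs hs' hlt
  have h2 := h'.1.leftSeq_eq h.1 (i := q' - 14 - 1) (i' := q - 14 - 1) (by omega) (by omega) (by omega)
  rw [lam, lam, h2]
  have h3 := (cfValue_lt_of_prefix (a := rightSeq S' (q' - 14)) (b := rightSeq S (q - 14))
      (fun n => hS' _) (fun n => hS _) 22 ?_ ?_).1 (by decide)
  · linarith
  · intro k hk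
    simp only [rightSeq]
    rcases lt_or_ge k 14 with hk1 | hk1
    · rw [h'.1 _ (by omega), h.1 _ (by omega)]
      congr 1; ring
    · have := h'.2.eq_at h.2 (k := k - 14) (by rw [show wordP.length = 8 from rfl]; omega)
      rw [show q' + ((k - 14 : ℕ) : ℤ) = q' - 14 + k by omega,
        show q + ((k - 14 : ℕ) : ℤ) = q - 14 + k by omega] at this
      exact this
  · rw [rightSeq_add, rightSeq_add, show q' - 14 + ((22 : ℕ) : ℤ) = q' + 8 by push_cast; ring,
      show q - 14 + ((22 : ℕ) : ℤ) = q + 8 by push_cast; ring]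
    exact h1

/-! ### Translation of the descriptions of `C`, `D` and `X` -/

lemma forbidden_eq : forbidden = forbiddenSym ++ [selfRep, selfRep.reverse] := rfl

lemma mem_forbidden {f : List ℕ} :
    f ∈ forbidden ↔ f ∈ forbiddenSym ∨ f = selfRep ∨ f = selfRep.reverse := by
  rw [forbidden_eq]; simp

lemma occursIn_rightSeq {S : ℤ → ℕ} {q : ℤ} {w : List ℕ} :
    OccursIn w (rightSeq S q) ↔ ∃ n : ℕ, At S (q + n) w := by
  refine exists_congr fun n => ?_
  rw [at_iff_getD]
  constructor
  · intro h k hk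
    have h1 : ((List.range w.length).map fun i => rightSeq S q (n + i))[k]? = w[k]? := by rw [h]
    rw [List.getElem?_map, List.getElem?_range hk, List.getElem?_eq_getElem hk] at h1
    rw [List.getD_eq_getElem _ _ hk]
    simp only [Option.map_some, Option.some.injEq] at h1
    rw [← h1, rightSeq]
    congr 1; push_cast; ring
  · intro h
    refine List.ext_getElem (by simp) fun k h1 h2 => ?_
    have := h k h2
    rw [List.getD_eq_getElem _ _ h2] at this
    rw [← this, List.getElem_map, List.getElem_range, rightSeq]
    congr 1; push_cast; ring

lemma prepend_rightSeq {S : ℤ → ℕ} {q : ℤ} {w : List ℕ} (h : At S q w) :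
    prepend w (rightSeq S (q + w.length)) = rightSeq S q := by
  funext n
  simp only [prepend]
  split_ifs with hn
  · exact ((at_iff_getD _ _ _).1 h n hn).symm
  · simp only [rightSeq]; congr 1; push_cast [not_lt.1 hn]; ring

lemma At.of_infix {S : ℤ → ℕ} {i : ℤ} {f w : List ℕ} (hw : At S i w) (h : f <:+: w) :
    ∃ k, i ≤ k ∧ k + f.length ≤ i + w.length ∧ At S k f := by
  obtain ⟨s, t, rfl⟩ := h
  rw [at_append, at_append] at hw
  refine ⟨i + s.length, by omega, ?_, hw.1.2⟩
  simp only [List.length_append]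
  push_cast
  omega

lemma At.infix {S : ℤ → ℕ} {i k : ℤ} {f w : List ℕ} (hw : At S i w) (hf : At S k f) (h1 : i ≤ k)
    (h2 : k + f.length ≤ i + w.length) : f <:+: w := by
  have h3 := hw.drop (k - i).toNat (by omega)
  rw [show i + ((k - i).toNat : ℤ) = k by omega] at h3
  have := hf.isPrefixOf h3 (by rw [List.length_drop]; omega)
  rw [List.isPrefixOf_iff_prefix] at this
  exact this.isInfix.trans (List.drop_suffix _ _).isInfix

/-- The condition on the right part of the elements of `C`. -/
def TailC (x : ℕ → ℕ) : Prop :=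
  (∀ n, x n ∈ ({1, 2, 3} : Set ℕ)) ∧ ∀ w ∈ forbidden, ¬ OccursIn w (prepend wordP x)

lemma mem_setC {v : ℝ} : v ∈ setC ↔ ∃ x, TailC x ∧ v = lam (seqC x) 0 := by
  constructor
  · rintro ⟨x, h1, h2, h3⟩
    exact ⟨x, ⟨h1, h2⟩, by rw [h3, lambda0_eq_lam]; rfl⟩
  · rintro ⟨x, ⟨h1, h2⟩, h3⟩
    exact ⟨x, h1, h2, by rw [h3, lambda0_eq_lam]; rfl⟩

/-- The condition on the middle words of the elements of `D`. -/
def WordD (s : List ℕ) : Prop :=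
  (∀ a ∈ s, a ∈ ({1, 2, 3} : Set ℕ)) ∧
    (∀ w ∈ forbidden, ¬ w <:+: wordP ++ s ++ wordP.reverse) ∧ cfWord s ≤ cfWord s.reverse

lemma mem_setD {v : ℝ} :
    v ∈ setD ↔ ∃ s, WordD s ∧ v = lam (seqD (wordP ++ s ++ wordP.reverse)) 0 := by
  have key : ∀ s, lambda0 (biSeq omega1
      (omega1 ++ omega1 ++ wordP ++ s ++ wordP.reverse ++ omega1.reverse) 4
      (periodic omega1.reverse)) = lam (seqD (wordP ++ s ++ wordP.reverse)) 0 := fun s => by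
    rw [lambda0_eq_lam, seqD]
    simp only [List.append_assoc]
  constructor
  · rintro ⟨s, h1, h2, h3, h4⟩
    exact ⟨s, ⟨h1, h2, h3⟩, h4.trans (key s)⟩
  · rintro ⟨s, ⟨h1, h2, h3⟩, h4⟩
    exact ⟨s, h1, h2, h3, h4.trans (key s).symm⟩

lemma pointX_eq (u : List ℕ) : pointX u = lam (seqD ([2, 1, 2, 2] ++ u ++ [2, 2, 1, 2])) 0 := by
  rw [pointX, lambda0_eq_lam, seqD]
  simp only [List.append_assoc]

lemma mem_123 {a : ℕ} : a ∈ ({1, 2, 3} : Set ℕ) ↔ a = 1 ∨ a = 2 ∨ a = 3 := by simp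

/-! ### Sequences with supremum between `j₀` and `J` -/

/-- The number `x` is the supremum of the values `λᵢ(S)`. -/
def IsSupLam (S : ℤ → ℕ) (x : ℝ) : Prop := (∀ i, lam S i ≤ x) ∧ ∀ y < x, ∃ i, y < lam S i

lemma IsSupLam.eq {S : ℤ → ℕ} {x : ℝ} (h : IsSupLam S x) {p : ℤ} (hp : ∀ i, lam S i ≤ lam S p) :
    x = lam S p := by
  refine le_antisymm (le_of_forall_lt fun y hy => ?_) (h.1 p)
  obtain ⟨i, hi⟩ := h.2 y hy
  exact hi.trans_le (hp i)

lemma IsSupLam.reversed {S : ℤ → ℕ} (hS : ∀ i, 1 ≤ S i) {x : ℝ} (h : IsSupLam S x) :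
    IsSupLam (rev S) x :=
  ⟨fun i => by rw [lam_rev hS]; exact h.1 _, fun y hy => by
    obtain ⟨i, hi⟩ := h.2 y hy
    exact ⟨-i, by rwa [lam_rev hS, neg_neg]⟩⟩

lemma below_of_lam_le {S : ℤ → ℕ} (hS : ∀ i, 1 ≤ S i) {x : ℝ} (hx : x < jL)
    (h : ∀ i, lam S i ≤ x) : Below S := by
  refine ⟨fun i => ?_, fun i => (h i).trans_lt hx⟩
  have h1 := one_lt_cfValue (a := rightSeq S (i + 1)) fun n => hS _
  have h2 := one_lt_cfValue (a := leftSeq S (i - 1)) fun n => hS _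
  have h3 := h i
  rw [lam_eq hS] at h3
  have h4 : (0 : ℝ) < 1 / cfValue (rightSeq S (i + 1)) := by positivity
  have h5 : (0 : ℝ) < 1 / cfValue (leftSeq S (i - 1)) := by positivity
  have h6 : (numJ : ℝ) / scale < 4 := by
    rw [div_lt_iff₀ (by exact_mod_cast scale_pos)]
    exact_mod_cast (by decide : numJ < 4 * scale)
  have h7 : (S i : ℝ) < 4 := by linarith [jL_le]
  have h8 : S i < 4 := by exact_mod_cast h7
  have := hS i
  omega

/-- A palindrome between mirrored ends makes the whole sequence symmetric. This covers `X` and the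
equality case `s = sᵀ` of `D`. -/
lemma lam_eq_of_palindrome {S : ℤ → ℕ} {q q' : ℤ} {w : List ℕ} (hS : ∀ i, 1 ≤ S i)
    (h : LeftPer S q) (h' : LeftPer (rev S) q') (hw : At S q w) (hl : q + w.length - 1 = -q')
    (hp : w.reverse = w) : lam S (14 - q') = lam S (q - 14) := by
  have h1 := lam_eq_seqD h hw (by rwa [hl, neg_neg])
  have h2 : At (rev S) q' w := by
    have := at_rev_of_at hw
    rw [hp] at this
    convert this using 1
    omega
  have h3 := lam_eq_seqD h' h2 (by
    rw [rev_rev, show -(q' + (w.length : ℤ) - 1) = q by omega]; exact h)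
  rw [lam_rev hS, show -(q' - 14) = 14 - q' by ring] at h3
  rw [h1, h3]

/-- Equal length removes the ambiguity `[0; 2] = [0; 1, 1]` of finite continued fractions. -/
lemma eq_of_cfWord_eq {s s' : List ℕ} (hl : s.length = s'.length) (hs : ∀ a ∈ s, 1 ≤ a)
    (hs' : ∀ a ∈ s', 1 ≤ a) (h : cfWord s = cfWord s') : s = s' := by
  induction s generalizing s' with
  | nil => exact (List.length_eq_zero_iff.1 hl.symm).symm
  | cons a t ih =>
    match s', hl, hs', h with
    | a' :: t', hl, hs', h =>
      have hl2 : t.length = t'.length := by simpa using hl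
      have ht : ∀ b ∈ t, 1 ≤ b := fun b hb => hs b (List.mem_cons_of_mem _ hb)
      have ht' : ∀ b ∈ t', 1 ≤ b := fun b hb => hs' b (List.mem_cons_of_mem _ hb)
      have hc := cfWord_bounds ht
      have hc' := cfWord_bounds ht'
      have ha : (1 : ℝ) ≤ a := by exact_mod_cast hs a List.mem_cons_self
      have ha' : (1 : ℝ) ≤ a' := by exact_mod_cast hs' a' List.mem_cons_self
      simp only [cfWord] at h
      have h2 : (a : ℝ) + cfWord t = a' + cfWord t' := by
        have := congrArg (fun x => 1 / x) h
        simpa using this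
      have pos_of_ne : ∀ {r : List ℕ}, (∀ b ∈ r, 1 ≤ b) → r ≠ [] → 0 < cfWord r := by
        intro r hr hne
        match r, hr, hne with
        | b :: r, hr, _ =>
          have hb : (1 : ℝ) ≤ b := by exact_mod_cast hr b List.mem_cons_self
          have := (cfWord_bounds fun c hc => hr c (List.mem_cons_of_mem b hc)).1
          simp only [cfWord]; positivity
      have haa : a = a' := by
        rcases lt_trichotomy a a' with hlt | heq | hgt
        · have h3 : (a : ℝ) + 1 ≤ a' := by exact_mod_cast hlt
          have h0 : cfWord t' = 0 := by linarith [hc.2, hc'.1]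
          have h4 : t' = [] := by
            by_contra hne; exact (pos_of_ne ht' hne).ne' h0
          rw [h4] at hl2
          rw [List.length_eq_zero_iff.1 hl2, h4] at h2
          simpa [cfWord] using h2
        · exact heq
        · have h3 : (a' : ℝ) + 1 ≤ a := by exact_mod_cast hgt
          have h0 : cfWord t = 0 := by linarith [hc'.2, hc.1]
          have h4 : t = [] := by
            by_contra hne; exact (pos_of_ne ht hne).ne' h0
          rw [h4] at hl2
          rw [List.length_eq_zero_iff.1 hl2.symm, h4] at h2
          simpa [cfWord] using h2
      subst haa
      rw [ih hl2 ht ht' (by linarith)]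

/-- The middle part between the two periodic ends has length `11`, `13`, `15` or at least `16`. -/
lemma two_sided_length {S : ℤ → ℕ} {q q' : ℤ} (h : Str S q) (h' : Str (rev S) q') :
    -q' + 1 - q = 11 ∨ -q' + 1 - q = 13 ∨ -q' + 1 - q = 15 ∨ 16 ≤ -q' + 1 - q := by
  have hv : At S (-q' - 7) (wordP.reverse ++ omega1.reverse) := by
    have h1 : At (rev S) (q' - 9) (omega1 ++ wordP) := by
      rw [at_append]
      refine ⟨?_, by simpa [omega1] using h'.2⟩
      have := h'.1.at_fourBlocks.drop 27 (by decide)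
      rw [show q' - 36 + ((27 : ℕ) : ℤ) = q' - 9 by push_cast; ring] at this
      exact this
    have h2 := at_rev_of_at h1
    rw [rev_rev, List.reverse_append] at h2
    convert h2 using 1
    simp [omega1, wordP]; ring
  have hP := h.2
  have hlP : wordP.length = 8 := by decide
  have hlv : (wordP.reverse ++ omega1.reverse).length = 17 := by decide
  by_contra! hcon
  obtain ⟨h11, h13, h15, h16⟩ := hcon
  -- With fewer than three middle letters, the `22` of `21221212` would lie in the right periodic
  -- end.
  rcases lt_or_ge (-q' + 1 - q) 3 with hlt | hge
  · obtain ⟨h1, h2⟩ := h.two_two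
    have h3 := h'.1 (-(q + 2)) (by omega)
    have h4 := h'.1 (-(q + 3)) (by omega)
    rw [rev, neg_neg] at h3 h4
    refine per9_no22 _ (h4.symm.trans h2) ?_
    rw [← h1, h3]; congr 1; ring
  -- With three to seven middle letters, `21221212` would be read inside `21212212ω₁ᵀ` at an offset
  -- where it does not fit. With eight to fifteen, a suffix of `21221212` has to match the beginning
  -- of that word, which happens only for the offsets 3, 5, 7.
  · rcases lt_or_ge (-q' + 1 - q) 8 with hlt8 | hge8
    · have h1 := hv.drop (8 - (-q' + 1 - q)).toNat (by omega)
      rw [show -q' - 7 + ((8 - (-q' + 1 - q)).toNat : ℤ) = q by omega] at h1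
      have h2 := hP.isPrefixOf h1 (by rw [List.length_drop]; omega)
      have key : ∀ d < 6, wordP.isPrefixOf ((wordP.reverse ++ omega1.reverse).drop d) = false := by
        decide
      rw [key _ (by omega)] at h2
      cases h2
    · have h1 := hP.drop (-q' + 1 - q - 8).toNat (by omega)
      rw [show q + ((-q' + 1 - q - 8).toNat : ℤ) = -q' - 7 by omega] at h1
      have h2 := h1.isPrefixOf hv (by rw [List.length_drop]; omega)
      have key : ∀ d < 8, (wordP.drop d).isPrefixOf (wordP.reverse ++ omega1.reverse) = true →
          d = 3 ∨ d = 5 ∨ d = 7 := by decide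
      rcases key _ (by omega) h2 with h3 | h3 | h3 <;> omega

lemma at_wordP_reverse {S : ℤ → ℕ} {q' : ℤ} (h' : Str (rev S) q') :
    At S (-q' - 7) wordP.reverse := by
  have h2 := at_rev_of_at h'.2
  rw [rev_rev] at h2
  convert h2 using 1
  simp [wordP]; ring

/-- A middle part of at least 16 letters has room for `21221212`, a word `s` and the transpose,
which gives `D`. The overlap lengths 11, 13, 15 give the three words of `X`. The hypothesis on the
two centres becomes `[0; s] ≤ [0; sᵀ]`. -/
lemma Below.mem_setD_union_setX {S : ℤ → ℕ} {q q' : ℤ} (hB : Below S) (h : Str S q)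
    (h' : Str (rev S) q') (hle : lam S (14 - q') ≤ lam S (q - 14)) :
    lam S (q - 14) ∈ setD ∪ setX := by
  have hR := at_wordP_reverse h'
  have hX : ∀ (d : ℕ) (u : List ℕ), -q' - 7 = q + d →
      [2, 1, 2, 2] ++ u ++ [2, 2, 1, 2] = wordP ++ wordP.reverse.drop (8 - d) → d ≤ 8 →
      lam S (q - 14) = pointX u := by
    intro d u hd hu hd8
    have hw : At S q ([2, 1, 2, 2] ++ u ++ [2, 2, 1, 2]) := by
      rw [hu, at_append]
      refine ⟨h.2, ?_⟩
      have := hR.drop (8 - d) (by simp [wordP])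
      rw [hd] at this
      convert this using 1
      rw [show wordP.length = 8 from rfl]; omega
    rw [pointX_eq]
    refine lam_eq_seqD h.1 hw ?_
    convert h'.1 using 1
    rw [hu, List.length_append, List.length_drop, List.length_reverse, show wordP.length = 8 from rfl]
    omega
  rcases two_sided_length h h' with hl | hl | hl | hl
  · exact Or.inr (Or.inl (hX 3 _ (by omega) (by decide) (by omega)))
  · exact Or.inr (Or.inr (Or.inl (hX 5 _ (by omega) (by decide) (by omega))))
  · exact Or.inr (Or.inr (Or.inr (hX 7 _ (by omega) (by decide) (by omega))))
  · refine Or.inl (mem_setD.2 ?_)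
    set m := (-q' + 1 - q - 16).toNat with hm
    set s := (List.range m).map fun k : ℕ => S (q + 8 + k) with hs
    have hslen : s.length = m := by simp [hs]
    have hsat : At S (q + 8) s := by
      rw [at_iff_getD]
      intro k hk
      rw [List.getD_eq_getElem _ _ hk]
      simp [hs]
    have hw : At S q (wordP ++ s ++ wordP.reverse) := by
      rw [at_append, at_append]
      refine ⟨⟨h.2, hsat⟩, ?_⟩
      convert hR using 1
      rw [List.length_append, hslen, show wordP.length = 8 from rfl]
      push_cast; omega
    have hwl : (wordP ++ s ++ wordP.reverse).length = m + 16 := by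
      rw [List.length_append, List.length_append, hslen, List.length_reverse,
        show wordP.length = 8 from rfl]; ring
    refine ⟨s, ⟨fun a ha => ?_, fun f hf hin => ?_, ?_⟩, ?_⟩
    · obtain ⟨k, -, rfl⟩ := List.mem_map.1 ha
      exact mem_123.2 (hB.1 _)
    · obtain ⟨k, hk1, hk2, hk3⟩ := hw.of_infix hin
      rcases mem_forbidden.1 hf with hf | rfl | rfl
      · exact hB.avoids f hf k hk3
      · exact hB.not_selfRep_of_str h k hk1 hk3
      · rw [length_selfRep_reverse] at hk2
        exact hB.not_selfRep_reverse_of_str h' k (by omega) hk3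
    · by_contra! hlt
      have hs' : At (rev S) (q' + 8) s.reverse := by
        have := at_rev_of_at hsat
        convert this using 1
        omega
      have := Str.lam_lt_of_cfWord_lt hB.1.reversed.pos hB.1.pos h' h (by simp) hs' hsat hlt
      rw [lam_rev hB.1.pos, show -(q' - 14) = 14 - q' by ring] at this
      linarith
    · refine lam_eq_seqD h.1 hw ?_
      convert h'.1 using 1
      omega

/-- If the transposed word occurs to the right, the reversed sequence has the `Str` form too;
reversing if necessary, the left centre has the larger value. Without it the right tail is that of
an element of `C`. -/
lemma Below.mem_of_str {S : ℤ → ℕ} {x : ℝ} (hB : Below S) (hsup : IsSupLam S x) {q : ℤ}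
    (h : Str S q) : x ∈ setC ∪ setD ∪ setX := by
  by_cases hr : ∃ k ≥ q, At S k selfRep.reverse
  · obtain ⟨k, hk, hat⟩ := hr
    have hj : j0 < lam (rev S) (-(q - 14)) := by
      rw [lam_rev hB.1.pos, neg_neg]; exact h.j0_lt_lam hB.1 hB.avoids
    obtain ⟨q', h'⟩ := hB.reversed.str_of_selfRep (at_rev_selfRep hat) hj
    rw [union_assoc]
    right
    rcases le_total (lam S (14 - q')) (lam S (q - 14)) with hle | hle
    · rw [hsup.eq (p := q - 14) (h.lam_le_of_two hB.1 hB.avoids h'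
        (fun k hk _ => hB.not_selfRep_of_str h k hk)
        (fun k _ hk => hB.not_selfRep_reverse_of_str h' k hk) hle)]
      exact hB.mem_setD_union_setX h h' hle
    · have hrr : Str (rev (rev S)) q := by rwa [rev_rev]
      have hle' : lam (rev S) (14 - q) ≤ lam (rev S) (q' - 14) := by
        rw [lam_rev hB.1.pos, lam_rev hB.1.pos, show -(14 - q) = q - 14 by ring,
          show -(q' - 14) = 14 - q' by ring]
        exact hle
      rw [(hsup.reversed hB.1.pos).eq (p := q' - 14) (h'.lam_le_of_two hB.1.reversed
        hB.avoids.reversed hrr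
        (fun k hk _ => hB.reversed.not_selfRep_of_str h' k hk)
        (fun k _ hk => hB.reversed.not_selfRep_reverse_of_str hrr k hk) hle')]
      exact hB.reversed.mem_setD_union_setX h' hrr hle'
  · push Not at hr
    left; left
    have hno := fun k hk => hB.not_selfRep_of_str h k hk
    rw [hsup.eq (p := q - 14) (h.lam_le_of_right hB.1 hB.avoids hno hr), h.lam_eq_seqC, mem_setC]
    refine ⟨_, ⟨fun n => mem_123.2 (hB.1 _), fun w hw hocc => ?_⟩, rfl⟩
    change OccursIn w (prepend wordP (rightSeq S (q + wordP.length))) at hocc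
    rw [prepend_rightSeq h.2] at hocc
    obtain ⟨n, hn⟩ := occursIn_rightSeq.1 hocc
    rcases mem_forbidden.1 hw with hf | rfl | rfl
    · exact hB.avoids w hf _ hn
    · exact hno _ (by omega) hn
    · exact hr _ (by omega) hn

lemma mem_of_isSupLam {S : ℤ → ℕ} {x : ℝ} (hS : ∀ i, 1 ≤ S i) (hsup : IsSupLam S x) (h0 : j0 < x)
    (hJ : x < jL) : x ∈ setC ∪ setD ∪ setX := by
  have hB := below_of_lam_le hS hJ hsup.1
  obtain ⟨i, hi⟩ := hsup.2 _ h0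
  rcases hB.str_or_str_rev hi with ⟨q, h⟩ | ⟨q, h⟩
  · exact hB.mem_of_str hsup h
  · exact hB.reversed.mem_of_str (hsup.reversed hS) h

/-! ### The values of `C`, `D` and `X` -/

/-- `x` is the value of a sequence whose maximum is taken at the centre of an `ω₁`. -/
def IsCentral (x : ℝ) : Prop :=
  ∃ S : ℤ → ℕ, Ternary S ∧ (∀ i, lam S i ≤ lam S 0) ∧ x = lam S 0 ∧ jM ≤ x ∧ x < jL

lemma TailC.ternary {x : ℕ → ℕ} (h : TailC x) : Ternary (seqC x) :=
  ternary_biSeq (by decide) (by decide) (by decide) fun n => mem_123.1 (h.1 n)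

lemma TailC.not_at {x : ℕ → ℕ} (h : TailC x) {f : List ℕ} (hf : f ∈ forbidden) {k : ℤ}
    (hk : k ≥ 14) : ¬ At (seqC x) k f := fun hat => by
  refine h.2 f hf ?_
  have h1 := prepend_rightSeq (str_seqC x).2
  rw [show (14 : ℤ) + (wordP.length : ℤ) = 22 from rfl, rightSeq_seqC] at h1
  rw [h1]
  exact occursIn_rightSeq.2 ⟨(k - 14).toNat, by rwa [show 14 + ((k - 14).toNat : ℤ) = k by omega]⟩

lemma TailC.avoids {x : ℕ → ℕ} (h : TailC x) : Avoids (seqC x) :=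
  (str_seqC x).avoids_of_right fun _ hf _ hk => h.not_at (mem_forbidden.2 (Or.inl hf)) hk

lemma isCentral_of_mem_setC {v : ℝ} (hv : v ∈ setC) : IsCentral v := by
  obtain ⟨x, hx, rfl⟩ := mem_setC.1 hv
  have h := str_seqC x
  have h1 := h.jM_le_lam hx.ternary hx.avoids
  have h2 := h.lam_lt_jL hx.ternary
  have h3 := h.lam_le_of_right hx.ternary hx.avoids
    (fun k hk => hx.not_at (mem_forbidden.2 (Or.inr (Or.inl rfl))) hk)
    (fun k hk => hx.not_at (mem_forbidden.2 (Or.inr (Or.inr rfl))) hk)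
  rw [sub_self] at h1 h2 h3
  exact ⟨_, hx.ternary, h3, rfl, h1, h2⟩

lemma ternary_seqD {w : List ℕ} (h : ∀ a ∈ w, a = 1 ∨ a = 2 ∨ a = 3) : Ternary (seqD w) := by
  refine ternary_biSeq (by decide) (by decide) (fun a ha => ?_)
    (ternary_periodic (by decide) (by decide))
  rw [List.mem_append, List.mem_append, List.mem_append] at ha
  have key : ∀ a ∈ omega1, a = 1 ∨ a = 2 ∨ a = 3 := by decide
  rcases ha with (ha | ha) | ha | ha
  · exact key a ha
  · exact key a ha
  · exact h a ha
  · exact key a (List.mem_reverse.1 ha)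

/-- The centre 0 lies 14 places before `w`. Its mirror image lies 14 places after the last letter of
`w`, which is at `13 + w.length`, and must not have a larger value. -/
lemma isCentral_seqD {w : List ℕ} (hw : ∀ a ∈ w, a = 1 ∨ a = 2 ∨ a = 3)
    (hf : ∀ f ∈ forbidden, ¬ f <:+: w) (h1 : wordP <+: w) (h2 : wordP.reverse <:+ w)
    (hle : lam (seqD w) (13 + w.length + 14) ≤ lam (seqD w) 0 ∨ w.reverse = w) :
    IsCentral (lam (seqD w) 0) := by
  have hS := ternary_seqD hw
  have hat := at_seqD w
  have h : Str (seqD w) 14 :=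
    ⟨leftPer_seqD w, hat.of_isPrefixOf (List.isPrefixOf_iff_prefix.2 h1)⟩
  have hw' : At (rev (seqD w)) (-(13 + w.length)) w.reverse := by
    convert at_rev_of_at hat using 1
    ring
  have h' : Str (rev (seqD w)) (-(13 + w.length)) := by
    refine ⟨leftPer_rev_seqD w, hw'.of_isPrefixOf (List.isPrefixOf_iff_prefix.2 ?_)⟩
    have := List.reverse_prefix.2 h2
    rwa [List.reverse_reverse] at this
  have hno : ∀ f ∈ forbidden, ∀ k ≥ (14 : ℤ), k + f.length ≤ -(-(13 + w.length : ℤ)) + 1 →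
      ¬ At (seqD w) k f := fun f hf' k hk hk2 hat' =>
    hf f hf' (hat.infix hat' hk (by omega))
  have hA : Avoids (seqD w) := h.avoids_of_two h' fun f hf' =>
    hno f (mem_forbidden.2 (Or.inl hf'))
  have hle' : lam (seqD w) (14 - -(13 + w.length)) ≤ lam (seqD w) (14 - 14) := by
    rcases hle with hle | hp
    · rw [sub_self, show 14 - -(13 + (w.length : ℤ)) = 13 + w.length + 14 by ring]
      exact hle
    · exact (lam_eq_of_palindrome hS.pos h.1 h'.1 hat (by ring) hp).le
  have hl := length_selfRep
  have hl' := length_selfRep_reverse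
  have h4 := h.jM_le_lam hS hA
  have h5 := h.lam_lt_jL hS
  have h6 := h.lam_le_of_two hS hA h'
    (fun k hk hk2 => hno _ (mem_forbidden.2 (Or.inr (Or.inl rfl))) k hk (by omega))
    (fun k hk hk2 => hno _ (mem_forbidden.2 (Or.inr (Or.inr rfl))) k hk (by omega)) hle'
  rw [sub_self] at h4 h5 h6
  exact ⟨_, hS, h6, rfl, h4, h5⟩

lemma isCentral_of_mem_setD {v : ℝ} (hv : v ∈ setD) : IsCentral v := by
  obtain ⟨s, ⟨hs1, hs2, hs3⟩, rfl⟩ := mem_setD.1 hv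
  have hw : ∀ a ∈ wordP ++ s ++ wordP.reverse, a = 1 ∨ a = 2 ∨ a = 3 := by
    have key : ∀ a ∈ wordP, a = 1 ∨ a = 2 ∨ a = 3 := by decide
    intro a ha
    rw [List.mem_append, List.mem_append] at ha
    rcases ha with (ha | ha) | ha
    · exact key a ha
    · exact mem_123.1 (hs1 a ha)
    · exact key a (List.mem_reverse.1 ha)
  have hS := ternary_seqD hw
  have hspos : ∀ a ∈ s, 1 ≤ a := fun a ha => by
    rcases mem_123.1 (hs1 a ha) with h | h | h <;> omega
  refine isCentral_seqD hw hs2 ⟨s ++ wordP.reverse, by simp⟩ ⟨wordP ++ s, rfl⟩ ?_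
  rcases hs3.lt_or_eq with hlt | heq
  · left
    have hat := at_seqD (wordP ++ s ++ wordP.reverse)
    have h : Str (seqD (wordP ++ s ++ wordP.reverse)) 14 :=
      ⟨leftPer_seqD _, ((at_append _ _ _ _).1 ((at_append _ _ _ _).1 hat).1).1⟩
    have hs : At (seqD (wordP ++ s ++ wordP.reverse)) (14 + 8) s :=
      ((at_append _ _ _ _).1 ((at_append _ _ _ _).1 hat).1).2
    have hw' := at_rev_of_at hat
    rw [show (wordP ++ s ++ wordP.reverse).reverse = wordP ++ (s.reverse ++ wordP.reverse) by simp,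
      show -14 + 1 - ((wordP ++ s ++ wordP.reverse).length : ℤ) =
        -(13 + ((wordP ++ s ++ wordP.reverse).length : ℤ)) by ring] at hw'
    rw [at_append, at_append] at hw'
    have h' : Str (rev (seqD (wordP ++ s ++ wordP.reverse))) _ := ⟨leftPer_rev_seqD _, hw'.1⟩
    have := Str.lam_lt_of_cfWord_lt hS.pos hS.reversed.pos h h' (by simp) hs hw'.2.1 hlt
    rw [lam_rev hS.pos, sub_self] at this
    rw [show 13 + ((wordP ++ s ++ wordP.reverse).length : ℤ) + 14 =
      -(-(13 + ((wordP ++ s ++ wordP.reverse).length : ℤ)) - 14) by ring]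
    exact this.le
  · right
    have := eq_of_cfWord_eq (by simp) hspos (fun a ha => hspos a (List.mem_reverse.1 ha)) heq
    simp [← this]

lemma isCentral_of_mem_setX {v : ℝ} (hv : v ∈ setX) : IsCentral v := by
  have key : ∀ u ∈ ([[1, 2, 1], [1, 2, 1, 2, 1], [1, 2, 1, 2, 1, 2, 1]] : List (List ℕ)),
      (∀ a ∈ [2, 1, 2, 2] ++ u ++ [2, 2, 1, 2], a = 1 ∨ a = 2 ∨ a = 3) ∧
      (∀ f ∈ forbidden, ¬ f <:+: [2, 1, 2, 2] ++ u ++ [2, 2, 1, 2]) ∧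
      wordP <+: [2, 1, 2, 2] ++ u ++ [2, 2, 1, 2] ∧
      wordP.reverse <:+ [2, 1, 2, 2] ++ u ++ [2, 2, 1, 2] ∧
      ([2, 1, 2, 2] ++ u ++ [2, 2, 1, 2]).reverse = [2, 1, 2, 2] ++ u ++ [2, 2, 1, 2] := by
    decide +kernel
  have main : ∀ u ∈ ([[1, 2, 1], [1, 2, 1, 2, 1], [1, 2, 1, 2, 1, 2, 1]] : List (List ℕ)),
      IsCentral (pointX u) := fun u hu => by
    obtain ⟨h1, h2, h3, h4, h5⟩ := key u hu
    rw [pointX_eq]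
    exact isCentral_seqD h1 h2 h3 h4 (Or.inr h5)
  rcases hv with rfl | rfl | rfl
  · exact main _ (by simp)
  · exact main _ (by simp)
  · exact main _ (by simp)

/-! ### Indefinite forms and continued fractions -/

/-- The form `(x - α y) (x + β y) / (α + β)` of discriminant `1`. -/
noncomputable def redForm (α β x y : ℝ) : ℝ := (x - α * y) * (x + β * y) / (α + β)

lemma redForm_neg (α β x y : ℝ) : redForm α β (-x) (-y) = redForm α β x y := by
  simp only [redForm]; ring

lemma redForm_step {a α β α' β' : ℝ} (hα' : 0 < α') (hβ : 0 < a + β) (h1 : α = a + 1 / α')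
    (h2 : β' = 1 / (a + β)) (x y : ℝ) :
    redForm α β x y = -redForm α' β' y (x - a * y) := by
  have h3 : 0 < β' := by rw [h2]; positivity
  have h4 : β = 1 / β' - a := by rw [h2]; field_simp; ring
  have h5 : 0 < α' + β' := by positivity
  have h6 : a + 1 / α' + (1 / β' - a) = (α' + β') / (α' * β') := by field_simp; ring
  rw [redForm, redForm, h1, h4, h6]
  field_simp
  ring

/-- On a segment between two even or two odd convergents the form is minimal at the ends. -/
lemma redForm_ge {a α β x y : ℝ} (ha0 : 0 ≤ a) (ha : a ≤ α) (hβ : 0 ≤ β) (hαβ : 0 < α + β)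
    (hy : 0 < y) (hx : 0 ≤ x) (hxy : x ≤ a * y) :
    y ^ 2 * (α * β / (α + β)) ≤ |redForm α β x y| ∨
      y ^ 2 * ((α - a) * (a + β) / (α + β)) ≤ |redForm α β x y| := by
  have h1 : |redForm α β x y| = (α * y - x) * (x + β * y) / (α + β) := by
    have h2 : redForm α β x y = -((α * y - x) * (x + β * y) / (α + β)) := by
      rw [redForm]; ring
    rw [h2, abs_neg, abs_of_nonneg]
    have h3 : 0 ≤ α * y - x := by nlinarith
    positivity
  rw [h1]
  rw [← mul_div_assoc, ← mul_div_assoc, div_le_div_iff_of_pos_right hαβ,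
    div_le_div_iff_of_pos_right hαβ]
  -- For fixed `y` the absolute value is a concave quadratic in `x`, with the same value at `0` and
  -- `(α - β) y`. To the left of the latter point it is at least the value at `0`, to the right at
  -- least the value at `a y`.
  rcases le_total ((α - β) * y) x with h | h
  · right
    nlinarith [mul_nonneg (sub_nonneg.2 hxy) (sub_nonneg.2 h), mul_nonneg (sub_nonneg.2 hxy) hx,
      mul_nonneg (mul_nonneg ha0 hy.le) (sub_nonneg.2 hxy)]
  · left
    nlinarith [mul_nonneg hx (sub_nonneg.2 h)]

/-- Coordinates of an integer vector with respect to the `n`-th pair of convergents. -/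
def coord (a : ℕ → ℕ) : ℕ → ℤ × ℤ → ℤ × ℤ
  | 0, v => v
  | n + 1, v => coord (fun i => a (i + 1)) n (v.2, v.1 - a 0 * v.2)

lemma coord_injective (a : ℕ → ℕ) (n : ℕ) : Function.Injective (coord a n) := by
  induction n generalizing a with
  | zero => exact fun _ _ h => h
  | succ n ih =>
    intro v w h
    have h1 := ih _ h
    simp only [Prod.mk.injEq] at h1
    obtain ⟨h2, h3⟩ := h1
    rw [h2] at h3
    exact Prod.ext (by linarith) h2

/-- Data of the complete quotients `α n` and the backward fractions `β n`. -/
structure Chain (a : ℕ → ℕ) (α β : ℕ → ℝ) : Prop where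
  one_le : ∀ n, 1 ≤ a n
  one_lt : ∀ n, 1 < α n
  nonneg : ∀ n, 0 ≤ β n
  eq_α : ∀ n, α n = a n + 1 / α (n + 1)
  eq_β : ∀ n, β (n + 1) = 1 / (a n + β n)

lemma Chain.tail {a : ℕ → ℕ} {α β : ℕ → ℝ} (h : Chain a α β) :
    Chain (fun n => a (n + 1)) (fun n => α (n + 1)) (fun n => β (n + 1)) :=
  ⟨fun _ => h.one_le _, fun _ => h.one_lt _, fun _ => h.nonneg _, fun _ => h.eq_α _,
    fun _ => h.eq_β _⟩

lemma Chain.abs_redForm {a : ℕ → ℕ} {α β : ℕ → ℝ} (h : Chain a α β) (n : ℕ) (v : ℤ × ℤ) :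
    |redForm (α n) (β n) (coord a n v).1 (coord a n v).2| = |redForm (α 0) (β 0) v.1 v.2| := by
  induction n generalizing a α β v with
  | zero => rfl
  | succ n ih =>
    have h1 := ih h.tail (v.2, v.1 - a 0 * v.2)
    simp only [coord]
    rw [h1, redForm_step (a := a 0) (α := α 0) (β := β 0) (α' := α (0 + 1)) (β' := β (0 + 1))
      (by linarith [h.one_lt (0 + 1)])
      (by have := h.nonneg 0; have : (1 : ℝ) ≤ a 0 := by exact_mod_cast h.one_le 0
          linarith) (h.eq_α 0) (h.eq_β 0), abs_neg]
    push_cast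
    rfl

/-- One step interchanges the roles of the coordinates, so two steps restore the inequality `x ≤ α
y`. They strictly decrease the positive integer `y`, so the process stops. -/
lemma Chain.descent {a : ℕ → ℕ} {α β : ℕ → ℝ} (h : Chain a α β) (v : ℤ × ℤ) (hx : 0 ≤ v.1)
    (hy : 0 < v.2) (hxy : (v.1 : ℝ) ≤ α 0 * v.2) :
    ∃ n, 0 ≤ (coord a n v).1 ∧ 0 < (coord a n v).2 ∧
      (coord a n v).1 ≤ a n * (coord a n v).2 := by
  obtain ⟨N, hN⟩ : ∃ N : ℕ, v.2.toNat ≤ N := ⟨_, le_rfl⟩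
  induction N generalizing a α β v with
  | zero => omega
  | succ N ih =>
    obtain ⟨x, y⟩ := v
    simp only at *
    rcases le_or_gt x (a 0 * y) with hle | hgt
    · exact ⟨0, hx, hy, hle⟩
    · have h0 := h.eq_α 0
      have h1 := h.eq_α 1
      simp only [zero_add] at h0
      have hα1 := h.one_lt 1
      have hα2 := h.one_lt 2
      have hpos : (0 : ℝ) < ((x - a 0 * y : ℤ) : ℝ) := by exact_mod_cast sub_pos.2 hgt
      have hle1 : α 1 * ((x - a 0 * y : ℤ) : ℝ) ≤ y := by
        have : ((x - a 0 * y : ℤ) : ℝ) ≤ 1 / α 1 * y := by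
          push_cast
          rw [h0] at hxy
          linarith
        calc α 1 * ((x - a 0 * y : ℤ) : ℝ) ≤ α 1 * (1 / α 1 * y) := by gcongr
          _ = y := by field_simp
      have hle2 : ((x - a 0 * y : ℤ) : ℝ) ≤ α 2 * ((y - a 1 * (x - a 0 * y) : ℤ) : ℝ) := by
        have h3 : 1 / α 2 * ((x - a 0 * y : ℤ) : ℝ) ≤ ((y - a 1 * (x - a 0 * y) : ℤ) : ℝ) := by
          rw [h1] at hle1
          push_cast at *
          linarith
        calc ((x - a 0 * y : ℤ) : ℝ) = α 2 * (1 / α 2 * ((x - a 0 * y : ℤ) : ℝ)) := by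
              field_simp
          _ ≤ _ := by gcongr
      have hy2 : 0 < y - a 1 * (x - a 0 * y) := by
        have : (0 : ℝ) < ((y - a 1 * (x - a 0 * y) : ℤ) : ℝ) := by
          by_contra hneg
          have := mul_nonpos_of_nonneg_of_nonpos (by linarith : 0 ≤ α 2) (not_lt.1 hneg)
          linarith
        exact_mod_cast this
      have ha1 : (1 : ℤ) ≤ a 1 := by exact_mod_cast h.one_le 1
      have hlt : y - a 1 * (x - a 0 * y) < y := by nlinarith
      obtain ⟨n, hn⟩ := ih h.tail.tail (x - a 0 * y, y - a 1 * (x - a 0 * y)) (by simp; omega) hy2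
        hle2 (by simp only; omega)
      exact ⟨n + 2, hn⟩

/-- Lower bound for the values of a form by its values at the convergents. -/
lemma Chain.bound {a : ℕ → ℕ} {α β : ℕ → ℝ} (h : Chain a α β) (v : ℤ × ℤ) (hx : 0 ≤ v.1)
    (hy : 0 < v.2) (hxy : (v.1 : ℝ) ≤ α 0 * v.2) :
    ∃ n, 0 ≤ (coord a n v).1 ∧ 0 < (coord a n v).2 ∧
      (coord a n v).1 ≤ a n * (coord a n v).2 ∧
      (((coord a n v).2 : ℝ) ^ 2 * (α n * β n / (α n + β n)) ≤ |redForm (α 0) (β 0) v.1 v.2| ∨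
        ((coord a n v).2 : ℝ) ^ 2 * (1 / (α (n + 1) + β (n + 1))) ≤
          |redForm (α 0) (β 0) v.1 v.2|) := by
  obtain ⟨n, h1, h2, h3⟩ := h.descent v hx hy hxy
  refine ⟨n, h1, h2, h3, ?_⟩
  have hα := h.one_lt n
  have hα' := h.one_lt (n + 1)
  have hβ := h.nonneg n
  have ha : (1 : ℝ) ≤ a n := by exact_mod_cast h.one_le n
  have he := h.eq_α n
  have hi : 0 < 1 / α (n + 1) := by positivity
  have key := redForm_ge (a := a n) (α := α n) (β := β n) (x := (coord a n v).1)
    (y := (coord a n v).2) (by linarith) (by linarith) hβ (by linarith) (by exact_mod_cast h2)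
    (by exact_mod_cast h1) (by exact_mod_cast h3)
  rw [h.abs_redForm n v] at key
  have hconv : (α n - a n) * (a n + β n) / (α n + β n) = 1 / (α (n + 1) + β (n + 1)) := by
    have h0 : α n - a n = 1 / α (n + 1) := by linarith
    have h5 : 0 < a n + β n := by linarith
    rw [h0, h.eq_β n, he]
    have h6 : 0 < (a n : ℝ) + 1 / α (n + 1) + β n := by positivity
    field_simp
    ring
  rwa [hconv] at key

/-! ### The form of a bi-infinite sequence -/

/-- `[S i; S (i + 1), …]`. -/
noncomputable def alphaS (S : ℤ → ℕ) (i : ℤ) : ℝ := cfValue (rightSeq S i)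

/-- `[0; S (i - 1), S (i - 2), …]`. -/
noncomputable def betaS (S : ℤ → ℕ) (i : ℤ) : ℝ := 1 / cfValue (leftSeq S (i - 1))

section
variable {S : ℤ → ℕ}

lemma lam_eq_add (S : ℤ → ℕ) (i : ℤ) : lam S i = alphaS S i + betaS S i := rfl

lemma one_lt_alphaS (hS : ∀ i, 1 ≤ S i) (i : ℤ) : 1 < alphaS S i :=
  one_lt_cfValue fun _ => hS _

lemma betaS_pos (hS : ∀ i, 1 ≤ S i) (i : ℤ) : 0 < betaS S i := by
  have := one_lt_cfValue (a := leftSeq S (i - 1)) fun _ => hS _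
  rw [betaS]; positivity

lemma lam_pos (hS : ∀ i, 1 ≤ S i) (i : ℤ) : 0 < lam S i := by
  rw [lam_eq_add]; linarith [one_lt_alphaS hS i, betaS_pos hS i]

lemma alphaS_eq (hS : ∀ i, 1 ≤ S i) (i : ℤ) : alphaS S i = S i + 1 / alphaS S (i + 1) :=
  cfValue_rightSeq hS i

lemma betaS_eq (hS : ∀ i, 1 ≤ S i) (i : ℤ) : betaS S (i + 1) = 1 / (S i + betaS S i) := by
  rw [betaS, add_sub_cancel_right, cfValue_leftSeq hS]; rfl

lemma redForm_stepS (hS : ∀ i, 1 ≤ S i) (i : ℤ) (x y : ℝ) :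
    redForm (alphaS S i) (betaS S i) x y =
      -redForm (alphaS S (i + 1)) (betaS S (i + 1)) y (x - S i * y) :=
  redForm_step (by linarith [one_lt_alphaS hS (i + 1)])
    (by have := betaS_pos hS i; positivity) (alphaS_eq hS i) (betaS_eq hS i) x y

lemma chainS (hS : ∀ i, 1 ≤ S i) (i : ℤ) :
    Chain (rightSeq S i) (fun n => alphaS S (i + n)) (fun n => betaS S (i + n)) := by
  refine ⟨fun _ => hS _, fun _ => one_lt_alphaS hS _, fun _ => (betaS_pos hS _).le, fun n => ?_,
    fun n => ?_⟩
  · simp only [rightSeq]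
    rw [alphaS_eq hS]; congr 3; push_cast; ring
  · simp only [rightSeq]
    rw [← betaS_eq hS]; congr 1; push_cast; ring

lemma exists_le_redForm_of_le (hS : ∀ i, 1 ≤ S i) (i : ℤ) {x y : ℤ} (hx : 0 ≤ x) (hy : 0 < y)
    (hxy : (x : ℝ) ≤ alphaS S i * y) :
    ∃ n, 1 / lam S n ≤ |redForm (alphaS S i) (betaS S i) x y| := by
  obtain ⟨n, h1, h2, h3, h4⟩ := (chainS hS i).bound (x, y) hx hy (by simpa using hxy)
  simp only [Nat.cast_zero, add_zero] at h4
  have hy1 : (1 : ℝ) ≤ ((coord (rightSeq S i) n (x, y)).2 : ℝ) ^ 2 := by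
    have : (1 : ℝ) ≤ ((coord (rightSeq S i) n (x, y)).2 : ℝ) := by exact_mod_cast h2
    nlinarith
  rcases h4 with h4 | h4
  · refine ⟨i + n - 1, le_trans ?_ h4⟩
    have hα := one_lt_alphaS hS (i + n)
    have hβ := betaS_pos hS (i + n)
    have e1 := alphaS_eq hS (i + n - 1)
    have e2 := betaS_eq hS (i + n - 1)
    rw [sub_add_cancel] at e1 e2
    have hβ' := betaS_pos hS (i + n - 1)
    have hs : (1 : ℝ) ≤ S (i + n - 1) := by exact_mod_cast hS _
    -- The left end of the segment is the preceding convergent: with `α`, `β` at `i + n`, the value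
    -- of `λ` one place earlier is `1/α + 1/β`.
    have e3 : lam S (i + n - 1) = 1 / alphaS S (i + n) + 1 / betaS S (i + n) := by
      rw [lam_eq_add, e1, e2, one_div_one_div]; ring
    have e4 : 1 / lam S (i + n - 1) =
        alphaS S (i + n) * betaS S (i + n) / (alphaS S (i + n) + betaS S (i + n)) := by
      rw [e3]; field_simp; ring
    rw [e4]
    exact le_mul_of_one_le_left (by positivity) hy1
  · refine ⟨i + (n + 1 : ℕ), le_trans ?_ h4⟩
    have := lam_pos hS (i + (n + 1 : ℕ))
    exact le_mul_of_one_le_left (by positivity) hy1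

lemma exists_le_redForm_of_nonneg (hS : ∀ i, 1 ≤ S i) (i : ℤ) {x y : ℤ} (hx : 0 ≤ x) (hy : 0 < y) :
    ∃ n, 1 / lam S n ≤ |redForm (alphaS S i) (betaS S i) x y| := by
  rcases le_or_gt (x : ℝ) (alphaS S i * y) with h | h
  · exact exists_le_redForm_of_le hS i hx hy h
  · have h1 := alphaS_eq hS i
    have h2 := one_lt_alphaS hS (i + 1)
    have hy' : (0 : ℝ) < y := by exact_mod_cast hy
    have h3 : 1 / alphaS S (i + 1) * y < ((x - S i * y : ℤ) : ℝ) := by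
      push_cast; rw [h1] at h; linarith
    have h4 : 0 < x - S i * y := by
      have : (0 : ℝ) < 1 / alphaS S (i + 1) * y := by positivity
      exact_mod_cast this.trans h3
    obtain ⟨n, hn⟩ := exists_le_redForm_of_le hS (i + 1) hy.le h4 (by
      calc (y : ℝ) = alphaS S (i + 1) * (1 / alphaS S (i + 1) * y) := by field_simp
        _ ≤ _ := by gcongr)
    refine ⟨n, ?_⟩
    rw [redForm_stepS hS, abs_neg]
    simpa using hn

lemma exists_le_redForm (hS : ∀ i, 1 ≤ S i) (i : ℤ) {v : ℤ × ℤ} (hv : v ≠ 0) :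
    ∃ n, 1 / lam S n ≤ |redForm (alphaS S i) (betaS S i) v.1 v.2| := by
  have hpos : ∀ x y : ℤ, 0 < y →
      ∃ n, 1 / lam S n ≤ |redForm (alphaS S i) (betaS S i) x y| := by
    intro x y hy
    rcases le_or_gt 0 x with hx | hx
    · exact exists_le_redForm_of_nonneg hS i hx hy
    -- For `x < 0 < y` the vector `(y, -x)` lies in the first quadrant for the reversed sequence,
    -- where `α` and `β` are replaced by `1/β` and `1/α`.
    · obtain ⟨n, hn⟩ := exists_le_redForm_of_nonneg (S := rev S) (fun _ => hS _) (1 - i)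
        (x := y) (y := -x) hy.le (by omega)
      have h1 : alphaS (rev S) (1 - i) = 1 / betaS S i := by
        rw [alphaS, rightSeq_rev, betaS, one_div_one_div]; congr 2; ring
      have h2 : betaS (rev S) (1 - i) = 1 / alphaS S i := by
        rw [alphaS, betaS, leftSeq_rev]; congr 3; ring
      refine ⟨-n, ?_⟩
      rw [lam_rev hS, h1, h2] at hn
      refine hn.trans (le_of_eq ?_)
      have hα := one_lt_alphaS hS i
      have hβ := betaS_pos hS i
      rw [← abs_neg (redForm (alphaS S i) _ _ _)]
      congr 1
      rw [redForm, redForm]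
      have h3 : 1 / betaS S i + 1 / alphaS S i =
        (alphaS S i + betaS S i) / (alphaS S i * betaS S i) := by field_simp
      rw [h3]
      push_cast
      field_simp
      ring
  obtain ⟨x, y⟩ := v
  rcases lt_trichotomy y 0 with hy | rfl | hy
  · obtain ⟨n, hn⟩ := hpos (-x) (-y) (by omega)
    refine ⟨n, ?_⟩
    push_cast at hn
    rwa [redForm_neg] at hn
  · have hx : x ≠ 0 := fun h => hv (by rw [h]; rfl)
    refine ⟨i, ?_⟩
    have hl := lam_pos hS i
    have h1 : (1 : ℝ) ≤ (x : ℝ) ^ 2 := by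
      have : 1 ≤ x ^ 2 := by have := Int.one_le_abs hx; rw [← sq_abs]; nlinarith
      exact_mod_cast this
    simp only [redForm, Int.cast_zero, mul_zero, sub_zero, add_zero]
    rw [← lam_eq_add, abs_of_nonneg (by nlinarith [div_nonneg (mul_self_nonneg (x : ℝ)) hl.le])]
    gcongr
    nlinarith
  · exact hpos x y hy

lemma redForm_one_zero (S : ℤ → ℕ) (i : ℤ) :
    redForm (alphaS S i) (betaS S i) 1 0 = 1 / lam S i := by
  simp [redForm, lam_eq_add]

/-- The suprema of `λᵢ(S)` that are attained belong to the Markov spectrum. -/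
theorem lam_mem_markovSpectrum (hS : ∀ i, 1 ≤ S i) {p : ℤ} (h : ∀ i, lam S i ≤ lam S p) :
    lam S p ∈ markovSpectrum := by
  have hα := one_lt_alphaS hS p
  have hβ := betaS_pos hS p
  have hl := lam_pos hS p
  set α := alphaS S p with hαd
  set β := betaS S p with hβd
  have hdisc : ((β - α) / (α + β)) ^ 2 - 4 * (1 / (α + β)) * (-(α * β) / (α + β)) = 1 := by
    have : α + β ≠ 0 := by positivity
    field_simp; ring
  have hval : ∀ x y : ℝ, 1 / (α + β) * x ^ 2 + (β - α) / (α + β) * x * y +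
      -(α * β) / (α + β) * y ^ 2 = redForm α β x y := fun x y => by
    have : α + β ≠ 0 := by positivity
    rw [redForm]; field_simp; ring
  have hinf : formInf (1 / (α + β)) ((β - α) / (α + β)) (-(α * β) / (α + β)) = 1 / lam S p := by
    simp only [formInf, hval]
    have : Nonempty {v : ℤ × ℤ // v ≠ 0} := ⟨⟨(1, 0), by simp⟩⟩
    refine le_antisymm ?_ (le_ciInf fun v => ?_)
    · refine (ciInf_le ⟨0, ?_⟩ ⟨(1, 0), by simp⟩).trans (le_of_eq ?_)
      · rintro _ ⟨v, rfl⟩; exact abs_nonneg _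
      · simp only [Int.cast_one, Int.cast_zero]
        rw [redForm_one_zero, abs_of_pos (by positivity)]
    · obtain ⟨n, hn⟩ := exists_le_redForm hS p v.2
      exact le_trans (one_div_le_one_div_of_le (lam_pos hS n) (h n)) hn
  refine ⟨1 / (α + β), (β - α) / (α + β), -(α * β) / (α + β), ?_, ?_, ?_⟩
  · rw [hdisc]; norm_num
  · rw [hinf]; positivity
  · rw [hinf, hdisc, Real.sqrt_one, one_div_one_div]

end

/-! ### Continued fraction expansions of irrational numbers -/

/-- The complete quotients of `ξ`. -/
noncomputable def quot (ξ : ℝ) : ℕ → ℝ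
  | 0 => ξ
  | n + 1 => (Int.fract (quot ξ n))⁻¹

lemma irrational_fract {ξ : ℝ} (h : Irrational ξ) : Irrational (Int.fract ξ) :=
  h.sub_intCast _

lemma irrational_quot {ξ : ℝ} (h : Irrational ξ) (n : ℕ) : Irrational (quot ξ n) := by
  induction n with
  | zero => exact h
  | succ n ih => exact (irrational_fract ih).inv

lemma one_lt_inv_fract {ξ : ℝ} (h : Irrational ξ) : 1 < (Int.fract ξ)⁻¹ := by
  have h1 : 0 < Int.fract ξ :=
    lt_of_le_of_ne (Int.fract_nonneg _) (irrational_fract h).ne_zero.symm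
  exact (one_lt_inv₀ h1).2 (Int.fract_lt_one _)

lemma one_lt_quot_succ {ξ : ℝ} (h : Irrational ξ) (n : ℕ) : 1 < quot ξ (n + 1) :=
  one_lt_inv_fract (irrational_quot h n)

lemma quot_eq (ξ : ℝ) (n : ℕ) : quot ξ n = ⌊quot ξ n⌋ + 1 / quot ξ (n + 1) := by
  rw [quot, one_div, inv_inv, Int.floor_add_fract]

/-- The partial quotients of `ξ` from the first one on. -/
noncomputable def pquot (ξ : ℝ) (n : ℕ) : ℕ := ⌊quot ξ (n + 1)⌋.toNat

lemma pquot_cast {ξ : ℝ} (h : Irrational ξ) (n : ℕ) : (pquot ξ n : ℤ) = ⌊quot ξ (n + 1)⌋ :=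
  Int.toNat_of_nonneg (Int.floor_nonneg.2 (by linarith [one_lt_quot_succ h n]))

lemma one_le_pquot {ξ : ℝ} (h : Irrational ξ) (n : ℕ) : 1 ≤ pquot ξ n := by
  have h1 : (1 : ℤ) ≤ ⌊quot ξ (n + 1)⌋ :=
    Int.le_floor.2 (by simpa using (one_lt_quot_succ h n).le)
  have := pquot_cast h n
  omega

lemma isCF_quot {ξ : ℝ} (h : Irrational ξ) : IsCF (pquot ξ) (fun n => quot ξ (n + 1)) := fun n => by
  refine ⟨(one_lt_quot_succ h n).le, ?_⟩
  have h1 : (pquot ξ n : ℝ) = (⌊quot ξ (n + 1)⌋ : ℝ) := by exact_mod_cast pquot_cast h n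
  rw [h1]
  exact quot_eq ξ (n + 1)

lemma cfValue_pquot {ξ : ℝ} (h : Irrational ξ) (n : ℕ) :
    cfValue (fun i => pquot ξ (i + n)) = quot ξ (n + 1) := by
  have := ((isCF_quot h).shift n).eq_cfValue (fun _ => one_le_pquot h _)
  rw [← this, zero_add]

/-- `pquot` skips the integer part, so it is applied to `ξ⁻¹ ∈ (0, 1)`, whose first complete
quotient is `ξ`. -/
lemma exists_cfValue_eq {ξ : ℝ} (h : Irrational ξ) (h1 : 1 < ξ) :
    ∃ a : ℕ → ℕ, (∀ n, 1 ≤ a n) ∧ cfValue a = ξ := by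
  have h2 : Irrational ξ⁻¹ := h.inv
  have h3 : Int.fract ξ⁻¹ = ξ⁻¹ :=
    Int.fract_eq_self.2 ⟨by positivity, (inv_lt_one₀ (by linarith)).2 h1⟩
  refine ⟨pquot ξ⁻¹, one_le_pquot h2, ?_⟩
  have := cfValue_pquot h2 0
  simp only [add_zero, quot, h3, inv_inv] at this
  exact this

/-! ### Reduction of indefinite forms -/

/-- The second root along the continued fraction expansion of the first root. -/
noncomputable def conj (ξ η : ℝ) : ℕ → ℝ
  | 0 => η
  | n + 1 => (conj ξ η n - ⌊quot ξ n⌋)⁻¹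

lemma irrational_conj (ξ : ℝ) {η : ℝ} (h : Irrational η) (n : ℕ) : Irrational (conj ξ η n) := by
  induction n with
  | zero => exact h
  | succ n ih => exact (ih.sub_intCast _).inv

/-- Once the second root is negative, the next step moves it into `(-1, 0)`. If it were never
negative from the first step on, it would always be at least 1, hence satisfy the same continued
fraction recursion as the first root and be equal to it. -/
lemma exists_conj_neg {ξ η : ℝ} (hξ : Irrational ξ) (hne : ξ ≠ η) :
    ∃ n, -1 < conj ξ η (n + 1) ∧ conj ξ η (n + 1) < 0 := by
  have hk : ∀ n, (1 : ℝ) ≤ ⌊quot ξ (n + 1)⌋ := fun n => by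
    have := one_le_pquot hξ n
    rw [← pquot_cast hξ n]
    exact_mod_cast this
  by_cases hex : ∃ n, conj ξ η (n + 1) < 0
  · obtain ⟨n, hn⟩ := hex
    refine ⟨n + 1, ?_⟩
    rw [conj]
    have h1 : conj ξ η (n + 1) - ⌊quot ξ (n + 1)⌋ < -1 := by linarith [hk n]
    refine ⟨?_, inv_lt_zero.2 (by linarith)⟩
    have := one_div_lt_one_div_of_neg_of_lt (by norm_num : (-1 : ℝ) < 0) h1
    rw [← one_div]
    linarith
  · exfalso
    push Not at hex
    have hge : ∀ n, 1 ≤ conj ξ η (n + 1) := fun n => by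
      by_contra! hlt
      have h1 := hex (n + 1)
      rw [conj] at h1
      have : conj ξ η (n + 1) - ⌊quot ξ (n + 1)⌋ < 0 := by linarith [hk n]
      exact absurd h1 (not_le.2 (inv_lt_zero.2 this))
    have hcf : IsCF (pquot ξ) (fun n => conj ξ η (n + 1)) := fun n => by
      refine ⟨hge n, ?_⟩
      have h1 : (pquot ξ n : ℝ) = (⌊quot ξ (n + 1)⌋ : ℝ) := by exact_mod_cast pquot_cast hξ n
      simp only
      rw [h1, show conj ξ η (n + 1 + 1) = (conj ξ η (n + 1) - ⌊quot ξ (n + 1)⌋)⁻¹ from rfl, one_div,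
        inv_inv]
      ring
    have h1 := hcf.eq_cfValue (one_le_pquot hξ)
    have h2 := (isCF_quot hξ).eq_cfValue (one_le_pquot hξ)
    rw [← h2] at h1
    simp only [conj, quot] at h1
    have h3 := inv_injective h1
    rw [Int.fract] at h3
    exact hne (by linarith)

/-- The unimodular substitution `(x, y) ↦ (y, x - k y)`. -/
def stepEquiv (k : ℤ) : ℤ × ℤ ≃+ ℤ × ℤ where
  toFun v := (v.2, v.1 - k * v.2)
  invFun v := (k * v.1 + v.2, v.1)
  left_inv v := by ext <;> simp
  right_inv v := by ext <;> simp
  map_add' v w := by ext <;> simp; ring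

lemma exists_equiv_quot {ξ η : ℝ} (hξ : Irrational ξ) (hη : Irrational η) (A : ℝ) (n : ℕ) :
    ∃ (B : ℝ) (g : ℤ × ℤ ≃+ ℤ × ℤ), ∀ v : ℤ × ℤ,
      A * (v.1 - ξ * v.2) * (v.1 - η * v.2) =
        B * ((g v).1 - quot ξ n * (g v).2) * ((g v).1 - conj ξ η n * (g v).2) ∧
      A ^ 2 * (ξ - η) ^ 2 = B ^ 2 * (quot ξ n - conj ξ η n) ^ 2 := by
  induction n with
  | zero => exact ⟨A, AddEquiv.refl _, fun v => ⟨rfl, rfl⟩⟩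
  | succ n ih =>
    obtain ⟨B, g, hg⟩ := ih
    have h1 : quot ξ n - ⌊quot ξ n⌋ ≠ 0 := (irrational_fract (irrational_quot hξ n)).ne_zero
    have h2 : conj ξ η n - ⌊quot ξ n⌋ ≠ 0 := ((irrational_conj ξ hη n).sub_intCast _).ne_zero
    refine ⟨B * (quot ξ n - ⌊quot ξ n⌋) * (conj ξ η n - ⌊quot ξ n⌋),
      g.trans (stepEquiv ⌊quot ξ n⌋), fun v => ⟨?_, ?_⟩⟩
    · rw [(hg v).1]
      simp only [AddEquiv.trans_apply, stepEquiv, AddEquiv.coe_mk, Equiv.coe_fn_mk, quot, conj,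
        Int.fract]
      push_cast
      field_simp
      ring
    · rw [(hg 0).2]
      simp only [quot, conj, Int.fract]
      field_simp
      ring

lemma exists_equiv_redForm {S : ℤ → ℕ} (hS : ∀ i, 1 ≤ S i) (n : ℤ) :
    ∃ g : ℤ × ℤ ≃+ ℤ × ℤ, ∀ v : ℤ × ℤ, |redForm (alphaS S 0) (betaS S 0) v.1 v.2| =
      |redForm (alphaS S n) (betaS S n) (g v).1 (g v).2| := by
  induction n using Int.induction_on with
  | zero => exact ⟨AddEquiv.refl _, fun v => rfl⟩
  | succ n ih =>
    obtain ⟨g, hg⟩ := ih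
    refine ⟨g.trans (stepEquiv (S n)), fun v => ?_⟩
    rw [hg, redForm_stepS hS, abs_neg]
    simp [stepEquiv]
  | pred n ih =>
    obtain ⟨g, hg⟩ := ih
    refine ⟨g.trans (stepEquiv (S (-n - 1))).symm, fun v => ?_⟩
    rw [hg, redForm_stepS hS (-n - 1), abs_neg, sub_add_cancel]
    simp [stepEquiv]

lemma exists_seq_of_pair {a b : ℕ → ℕ} (ha : ∀ n, 1 ≤ a n) (hb : ∀ n, 1 ≤ b n) :
    ∃ S : ℤ → ℕ, (∀ i, 1 ≤ S i) ∧ alphaS S 0 = cfValue a ∧ betaS S 0 = 1 / cfValue b := by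
  refine ⟨fun n => if 0 ≤ n then a n.toNat else b (-n - 1).toNat, fun i => ?_, ?_, ?_⟩
  · simp only; split_ifs
    · exact ha _
    · exact hb _
  · rw [alphaS]; congr 1; funext n; simp [rightSeq]
  · rw [betaS]; congr 2; funext n
    simp only [leftSeq]
    rw [if_neg (by omega)]
    congr 1; omega

/-- The elements of the Markov spectrum are suprema of values `λᵢ(S)`. -/
theorem exists_isSupLam {x : ℝ} (hx : x ∈ markovSpectrum) :
    ∃ S : ℤ → ℕ, (∀ i, 1 ≤ S i) ∧ IsSupLam S x := by
  obtain ⟨a, b, c, hD, hm, rfl⟩ := hx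
  set D := b ^ 2 - 4 * a * c with hDd
  set m := formInf a b c with hmd
  have hbdd : BddBelow (range fun v : {v : ℤ × ℤ // v ≠ 0} =>
      |a * (v.1.1 : ℝ) ^ 2 + b * (v.1.1 : ℝ) * (v.1.2 : ℝ) + c * (v.1.2 : ℝ) ^ 2|) :=
    ⟨0, by rintro _ ⟨v, rfl⟩; exact abs_nonneg _⟩
  have hle : ∀ v : ℤ × ℤ, v ≠ 0 →
      m ≤ |a * (v.1 : ℝ) ^ 2 + b * (v.1 : ℝ) * (v.2 : ℝ) + c * (v.2 : ℝ) ^ 2| :=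
    fun v hv => ciInf_le hbdd ⟨v, hv⟩
  have ha : a ≠ 0 := by
    intro h0
    have := hle (1, 0) (by simp)
    simp [h0] at this
    linarith
  have hsq : 0 < √D := Real.sqrt_pos.2 hD
  have hsq2 : √D ^ 2 = D := Real.sq_sqrt hD.le
  set ξ := (-b + √D) / (2 * a) with hξd
  set η := (-b - √D) / (2 * a) with hηd
  have hfac : ∀ x y : ℝ, a * x ^ 2 + b * x * y + c * y ^ 2 =
      a * (x - ξ * y) * (x - η * y) := fun x y => by
    have : c = (b ^ 2 - √D ^ 2) / (4 * a) := by rw [hsq2, hDd]; field_simp; ring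
    rw [this, hξd, hηd]
    field_simp
    ring
  -- A positive infimum excludes integer zeros other than the origin, so neither root is rational.
  have hirr : ∀ ρ : ℝ, (∀ x y : ℝ, x - ρ * y = 0 → a * x ^ 2 + b * x * y + c * y ^ 2 = 0) →
      Irrational ρ := by
    rintro ρ hρ ⟨r, rfl⟩
    have h1 := hle (r.num, r.den) (by
      intro h; have := congrArg Prod.snd h; simp at this)
    have h2 := hρ r.num r.den (by
      have : (r.den : ℝ) ≠ 0 := by exact_mod_cast r.den_nz
      rw [Rat.cast_def r]; field_simp; ring)
    simp only [Int.cast_natCast] at h1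
    rw [h2, abs_zero] at h1
    linarith
  have hξ : Irrational ξ := hirr ξ fun x y h => by rw [hfac, h]; ring
  have hη : Irrational η := hirr η fun x y h => by rw [hfac, h]; ring
  have hdiff : ξ - η = √D / a := by rw [hξd, hηd]; field_simp; ring
  have hne : ξ ≠ η := fun h => by
    rw [h, sub_self] at hdiff
    exact (div_ne_zero hsq.ne' ha) hdiff.symm
  obtain ⟨n, hn1, hn2⟩ := exists_conj_neg hξ hne
  obtain ⟨B, g, hg⟩ := exists_equiv_quot hξ hη a (n + 1)
  set α := quot ξ (n + 1) with hα
  set β := -conj ξ η (n + 1) with hβ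
  have hα1 : 1 < α := one_lt_quot_succ hξ n
  have hβ0 : 0 < β := by rw [hβ]; linarith
  have hβ1 : β < 1 := by rw [hβ]; linarith
  have hβi : Irrational β⁻¹ := (irrational_conj ξ hη (n + 1)).neg.inv
  obtain ⟨u, hu, hu'⟩ := exists_cfValue_eq (irrational_quot hξ (n + 1)) hα1
  obtain ⟨w, hw, hw'⟩ := exists_cfValue_eq hβi ((one_lt_inv₀ hβ0).2 hβ1)
  obtain ⟨S, hS, hS1, hS2⟩ := exists_seq_of_pair hu hw
  rw [hu', ← hα] at hS1
  rw [hw', one_div, inv_inv] at hS2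
  have hB : |B| * (α + β) = √D := by
    have h1 := (hg 0).2
    rw [hdiff] at h1
    have h2 : (|B| * (α + β)) ^ 2 = √D ^ 2 := by
      rw [mul_pow, sq_abs, hβ, ← sub_eq_add_neg, ← h1]
      field_simp
    exact (sq_eq_sq₀ (by positivity) hsq.le).1 h2
  have hval : ∀ v : ℤ × ℤ,
      |a * (v.1 : ℝ) ^ 2 + b * (v.1 : ℝ) * (v.2 : ℝ) + c * (v.2 : ℝ) ^ 2| =
        √D * |redForm (alphaS S 0) (betaS S 0) (g v).1 (g v).2| := fun v => by
    rw [hfac, (hg v).1, hS1, hS2, redForm, abs_div, abs_of_pos (by linarith : 0 < α + β), ← hB]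
    have hβ' : conj ξ η (n + 1) = -β := by rw [hβ, neg_neg]
    rw [hβ', mul_assoc, abs_mul, sub_eq_add_neg ((g v).1 : ℝ) (-β * _), neg_mul, neg_neg]
    field_simp
  refine ⟨S, hS, fun i => ?_, fun y hy => ?_⟩
  · obtain ⟨h, hh⟩ := exists_equiv_redForm hS i
    have hl := lam_pos hS i
    -- In the coordinates at place `i` the form takes the value `√D / λᵢ`, up to sign, at `(1, 0)`.
    -- This yields the upper bound for every `λᵢ`; the lower bound for the form yields the
    -- approximation from below.
    set v := g.symm (h.symm (1, 0)) with hv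
    have hv0 : v ≠ 0 := by
      rw [hv, Ne, AddEquiv.map_eq_zero_iff, AddEquiv.map_eq_zero_iff]; simp
    have h1 := hle v hv0
    rw [hval, hh, hv, AddEquiv.apply_symm_apply, AddEquiv.apply_symm_apply] at h1
    simp only [Int.cast_one, Int.cast_zero] at h1
    rw [redForm_one_zero, abs_of_pos (by positivity)] at h1
    rw [le_div_iff₀ hm]
    have : m * lam S i ≤ √D * (1 / lam S i) * lam S i := by gcongr
    rw [mul_assoc, one_div_mul_cancel hl.ne', mul_one] at this
    linarith
  · rcases le_or_gt y 0 with hy0 | hy0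
    · exact ⟨0, hy0.trans_lt (lam_pos hS 0)⟩
    · have h1 : m < √D / y := by
        rw [lt_div_iff₀ hy0]
        rw [lt_div_iff₀ hm] at hy
        linarith
      have : Nonempty {v : ℤ × ℤ // v ≠ 0} := ⟨⟨(1, 0), by simp⟩⟩
      obtain ⟨⟨v, hv⟩, h2⟩ := exists_lt_of_ciInf_lt (hmd ▸ h1 : formInf a b c < √D / y)
      simp only at h2
      rw [hval] at h2
      obtain ⟨k, hk⟩ := exists_le_redForm hS 0 (v := g v)
        (by rwa [Ne, AddEquiv.map_eq_zero_iff])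
      refine ⟨k, ?_⟩
      have hl := lam_pos hS k
      have h3 : √D * (1 / lam S k) < √D * (1 / y) := by
        calc _ ≤ √D * |redForm (alphaS S 0) (betaS S 0) (g v).1 (g v).2| := by gcongr
          _ < √D / y := h2
          _ = _ := by ring
      have h4 := lt_of_mul_lt_mul_left h3 hsq.le
      exact lt_of_one_div_lt_one_div hl h4

/-! ### The Lagrange value as a limit superior along the continued fraction -/

/-- The vector with coordinates `(1, 0)` with respect to the `n`-th pair of convergents. -/
def convVec : (ℕ → ℕ) → ℕ → ℤ × ℤ
  | _, 0 => (1, 0)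
  | a, n + 1 =>
    (a 0 * (convVec (fun i => a (i + 1)) n).1 + (convVec (fun i => a (i + 1)) n).2,
      (convVec (fun i => a (i + 1)) n).1)

lemma coord_convVec (a : ℕ → ℕ) (n : ℕ) : coord a n (convVec a n) = (1, 0) := by
  induction n generalizing a with
  | zero => rfl
  | succ n ih =>
    simp only [coord, convVec, add_sub_cancel_left]
    exact ih _

lemma convVec_bounds {a : ℕ → ℕ} (ha : ∀ n, 1 ≤ a n) (n : ℕ) :
    1 ≤ (convVec a n).1 ∧ (n : ℤ) ≤ (convVec a n).1 ∧ 0 ≤ (convVec a n).2 ∧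
      (1 ≤ n → 1 ≤ (convVec a n).2) := by
  induction n generalizing a with
  | zero => simp [convVec]
  | succ n ih =>
    obtain ⟨h1, h2, h3, h4⟩ := ih (a := fun i => a (i + 1)) (fun _ => ha _)
    have h0 : (1 : ℤ) ≤ a 0 := by exact_mod_cast ha 0
    simp only [convVec]
    have h5 : (convVec (fun i => a (i + 1)) n).1 ≤ a 0 * (convVec (fun i => a (i + 1)) n).1 := by
      nlinarith
    refine ⟨by linarith, ?_, by linarith, fun _ => h1⟩
    rcases Nat.eq_zero_or_pos n with rfl | hn
    · push_cast; linarith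
    · have := h4 hn
      push_cast; linarith

/-- Denominators over partial quotients, `[0; a (n - 1), …, a 0]`. -/
noncomputable def backFrac (a : ℕ → ℕ) : ℕ → ℝ
  | 0 => 0
  | n + 1 => 1 / (a n + backFrac a n)

lemma backFrac_nonneg (a : ℕ → ℕ) (n : ℕ) : 0 ≤ backFrac a n := by
  induction n with
  | zero => exact le_rfl
  | succ n ih => rw [backFrac]; positivity

lemma backFrac_succ_pos {a : ℕ → ℕ} (ha : ∀ n, 1 ≤ a n) (n : ℕ) : 0 < backFrac a (n + 1) := by
  have h0 : (1 : ℝ) ≤ a n := by exact_mod_cast ha n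
  have := backFrac_nonneg a n
  rw [backFrac]; positivity

lemma chain_quot {ξ : ℝ} (h : Irrational ξ) :
    Chain (pquot ξ) (fun n => quot ξ (n + 1)) (backFrac (pquot ξ)) :=
  ⟨one_le_pquot h, one_lt_quot_succ h, backFrac_nonneg _, fun n => (isCF_quot h n).2,
    fun _ => rfl⟩

/-- `|q (q ξ - p)|` in terms of the reduced form. -/
lemma mul_sub_eq_redForm {ξ : ℝ} (h : Irrational ξ) (p q : ℤ) :
    (q : ℝ) * (q * ξ - p) = redForm (quot ξ 1) 0 q ((p - ⌊ξ⌋ * q : ℤ) : ℝ) := by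
  have h1 : Int.fract ξ ≠ 0 := (irrational_fract h).ne_zero
  have h2 : quot ξ 1 = (Int.fract ξ)⁻¹ := rfl
  have h3 : ξ = ⌊ξ⌋ + Int.fract ξ := (Int.floor_add_fract ξ).symm
  rw [redForm, h2]
  push_cast
  field_simp
  linear_combination (q : ℝ) ^ 2 * h3

/-- `λ` of the one-sided expansion. -/
noncomputable def lamOne (ξ : ℝ) (n : ℕ) : ℝ := quot ξ (n + 1) + backFrac (pquot ξ) n

lemma one_lt_lamOne {ξ : ℝ} (h : Irrational ξ) (n : ℕ) : 1 < lamOne ξ n := by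
  have := one_lt_quot_succ h n
  have := backFrac_nonneg (pquot ξ) n
  rw [lamOne]; linarith

lemma tendsto_cofinite_int {u : ℕ → ℤ} (h : ∀ M : ℝ, ∀ᶠ n in atTop, M < |(u n : ℝ)|) :
    Tendsto u atTop cofinite := by
  rw [Tendsto, le_cofinite_iff_eventually_ne]
  intro x
  rw [eventually_map]
  filter_upwards [h |(x : ℝ)|] with n hn hx
  rw [hx] at hn
  exact lt_irrefl _ hn

lemma eventually_lamOne_lt {ξ : ℝ} (h : Irrational ξ) {c : ℝ} (hc : 0 < c)
    (hlt : lagrangeValue ξ < ENNReal.ofReal c) : ∀ᶠ n in atTop, lamOne ξ n < c := by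
  have hev := eventually_lt_of_limsup_lt hlt
  set P : ℕ → ℤ := fun n => (convVec (pquot ξ) n).2 + ⌊ξ⌋ * (convVec (pquot ξ) n).1
  set Q : ℕ → ℤ := fun n => (convVec (pquot ξ) n).1
  have hval : ∀ n, |(Q n : ℝ) * (Q n * ξ - P n)| = 1 / lamOne ξ n := fun n => by
    have h1 := (chain_quot h).abs_redForm n (convVec (pquot ξ) n)
    rw [coord_convVec] at h1
    rw [mul_sub_eq_redForm h, show P n - ⌊ξ⌋ * Q n = (convVec (pquot ξ) n).2 by simp [P, Q]]
    refine h1.symm.trans ?_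
    have := one_lt_lamOne h n
    simp only [redForm, Int.cast_one, Int.cast_zero, mul_zero, sub_zero, add_zero, mul_one]
    rw [abs_of_pos]
    · rfl
    · rw [lamOne] at this; positivity
  have hQ : ∀ n : ℕ, (n : ℝ) ≤ Q n ∧ (1 : ℝ) ≤ Q n := fun n => by
    have := convVec_bounds (one_le_pquot h) n
    exact ⟨by exact_mod_cast this.2.1, by exact_mod_cast this.1⟩
  -- The limit superior also requires the numerators to tend to infinity; they stay within 1 of `Q n
  -- * ξ`, and `ξ ≠ 0`.
  have hP : ∀ n : ℕ, |ξ| * n - 1 ≤ |(P n : ℝ)| := fun n => by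
    have h1 := hval n
    obtain ⟨h2, h3⟩ := hQ n
    rw [abs_mul, abs_of_pos (by linarith)] at h1
    have h4 : 1 / lamOne ξ n ≤ 1 := by
      have := one_lt_lamOne h n
      rw [div_le_one (by linarith)]; exact this.le
    have h5 : |(Q n : ℝ) * ξ - P n| ≤ 1 := by
      have := abs_nonneg ((Q n : ℝ) * ξ - P n)
      nlinarith
    have h6 := abs_sub_abs_le_abs_sub ((Q n : ℝ) * ξ) (P n)
    rw [abs_mul, abs_of_pos (by linarith : (0 : ℝ) < Q n)] at h6
    have h7 : |ξ| * n ≤ Q n * |ξ| := by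
      rw [mul_comm]; gcongr
    linarith
  have hξ : 0 < |ξ| := abs_pos.2 h.ne_zero
  have ht : Tendsto (fun n => (P n, Q n)) atTop (cofinite ×ˢ cofinite) := by
    refine Tendsto.prodMk (tendsto_cofinite_int fun M => ?_) (tendsto_cofinite_int fun M => ?_)
    · have h1 : Tendsto (fun n : ℕ => |ξ| * n - 1) atTop atTop :=
        tendsto_atTop_add_const_right _ _ (tendsto_natCast_atTop_atTop.const_mul_atTop hξ)
      filter_upwards [h1.eventually_gt_atTop M] with n hn
      exact hn.trans_le (hP n)
    · filter_upwards [(tendsto_natCast_atTop_atTop (R := ℝ)).eventually_gt_atTop M] with n hn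
      exact hn.trans_le ((hQ n).1.trans (le_abs_self _))
  filter_upwards [ht.eventually hev] with n hn
  change _ < _ at hn
  rw [hval, one_div_one_div] at hn
  exact (ENNReal.ofReal_lt_ofReal_iff hc).1 hn

/-- Vectors that are good at the index `n` and have a small value form a finite set. -/
lemma finite_good {ξ : ℝ} (h : Irrational ξ) (n : ℕ) :
    {v : ℤ × ℤ | 0 < v.1 ∧ 0 ≤ (coord (pquot ξ) n v).1 ∧ 0 < (coord (pquot ξ) n v).2 ∧
      (coord (pquot ξ) n v).1 ≤ pquot ξ n * (coord (pquot ξ) n v).2 ∧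
      |redForm (quot ξ 1) 0 v.1 v.2| < 1}.Finite := by
  set a := pquot ξ
  set α := quot ξ (n + 1) with hα
  set β := backFrac a n with hβ
  have hch := chain_quot h
  have hα1 : 1 < α := one_lt_quot_succ h n
  have hβ0 : 0 ≤ β := backFrac_nonneg _ _
  have ha : 0 < α - a n := by
    have h1 := (isCF_quot h n).2
    have h2 := one_lt_quot_succ h (n + 1)
    have : 0 < 1 / quot ξ (n + 1 + 1) := by positivity
    simp only at h1
    linarith
  obtain ⟨M, hM⟩ : ∃ M : ℕ, (α + β) / (α - a n) ≤ M ∧ (α + β) / ((α - a n) * β) ≤ M := by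
    obtain ⟨M, hM⟩ := exists_nat_ge (max ((α + β) / (α - a n)) ((α + β) / ((α - a n) * β)))
    exact ⟨M, (le_max_left _ _).trans hM, (le_max_right _ _).trans hM⟩
  refine Set.Finite.subset (Set.Finite.preimage ((coord_injective a n).injOn)
    ((Set.finite_Icc (0 : ℤ) (a n * M)).prod (Set.finite_Icc (0 : ℤ) M))) ?_
  rintro v ⟨h1, h2, h3, h4, h5⟩
  have h6 := hch.abs_redForm n v
  have h7 : |redForm α β (coord a n v).1 (coord a n v).2| < 1 := by
    rw [h6]; exact h5
  generalize hc : coord a n v = c at *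
  obtain ⟨X, Y⟩ := c
  simp only at h2 h3 h4 h7
  have hX : (0 : ℝ) ≤ X := by exact_mod_cast h2
  have hY : (1 : ℝ) ≤ Y := by exact_mod_cast h3
  have hXY : (X : ℝ) ≤ a n * Y := by exact_mod_cast h4
  have h8 : (α * Y - X) * (X + β * Y) < α + β := by
    have h9 : redForm α β X Y = -((α * Y - X) * (X + β * Y) / (α + β)) := by
      rw [redForm]; ring
    rw [h9, abs_neg, abs_lt] at h7
    have := h7.2
    rwa [div_lt_one (by linarith)] at this
  have h9 : (α - a n) * Y ≤ α * Y - X := by linarith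
  have hYM : (Y : ℝ) ≤ M := by
    -- At index 0 the backward fraction is 0 and gives no control of `Y`. There the first coordinate
    -- is `v.1`, and its positivity is used instead.
    rcases n with _ | n
    · have hX1 : (1 : ℝ) ≤ X := by
        have : v = (X, Y) := hc
        rw [this] at h1
        exact_mod_cast h1
      refine le_trans ?_ hM.1
      rw [le_div_iff₀ ha]
      nlinarith [mul_nonneg hβ0 (by linarith : (0 : ℝ) ≤ Y), mul_pos ha (by linarith : (0 : ℝ) < Y)]
    · have hβ1 : 0 < β := backFrac_succ_pos (one_le_pquot h) n
      refine le_trans ?_ hM.2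
      rw [le_div_iff₀ (mul_pos ha hβ1)]
      have h10 : β ≤ X + β * Y := by nlinarith
      have h11 : (α - a (n + 1)) * Y * β ≤ (α * Y - X) * (X + β * Y) :=
        mul_le_mul h9 h10 hβ1.le (by nlinarith)
      linarith
  have hYM' : Y ≤ M := by exact_mod_cast hYM
  rw [Set.mem_preimage, hc]
  exact ⟨⟨h2, h4.trans (by gcongr)⟩, h3.le, hYM'⟩

/-- Vectors beyond the line `x = α y` are handled after one step, which moves them into the range of
`Chain.bound`. -/
lemma exists_good {ξ : ℝ} (h : Irrational ξ) {x y : ℤ} (hx : 0 < x) (hy : 0 ≤ y) :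
    ∃ n, 0 ≤ (coord (pquot ξ) n (x, y)).1 ∧ 0 < (coord (pquot ξ) n (x, y)).2 ∧
      (coord (pquot ξ) n (x, y)).1 ≤ pquot ξ n * (coord (pquot ξ) n (x, y)).2 ∧
      (((coord (pquot ξ) n (x, y)).2 : ℝ) ^ 2 * (quot ξ (n + 1) * backFrac (pquot ξ) n /
          (quot ξ (n + 1) + backFrac (pquot ξ) n)) ≤ |redForm (quot ξ 1) 0 x y| ∨
        ((coord (pquot ξ) n (x, y)).2 : ℝ) ^ 2 * (1 / lamOne ξ (n + 1)) ≤
          |redForm (quot ξ 1) 0 x y|) := by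
  have hch := chain_quot h
  rcases le_or_gt (x : ℝ) (quot ξ 1 * y) with hle | hgt
  · have hy' : 0 < y := by
      rcases hy.eq_or_lt with rfl | hlt
      · simp at hle; omega
      · exact hlt
    exact hch.bound (x, y) hx.le hy' hle
  · have h1 := (isCF_quot h 0).2
    have h2 := one_lt_quot_succ h 1
    simp only [zero_add] at h1
    have hyr : (0 : ℝ) ≤ y := by exact_mod_cast hy
    have h3 : 1 / quot ξ (1 + 1) * y < ((x - pquot ξ 0 * y : ℤ) : ℝ) := by
      push_cast; rw [h1] at hgt; linarith
    have h4 : 0 < x - pquot ξ 0 * y := by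
      have : (0 : ℝ) ≤ 1 / quot ξ (1 + 1) * y := by positivity
      exact_mod_cast this.trans_lt h3
    obtain ⟨n, hn1, hn2, hn3, hn4⟩ := hch.tail.bound (y, x - pquot ξ 0 * y) hy h4 (by
      calc (y : ℝ) = quot ξ (1 + 1) * (1 / quot ξ (1 + 1) * y) := by field_simp
        _ ≤ _ := by simp only; gcongr)
    have h5 := hch.abs_redForm 1 (x, y)
    refine ⟨n + 1, hn1, hn2, hn3, ?_⟩
    simp only [coord] at h5
    have h6 : |redForm (quot ξ (0 + 1 + 1)) (backFrac (pquot ξ) (0 + 1)) (y : ℝ)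
        ((x - pquot ξ 0 * y : ℤ) : ℝ)| = |redForm (quot ξ 1) 0 x y| := h5
    rw [h6] at hn4
    exact hn4

lemma finite_compl_mem_prod_cofinite {s : Set (ℤ × ℤ)} (hs : s.Finite) :
    ∀ᶠ v in (cofinite ×ˢ cofinite : Filter (ℤ × ℤ)), v ∉ s := by
  have hle : (cofinite ×ˢ cofinite : Filter (ℤ × ℤ)) ≤ cofinite := by
    rw [le_cofinite_iff_eventually_ne]
    intro x
    have : ∀ᶠ p in (cofinite : Filter ℤ), p ≠ x.1 := le_cofinite_iff_eventually_ne.1 le_rfl _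
    filter_upwards [this.prod_inl cofinite] with v hv hvx
    exact hv (congrArg Prod.fst hvx)
  exact hle hs.eventually_cofinite_notMem

/-- A vector with a small value comes from some index. Each index accounts for finitely many
vectors, so those with index at most `N`, of either sign, can be discarded. The rest have larger
index, and their value is bounded below by `1 / λ` at a neighbouring place. -/
lemma exists_lt_lamOne {ξ : ℝ} (h : Irrational ξ) {c : ℝ} (hc : 1 < c)
    (hlt : ENNReal.ofReal c < lagrangeValue ξ) (N : ℕ) : ∃ n ≥ N, c < lamOne ξ n := by
  have hfr := frequently_lt_of_lt_limsup (by isBoundedDefault) hlt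
  set G : Set (ℤ × ℤ) := ⋃ n ∈ Finset.range (N + 1),
    {v : ℤ × ℤ | 0 < v.1 ∧ 0 ≤ (coord (pquot ξ) n v).1 ∧ 0 < (coord (pquot ξ) n v).2 ∧
      (coord (pquot ξ) n v).1 ≤ pquot ξ n * (coord (pquot ξ) n v).2 ∧
      |redForm (quot ξ 1) 0 v.1 v.2| < 1} with hG
  have hGf : G.Finite := (Finset.range (N + 1)).finite_toSet.biUnion fun n _ => finite_good h n
  have hinj1 : Function.Injective fun v : ℤ × ℤ => (v.2, v.1 - ⌊ξ⌋ * v.2) := fun v w hvw => by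
    simp only [Prod.mk.injEq] at hvw
    obtain ⟨h1, h2⟩ := hvw
    rw [h1] at h2
    exact Prod.ext (by linarith) h1
  have hinj2 : Function.Injective fun v : ℤ × ℤ => (-v.2, -(v.1 - ⌊ξ⌋ * v.2)) := fun v w hvw => by
    simp only [Prod.mk.injEq, neg_inj] at hvw
    obtain ⟨h1, h2⟩ := hvw
    rw [h1] at h2
    exact Prod.ext (by linarith) h1
  have hev := (finite_compl_mem_prod_cofinite (hGf.preimage hinj1.injOn)).and
    (finite_compl_mem_prod_cofinite (hGf.preimage hinj2.injOn))
  obtain ⟨⟨p, q⟩, h1, h2, h3⟩ := (hfr.and_eventually hev).exists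
  simp only [Set.mem_preimage] at h1 h2 h3
  rw [ENNReal.ofReal_lt_ofReal_iff_of_nonneg (by linarith), mul_sub_eq_redForm h] at h1
  obtain ⟨x, y, hx, hxy, hval⟩ : ∃ x y : ℤ, 0 < x ∧ (x, y) ∉ G ∧
      c < 1 / |redForm (quot ξ 1) 0 x y| := by
    rcases lt_trichotomy q 0 with hq | rfl | hq
    · refine ⟨-q, -(p - ⌊ξ⌋ * q), by omega, h3, ?_⟩
      push_cast at h1 ⊢
      rwa [redForm_neg]
    -- Here `q = 0`, the denominator vanishes and `1 / 0 = 0` is not above `c`.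
    · exfalso
      simp [redForm] at h1
      linarith
    · exact ⟨q, p - ⌊ξ⌋ * q, hq, h2, h1⟩
  set F := |redForm (quot ξ 1) 0 x y| with hF
  have hF0 : 0 < F := by
    rcases (abs_nonneg (redForm (quot ξ 1) 0 x y)).eq_or_lt with h0 | h0
    · rw [hF, ← h0] at hval; simp at hval; linarith
    · exact h0
  have hF1 : F < 1 / c := by
    rw [lt_div_iff₀ (by linarith)]
    rw [lt_div_iff₀ hF0] at hval
    linarith
  have hF2 : F < 1 := hF1.trans ((div_lt_one (by linarith)).2 hc)
  have hα := one_lt_quot_succ h 0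
  rw [zero_add] at hα
  have hxr : (1 : ℝ) ≤ x := by exact_mod_cast hx
  have hy : 0 ≤ y := by
    by_contra! hneg
    have hyr : (y : ℝ) ≤ -1 := by exact_mod_cast (by omega : y ≤ -1)
    have h4 : (1 : ℝ) ≤ redForm (quot ξ 1) 0 x y := by
      rw [redForm, le_div_iff₀ (by linarith)]
      have : quot ξ 1 ≤ x - quot ξ 1 * y := by nlinarith
      nlinarith
    have := le_abs_self (redForm (quot ξ 1) 0 x y)
    linarith
  obtain ⟨n, hn1, hn2, hn3, hn4⟩ := exists_good h hx hy
  have hnN : N < n := by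
    by_contra! hle
    refine hxy ?_
    rw [hG, Set.mem_iUnion₂]
    exact ⟨n, Finset.mem_range.2 (by omega), hx, hn1, hn2, hn3, hF2⟩
  have hY : (1 : ℝ) ≤ ((coord (pquot ξ) n (x, y)).2 : ℝ) ^ 2 := by
    have : (1 : ℝ) ≤ ((coord (pquot ξ) n (x, y)).2 : ℝ) := by exact_mod_cast hn2
    nlinarith
  have fin : ∀ m, 1 / lamOne ξ m ≤ F → c < lamOne ξ m := fun m hm => by
    have := one_lt_lamOne h m
    exact lt_of_one_div_lt_one_div (by linarith) (hm.trans_lt hF1)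
  obtain ⟨n, rfl⟩ : ∃ k, n = k + 1 := ⟨n - 1, by omega⟩
  rcases hn4 with hn4 | hn4
  · refine ⟨n, by omega, fin n (le_trans ?_ hn4)⟩
    have hl := one_lt_lamOne h n
    have hβ := backFrac_succ_pos (one_le_pquot h) n
    have hα' := one_lt_quot_succ h (n + 1)
    have e1 : lamOne ξ n = 1 / quot ξ (n + 1 + 1) + 1 / backFrac (pquot ξ) (n + 1) := by
      have h5 := (isCF_quot h n).2
      simp only at h5
      rw [lamOne, h5, backFrac, one_div_one_div]
      ring
    have e2 : 1 / lamOne ξ n = quot ξ (n + 1 + 1) * backFrac (pquot ξ) (n + 1) /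
        (quot ξ (n + 1 + 1) + backFrac (pquot ξ) (n + 1)) := by
      rw [e1]; field_simp; ring
    rw [e2]
    exact le_mul_of_one_le_left (by positivity) hY
  · refine ⟨n + 1 + 1, by omega, fin _ (le_trans ?_ hn4)⟩
    have hl := one_lt_lamOne h (n + 1 + 1)
    exact le_mul_of_one_le_left (by positivity) hY

/-! ### Extension to a bi-infinite sequence -/

lemma alphaS_eq_quot {ξ : ℝ} (h : Irrational ξ) {E : ℤ → ℕ} {N : ℕ}
    (hE : ∀ n : ℕ, N ≤ n → E n = pquot ξ n) {n : ℕ} (hn : N ≤ n) :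
    alphaS E n = quot ξ (n + 1) := by
  rw [← cfValue_pquot h, alphaS]
  congr 1
  funext i
  rw [rightSeq, ← hE _ (by omega)]
  congr 1; push_cast; ring

/-- The choice of letters before `N` is forgotten at the rate of two steps per factor 4, so the
limit superior does not depend on the extension to the left. -/
lemma abs_betaS_sub_le {ξ : ℝ} (h : Irrational ξ) {E : ℤ → ℕ} (hpos : ∀ i, 1 ≤ E i) {N : ℕ}
    (hE : ∀ n : ℕ, N ≤ n → E n = pquot ξ n) (m : ℕ) :
    |betaS E (N + 2 * m : ℕ) - backFrac (pquot ξ) (N + 2 * m)| ≤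
      (1 / 4) ^ m * |betaS E N - backFrac (pquot ξ) N| := by
  induction m with
  | zero => simp
  | succ m ih =>
    set n := N + 2 * m with hn
    have e1 : betaS E ((n + 1 : ℕ) : ℤ) = 1 / (pquot ξ n + betaS E n) := by
      rw [← hE n (by omega)]; push_cast; exact betaS_eq hpos n
    have e2 : betaS E ((n + 2 : ℕ) : ℤ) = 1 / (pquot ξ (n + 1) + betaS E (n + 1 : ℕ)) := by
      rw [← hE (n + 1) (by omega)]
      have := betaS_eq hpos (n + 1 : ℕ)
      rw [← this]; congr 1
    have e3 : backFrac (pquot ξ) (n + 2) =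
        1 / (pquot ξ (n + 1) + 1 / (pquot ξ n + backFrac (pquot ξ) n)) := rfl
    rw [show N + 2 * (m + 1) = n + 2 by omega, e2, e1, e3]
    have ha : (1 : ℝ) ≤ pquot ξ n := by exact_mod_cast one_le_pquot h n
    have hb := betaS_pos hpos n
    have hb' := backFrac_nonneg (pquot ξ) n
    have := abs_two_step_le (p := 0) (q := pquot ξ (n + 1)) (s := pquot ξ n + betaS E n)
      (t := pquot ξ n + backFrac (pquot ξ) n) (by exact_mod_cast one_le_pquot h _)
      (by linarith) (by linarith)
    simp only [zero_add] at this
    refine this.trans ?_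
    rw [pow_succ, add_sub_add_left_eq_sub]
    linarith

lemma betaS_lt_one {E : ℤ → ℕ} (hpos : ∀ i, 1 ≤ E i) (i : ℤ) : betaS E i < 1 := by
  have := one_lt_cfValue (a := leftSeq E (i - 1)) fun _ => hpos _
  rw [betaS, div_lt_one (by linarith)]
  exact this

lemma abs_betaS_sub_backFrac_le {ξ : ℝ} (h : Irrational ξ) {E : ℤ → ℕ} (hpos : ∀ i, 1 ≤ E i)
    {N : ℕ} (hE : ∀ n : ℕ, N ≤ n → E n = pquot ξ n) (m n : ℕ) (hn : N + 2 * m ≤ n) :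
    |lam E n - lamOne ξ n| ≤ (1 / 4) ^ m := by
  have h1 := abs_betaS_sub_le h hpos (N := n - 2 * m) (fun k hk => hE k (by omega)) m
  rw [Nat.sub_add_cancel (by omega)] at h1
  rw [lam_eq_add, lamOne, alphaS_eq_quot h hE (by omega), add_sub_add_left_eq_sub]
  refine h1.trans (mul_le_of_le_one_right (by positivity) ?_)
  have h2 := betaS_pos hpos (n - 2 * m : ℕ)
  have h3 := betaS_lt_one hpos (n - 2 * m : ℕ)
  have h4 := backFrac_nonneg (pquot ξ) (n - 2 * m)
  have h5 : backFrac (pquot ξ) (n - 2 * m) ≤ 1 := by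
    rcases n - 2 * m with _ | k
    · simp [backFrac]
    · have h0 : (1 : ℝ) ≤ pquot ξ k := by exact_mod_cast one_le_pquot h k
      have := backFrac_nonneg (pquot ξ) k
      rw [backFrac, div_le_one (by linarith)]; linarith
  rw [abs_le]; constructor <;> linarith

/-- Every element of the Lagrange spectrum below `J` is the limit superior of `λₙ(E)` for a
ternary sequence `E`. -/
theorem exists_ternary_limsup {x : ℝ} (hx : x ∈ lagrangeSpectrum) (h0 : j0 < x) (hJ : x < jL) :
    ∃ E : ℤ → ℕ, Ternary E ∧ (∀ c > x, ∀ᶠ n : ℕ in atTop, lam E n < c) ∧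
      ∀ c < x, ∀ N : ℕ, ∃ n ≥ N, c < lam E (n : ℕ) := by
  obtain ⟨ξ, hξ, hfin, rfl⟩ := hx
  set x := (lagrangeValue ξ).toReal
  have h0' : 3 < j0 := by
    refine lt_of_lt_of_le ?_ le_j0
    rw [lt_div_iff₀ (by exact_mod_cast scale_pos)]
    exact_mod_cast (by decide : 3 * scale < num0)
  have h4 : jL < 4 := by
    refine jL_le.trans_lt ?_
    rw [div_lt_iff₀ (by exact_mod_cast scale_pos)]
    exact_mod_cast (by decide : numJ < 4 * scale)
  have hU : ∀ c > x, ∀ᶠ n in atTop, lamOne ξ n < c := fun c hc =>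
    eventually_lamOne_lt hξ (by linarith) ((ENNReal.lt_ofReal_iff_toReal_lt hfin).2 hc)
  have hL : ∀ c < x, 1 < c → ∀ N, ∃ n ≥ N, c < lamOne ξ n := fun c hc h1 =>
    exists_lt_lamOne hξ h1 ((ENNReal.ofReal_lt_iff_lt_toReal (by linarith) hfin).2 hc)
  obtain ⟨N, hN⟩ := eventually_atTop.1 (hU 4 (by linarith))
  have hle3 : ∀ n ≥ N, pquot ξ n ≤ 3 := fun n hn => by
    have h1 := hN n hn
    have h2 := (isCF_quot hξ n).2
    have h3 := one_lt_quot_succ hξ (n + 1)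
    have h5 := backFrac_nonneg (pquot ξ) n
    have h6 : 0 < 1 / quot ξ (n + 1 + 1) := by positivity
    simp only at h2
    rw [lamOne] at h1
    have h7 : (pquot ξ n : ℝ) < 4 := by linarith
    have h8 : pquot ξ n < 4 := by exact_mod_cast h7
    omega
  set E : ℤ → ℕ := fun i => if (N : ℤ) ≤ i then pquot ξ i.toNat else 1 with hEdef
  have hE : ∀ n : ℕ, N ≤ n → E n = pquot ξ n := fun n hn => by
    simp only [hEdef]; rw [if_pos (by exact_mod_cast hn)]; simp
  have hT : Ternary E := fun i => by
    simp only [hEdef]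
    split_ifs with hi
    · have h1 := one_le_pquot hξ i.toNat
      have h2 := hle3 i.toNat (by omega)
      omega
    · exact Or.inl rfl
  have hclose := fun m n hn => abs_betaS_sub_backFrac_le hξ hT.pos hE m n hn
  refine ⟨E, hT, fun c hc => ?_, fun c hc M => ?_⟩
  · obtain ⟨m, hm⟩ := exists_pow_lt_of_lt_one (show 0 < (c - x) / 2 by linarith)
      (by norm_num : (1 / 4 : ℝ) < 1)
    filter_upwards [hU ((c + x) / 2) (by linarith), eventually_ge_atTop (N + 2 * m)] with n h1 h2
    have := (abs_le.1 (hclose m n h2)).2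
    linarith
  · set c' := max c 2
    have hc' : c' < x := max_lt hc (by linarith)
    obtain ⟨m, hm⟩ := exists_pow_lt_of_lt_one (show 0 < (x - c') / 2 by linarith)
      (by norm_num : (1 / 4 : ℝ) < 1)
    obtain ⟨n, hn1, hn2⟩ := hL ((c' + x) / 2) (by linarith)
      (by have := le_max_right c 2; linarith) (max M (N + 2 * m))
    refine ⟨n, (le_max_left _ _).trans hn1, ?_⟩
    have := (abs_le.1 (hclose m n ((le_max_right _ _).trans hn1))).1
    have := le_max_left c 2
    linarith

/-! ### Continuity and compactness -/

lemma eventually_apply_eq {ι : Type*} (a : ι → ℕ) (i : ι) : ∀ᶠ b in 𝓝 a, b i = a i := by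
  have h : IsOpen ((fun b : ι → ℕ => b i) ⁻¹' {a i}) :=
    (isOpen_discrete {a i}).preimage (continuous_apply i)
  exact h.mem_nhds (Set.mem_singleton _)

lemma continuousOn_cfValue : ContinuousOn cfValue {a | ∀ n, 1 ≤ a n} := by
  intro a ha
  rw [ContinuousWithinAt, Metric.tendsto_nhds]
  intro ε hε
  obtain ⟨N, hN⟩ := exists_pow_lt_of_lt_one hε (by norm_num : (1 / 4 : ℝ) < 1)
  have h1 : ∀ᶠ b in 𝓝 a, ∀ i ∈ Finset.range (2 * N + 1), b i = a i :=
    (Finset.eventually_all _).2 fun i _ => eventually_apply_eq a i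
  filter_upwards [nhdsWithin_le_nhds h1, self_mem_nhdsWithin] with b hb hb'
  exact (abs_cfValue_sub_le hb' ha N fun i hi => hb i (Finset.mem_range.2 hi)).trans_lt hN

lemma continuousOn_lam (i : ℤ) : ContinuousOn (fun S => lam S i) {S | ∀ i, 1 ≤ S i} := by
  have h1 : Continuous fun S : ℤ → ℕ => rightSeq S i := continuous_pi fun n => continuous_apply _
  have h2 : Continuous fun S : ℤ → ℕ => leftSeq S (i - 1) :=
    continuous_pi fun n => continuous_apply _
  have h3 : ContinuousOn (fun S => cfValue (rightSeq S i)) {S | ∀ i, 1 ≤ S i} :=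
    continuousOn_cfValue.comp h1.continuousOn fun S (hS : ∀ i, 1 ≤ S i) n => hS _
  have h4 : ContinuousOn (fun S => cfValue (leftSeq S (i - 1))) {S | ∀ i, 1 ≤ S i} :=
    continuousOn_cfValue.comp h2.continuousOn fun S (hS : ∀ i, 1 ≤ S i) n => hS _
  refine h3.add (continuousOn_const.div h4 fun S (hS : ∀ i, 1 ≤ S i) => ?_)
  have := one_lt_cfValue (a := leftSeq S (i - 1)) fun _ => hS _
  linarith

lemma isCompact_ternary : IsCompact {S : ℤ → ℕ | Ternary S} := by
  have : {S : ℤ → ℕ | Ternary S} = Set.pi univ fun _ => ({1, 2, 3} : Set ℕ) := by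
    ext S
    simp only [Set.mem_ofPred_eq, Set.mem_univ_pi, mem_123]
    rfl
  rw [this]
  exact isCompact_univ_pi fun _ => (Set.toFinite _).isCompact

lemma eventually_at_iff (S : ℤ → ℕ) (k : ℤ) (w : List ℕ) :
    ∀ᶠ T in 𝓝 S, (At T k w ↔ At S k w) := by
  induction w generalizing k with
  | nil => simp [At]
  | cons a w ih =>
    filter_upwards [ih (k + 1), eventually_apply_eq S k] with T h1 h2
    simp only [At, h1, h2]

/-! ### The gap of the Lagrange spectrum -/

section
variable {E : ℤ → ℕ} {x : ℝ}

/-- Limits of the shifts of a sequence with `limsup λₙ < J`. -/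
lemma exists_below_limit (hE : Ternary E) (hup : ∀ c > x, ∀ᶠ n : ℕ in atTop, lam E n < c)
    (hx : x < jL) {p : ℕ → Prop} (hp : ∃ᶠ n in atTop, p n) :
    ∃ (U : Ultrafilter ℕ) (S : ℤ → ℕ), (U : Filter ℕ) ≤ atTop ∧ (∀ᶠ n in U, p n) ∧ Below S ∧
      (∀ k w, ∀ᶠ n : ℕ in U, (At E (k + n) w ↔ At S k w)) ∧
      ∀ i, Tendsto (fun n : ℕ => lam E (i + n)) U (𝓝 (lam S i)) := by
  have : (atTop ⊓ 𝓟 {n | p n}).NeBot := by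
    rw [← frequently_mem_iff_neBot]; exact hp
  set U := Ultrafilter.of (atTop ⊓ 𝓟 {n | p n})
  have hU : (U : Filter ℕ) ≤ atTop ⊓ 𝓟 {n | p n} := Ultrafilter.of_le _
  obtain ⟨S, hS, hlim⟩ := isCompact_ternary.ultrafilter_le_nhds
    (U.map fun n i => E (i + n)) (by
      rw [Ultrafilter.coe_map, le_principal_iff, mem_map]
      exact univ_mem' fun n i => hE (i + n))
  have hlim' : Tendsto (fun (n : ℕ) i => E (i + n)) U (𝓝 S) := hlim
  have hlam : ∀ i, Tendsto (fun n : ℕ => lam E (i + n)) U (𝓝 (lam S i)) := fun i => by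
    have h1 := continuousOn_lam i S hS.pos
    have h2 := h1.tendsto.comp (tendsto_nhdsWithin_iff.2
      ⟨hlim', Eventually.of_forall fun n j => hE.pos _⟩)
    refine h2.congr fun n => ?_
    exact lam_shift E n i
  refine ⟨U, S, hU.trans inf_le_left, hU.trans inf_le_right (mem_principal_self _), ⟨hS, ?_⟩, ?_,
    hlam⟩
  · intro i
    refine lt_of_le_of_lt (le_of_forall_gt_imp_ge_of_dense fun c hc => ?_) hx
    refine le_of_tendsto (hlam i) ((hU.trans inf_le_left) ?_)
    obtain ⟨N, hN⟩ := eventually_atTop.1 (hup c hc)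
    filter_upwards [eventually_ge_atTop (N + i.natAbs)] with n hn
    have := hN (i + n).toNat (by omega)
    rw [Int.toNat_of_nonneg (by omega)] at this
    exact this.le
  · intro k w
    filter_upwards [hlim'.eventually (eventually_at_iff S k w)] with n hn
    rw [← hn]
    exact (at_shift E n k w).symm

/-- If replication failed infinitely often, the shifts at the failures would have a limit with all
`λᵢ < J` in which it fails at 0. -/
lemma eventually_selfRep_sub (hE : Ternary E) (hup : ∀ c > x, ∀ᶠ n : ℕ in atTop, lam E n < c)
    (hx : x < jL) : ∃ N : ℕ, ∀ n : ℤ, N ≤ n → At E n selfRep → At E (n - 9) selfRep := by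
  by_contra! hcon
  have hp : ∃ᶠ n : ℕ in atTop, At E n selfRep ∧ ¬ At E (n - 9) selfRep := by
    rw [frequently_atTop]
    intro N
    obtain ⟨n, h1, h2⟩ := hcon N
    lift n to ℕ using by omega
    exact ⟨n, by omega, h2⟩
  obtain ⟨U, S, -, hpU, hB, hat, -⟩ := exists_below_limit hE hup hx hp
  obtain ⟨n, ⟨h1, h2⟩, h3, h4⟩ := (hpU.and ((hat 0 selfRep).and (hat (-9) selfRep))).exists
  rw [zero_add] at h3
  rw [neg_add_eq_sub] at h4
  exact h2 (h4.2 (hB.selfRep_sub (h3.1 h1)))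

lemma eventually_selfRep_reverse_add (hE : Ternary E)
    (hup : ∀ c > x, ∀ᶠ n : ℕ in atTop, lam E n < c) (hx : x < jL) :
    ∃ N : ℕ, ∀ n : ℤ, N ≤ n → At E n selfRep.reverse → At E (n + 9) selfRep.reverse := by
  by_contra! hcon
  have hp : ∃ᶠ n : ℕ in atTop, At E n selfRep.reverse ∧ ¬ At E (n + 9) selfRep.reverse := by
    rw [frequently_atTop]
    intro N
    obtain ⟨n, h1, h2⟩ := hcon N
    lift n to ℕ using by omega
    exact ⟨n, by omega, h2⟩
  obtain ⟨U, S, -, hpU, hB, hat, -⟩ := exists_below_limit hE hup hx hp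
  obtain ⟨n, ⟨h1, h2⟩, h3, h4⟩ :=
    (hpU.and ((hat 0 selfRep.reverse).and (hat 9 selfRep.reverse))).exists
  rw [zero_add] at h3
  rw [add_comm] at h4
  refine h2 (h4.2 ?_)
  have h5 := hB.reversed.selfRep_sub (at_rev_selfRep (h3.1 h1))
  have h6 := at_rev_selfRep_reverse h5
  rw [rev_rev] at h6
  convert h6 using 1
  norm_num

/-- The letters 4 to 13 are a block followed by a 2. Copies nine places apart therefore cover every
pair of neighbouring letters. -/
lemma selfRep_no22 : ∀ d < 9,
    ¬ (selfRep.getD (d + 4) 0 = 2 ∧ selfRep.getD (d + 5) 0 = 2) := by decide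

lemma selfRep_reverse_no22 : ∀ d < 9,
    ¬ (selfRep.reverse.getD (d + 3) 0 = 2 ∧ selfRep.reverse.getD (d + 4) 0 = 2) := by decide

theorem lagrangeSpectrum_gap : lagrangeSpectrum ∩ Ioo j0 jL = ∅ := by
  rw [Set.eq_empty_iff_forall_notMem]
  rintro x ⟨hx, h0, hJ⟩
  obtain ⟨E, hE, hup, hlow⟩ := exists_ternary_limsup hx h0 hJ
  obtain ⟨c, hc1, hc2⟩ := exists_between h0
  have hp : ∃ᶠ n : ℕ in atTop, c < lam E n := by
    rw [frequently_atTop]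
    intro N
    obtain ⟨n, h1, h2⟩ := hlow c hc2 N
    exact ⟨n, h1, h2⟩
  obtain ⟨U, S, hU, hpU, hB, hat, hlam⟩ := exists_below_limit hE hup hJ hp
  have hS0 : j0 < lam S 0 := by
    refine hc1.trans_le (ge_of_tendsto (hlam 0) ?_)
    filter_upwards [hpU] with n hn
    rw [zero_add]; exact hn.le
  have hge : ∀ m : ℕ, ∀ᶠ n in (U : Filter ℕ), m ≤ n := fun m => hU (eventually_ge_atTop m)
  rcases selfRep_of_lt_lam hB.1 hB.avoids hS0 with h | h
  -- The limit `S` reappears in `E` arbitrarily far out. A `22` is chosen at `m` beyond `N`, then a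
  -- copy of the word at `k` beyond `m`. Going back from `k` by steps of nine, copies reach `m`.
  · obtain ⟨q, hq⟩ := hB.str_of_selfRep h hS0
    obtain ⟨N, hN⟩ := eventually_selfRep_sub hE hup hJ
    have h22 : At S (q + 2) [2, 2] := by
      have := hq.two_two
      rw [show q + 3 = q + 2 + 1 by ring] at this
      exact ⟨this.1, this.2, trivial⟩
    obtain ⟨n₀, h1, h2⟩ := ((hge (N + 12 + q.natAbs)).and (hat (q + 2) [2, 2])).exists
    have h3 := h2.2 h22
    generalize hm : q + 2 + (n₀ : ℤ) = m at h3
    have hmN : N + 12 ≤ m := by omega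
    obtain ⟨n₁, h4, h5⟩ := ((hge (m.natAbs + 8)).and (hat (0 - 8) selfRep)).exists
    have h6 := h5.2 h
    generalize hk : (0 - 8 + n₁ : ℤ) = k at h6
    have hdesc : ∀ j : ℕ, N ≤ k - 9 * j → At E (k - 9 * j) selfRep := by
      intro j
      induction j with
      | zero => intro _; simpa using h6
      | succ j ih =>
        intro hj
        have := hN _ (by push_cast at hj; linarith) (ih (by push_cast at hj; linarith))
        push_cast
        convert this using 1; ring
    have hd := hdesc ((k - m + 12) / 9).toNat (by omega)
    rw [at_iff_getD, length_selfRep] at hd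
    obtain ⟨d, hd9, hdm⟩ : ∃ d : ℕ, d < 9 ∧
        m = k - 9 * ((k - m + 12) / 9).toNat + ((d + 4 : ℕ) : ℤ) :=
      ⟨(m - (k - 9 * ((k - m + 12) / 9).toNat) - 4).toNat, by omega, by omega⟩
    refine selfRep_no22 d hd9 ⟨?_, ?_⟩
    · rw [← hd _ (by omega), ← hdm]; exact h3.1
    · rw [← hd _ (by omega), ← h3.2.1]
      congr 1
      push_cast at hdm ⊢
      linarith
  -- In the mirrored case the transposed word replicates to the right, so the copy at `k` is chosen
  -- first and the `22` beyond it.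
  · obtain ⟨q, hq⟩ := hB.reversed.str_of_selfRep (at_rev_selfRep h) (i := 0) (by
      rw [lam_rev hB.1.pos]; simpa using hS0)
    obtain ⟨N, hN⟩ := eventually_selfRep_reverse_add hE hup hJ
    have h22 : At S (-(q + 3)) [2, 2] := by
      have := hq.two_two
      simp only [rev] at this
      refine ⟨this.2, ?_, trivial⟩
      rw [← this.1]; congr 1; ring
    obtain ⟨n₁, h4, h5⟩ := ((hge (N + 8)).and (hat (0 - 8) selfRep.reverse)).exists
    have h6 := h5.2 h
    generalize hk : (0 - 8 + n₁ : ℤ) = k at h6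
    obtain ⟨n₀, h1, h2⟩ := ((hge (k.natAbs + 12 + q.natAbs)).and (hat (-(q + 3)) [2, 2])).exists
    have h3 := h2.2 h22
    generalize hm : -(q + 3) + (n₀ : ℤ) = m at h3
    have hasc : ∀ j : ℕ, At E (k + 9 * j) selfRep.reverse := by
      intro j
      induction j with
      | zero => simpa using h6
      | succ j ih =>
        have := hN _ (by omega) ih
        push_cast
        convert this using 1; ring
    have hd := hasc ((m - k - 3) / 9).toNat
    rw [at_iff_getD, length_selfRep_reverse] at hd
    obtain ⟨d, hd9, hdm⟩ : ∃ d : ℕ, d < 9 ∧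
        m = k + 9 * ((m - k - 3) / 9).toNat + ((d + 3 : ℕ) : ℤ) :=
      ⟨(m - (k + 9 * ((m - k - 3) / 9).toNat) - 3).toNat, by omega, by omega⟩
    refine selfRep_reverse_no22 d hd9 ⟨?_, ?_⟩
    · rw [← hd _ (by omega), ← hdm]; exact h3.1
    · rw [← hd _ (by omega), ← h3.2.1]
      congr 1
      push_cast at hdm ⊢
      linarith

end

/-! ### Extension of admissible words -/

/-- The word `e` followed by a block of letters `2`. -/
def tailWord (e : List ℕ) : List ℕ := e ++ List.replicate 20 2

/-- No forbidden word begins in the word `s` or after it in `s e 2 2 2 …` and ends after `s`. -/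
def extOk (s e : List ℕ) : Bool :=
  forbidden.all fun f => !(infx f (tailWord e)) && (List.range f.length).all fun d =>
    -- Only the suffix `s` of the past is known. A part of `f` reaching further back than `s` can
    -- merely be compatible with it, and this already counts as a possible occurrence.
    !(((f.take d).isSuffixOf s || s.isSuffixOf (f.take d)) && (f.drop d).isPrefixOf (tailWord e))

lemma length_forbidden : ∀ f ∈ forbidden, f ≠ [] ∧ f.length ≤ 17 := by decide

lemma At.isSuffixOf {S : ℤ → ℕ} {m : ℤ} {f w : List ℕ} (hf : At S (m - f.length) f)
    (hw : At S (m - w.length) w) (hl : f.length ≤ w.length) : f.isSuffixOf w = true := by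
  have h1 := hw.drop (w.length - f.length) (Nat.sub_le _ _)
  rw [show m - (w.length : ℤ) + ((w.length - f.length : ℕ) : ℤ) = m - f.length by omega] at h1
  have h2 := hf.isPrefixOf h1 (by rw [List.length_drop]; omega)
  rw [List.isPrefixOf_iff_prefix] at h2
  rw [List.isSuffixOf_iff_suffix, h2.eq_of_length (by rw [List.length_drop]; omega)]
  exact List.drop_suffix _ _

/-- Forbidden words have at most 17 letters, so the twenty letters 2 of `tailWord` show everything
that can happen; an occurrence inside the constant tail may be moved to its beginning. -/
lemma not_at_of_extOk {S : ℤ → ℕ} {m : ℤ} {s e : List ℕ} (hs : At S (m - s.length) s)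
    (he : At S m e) (h2 : ∀ i, m + e.length ≤ i → S i = 2) (hok : extOk s e = true) {f : List ℕ}
    (hf : f ∈ forbidden) {k : ℤ} (hk : m < k + f.length) : ¬ At S k f := by
  intro hat
  obtain ⟨hf0, hf17⟩ := length_forbidden f hf
  have hok := List.all_eq_true.1 hok f hf
  rw [Bool.and_eq_true, List.all_eq_true] at hok
  have hl : (tailWord e).length = e.length + 20 := by simp [tailWord]
  have hu : At S m (tailWord e) := by
    rw [tailWord, at_append]
    refine ⟨he, (at_iff_getD _ _ _).2 fun i hi => ?_⟩
    rw [List.length_replicate] at hi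
    rw [h2 _ (by omega), List.getD_replicate _ hi]
  rcases le_or_gt m k with hmk | hmk
  · obtain ⟨d, hd, hat'⟩ : ∃ d : ℕ, d ≤ e.length ∧ At S (m + d) f := by
      rcases le_or_gt k (m + e.length) with h | h
      · exact ⟨(k - m).toNat, by omega, by rwa [show m + ((k - m).toNat : ℤ) = k by omega]⟩
      · refine ⟨e.length, le_rfl, (at_congr fun i _ => ?_).1 hat⟩
        rw [h2 _ (by omega), h2 _ (by omega)]
    have := infx_of_isPrefixOf_drop hf0 d
      (hat'.isPrefixOf (hu.drop d (by omega)) (by rw [List.length_drop]; omega))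
    rw [this] at hok
    exact absurd hok.1 (by decide)
  · obtain ⟨d, hd⟩ : ∃ d : ℕ, m = k + d := ⟨(m - k).toNat, by omega⟩
    have hdl : d < f.length := by omega
    have h3 := hok.2 d (List.mem_range.2 hdl)
    have h4 : At S (m - (f.take d).length) (f.take d) := by
      rw [List.length_take, min_eq_left hdl.le, hd, add_sub_cancel_right]
      exact hat.take d
    have h5 : (f.drop d).isPrefixOf (tailWord e) = true := by
      have := hat.drop d hdl.le
      rw [← hd] at this
      exact this.isPrefixOf hu (by rw [List.length_drop]; omega)
    rw [h5, Bool.and_true, Bool.not_eq_true', Bool.or_eq_false_iff] at h3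
    rcases le_total (f.take d).length s.length with h | h
    · rw [h4.isSuffixOf hs h] at h3; exact absurd h3.1 (by decide)
    · rw [hs.isSuffixOf h4 h] at h3; exact absurd h3.2 (by decide)

/-- Words that lead from an arbitrary admissible word to an unrestricted choice. -/
def extWords : List (List ℕ) :=
  [[], [1], [1, 1], [1, 1, 1], [2, 1], [1, 2, 1], [2, 1, 1, 1], [3, 2, 1, 1, 1], [3, 2, 1]]

/-- The test of `e` looks only at the letters before the cut. The search first reads two actual
letters after the cut: these rule out dead ends, that is, pasts with no admissible continuation. -/
def extStop (c : ℕ) (w : List ℕ) : Bool :=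
  (forbiddenSym.any fun f => infx f w) || (decide (c ≤ w.length) && extWords.any fun e =>
    extOk (w.take c) e && extOk (w.take c) (e ++ [2, 2, 1]))

lemma ext_search : search extStop ([false, false] ++ List.replicate 12 true) 0 [] = true := by
  decide +kernel

lemma Avoids.exists_ext {S : ℤ → ℕ} (hS : Ternary S) (hA : Avoids S) (m : ℤ) :
    ∃ s, At S (m - s.length) s ∧ ∃ e ∈ extWords, extOk s e = true ∧
      extOk s (e ++ [2, 2, 1]) = true := by
  refine search_spec (p := m) hS (leaf := extStop) ?_ _ 0 [] trivial ext_search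
  intro c w hw hs
  rw [extStop, hA.not_infx hw, Bool.false_or, Bool.and_eq_true, decide_eq_true_iff,
    List.any_eq_true] at hs
  obtain ⟨hc, e, he, hok⟩ := hs
  rw [Bool.and_eq_true] at hok
  refine ⟨w.take c, ?_, e, he, hok⟩
  rw [List.length_take, min_eq_left hc]
  exact hw.take c

lemma tailC_of_not_at {x : ℕ → ℕ} (h1 : ∀ n, x n = 1 ∨ x n = 2 ∨ x n = 3)
    (h2 : ∀ f ∈ forbidden, ∀ k ≥ 14, ¬ At (seqC x) k f) : TailC x := by
  refine ⟨fun n => mem_123.2 (h1 n), fun f hf hocc => ?_⟩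
  have h3 := prepend_rightSeq (str_seqC x).2
  rw [show (14 : ℤ) + (wordP.length : ℤ) = 22 from rfl, rightSeq_seqC] at h3
  rw [h3] at hocc
  obtain ⟨n, hn⟩ := occursIn_rightSeq.1 hocc
  exact h2 f hf _ (by omega) hn

/-- `S` up to the position `m`, continued by `e 2 2 2 …`. -/
def graft (S : ℤ → ℕ) (m : ℤ) (e : List ℕ) : ℤ → ℕ := fun i =>
  if i < m then S i else prepend e (fun _ => 2) (i - m).toNat

lemma graft_of_lt (S : ℤ → ℕ) {m i : ℤ} (e : List ℕ) (h : i < m) : graft S m e i = S i :=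
  if_pos h

lemma at_graft (S : ℤ → ℕ) (m : ℤ) (e : List ℕ) : At (graft S m e) m e := by
  rw [at_iff_getD]
  intro k hk
  rw [graft, if_neg (by omega), prepend, if_pos (by omega)]
  congr 1; omega

lemma graft_of_ge (S : ℤ → ℕ) {m i : ℤ} (e : List ℕ) (h : m + e.length ≤ i) :
    graft S m e i = 2 := by
  rw [graft, if_neg (by omega), prepend, if_neg (by omega)]

lemma at_graft_of_le {S : ℤ → ℕ} {m i : ℤ} {e w : List ℕ} (h : i + w.length ≤ m) :
    At (graft S m e) i w ↔ At S i w :=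
  at_congr fun k hk => graft_of_lt _ _ (by omega)

lemma graft_ternary {S : ℤ → ℕ} (hS : Ternary S) {e : List ℕ}
    (he : ∀ a ∈ e, a = 1 ∨ a = 2 ∨ a = 3) (m : ℤ) : Ternary (graft S m e) := by
  intro i
  rw [graft, prepend]
  split_ifs with h1 h2
  · exact hS i
  · rw [List.getD_eq_getElem _ _ h2]
    exact he _ (List.getElem_mem h2)
  · exact Or.inr (Or.inl rfl)

lemma tailC_graft {x : ℕ → ℕ} (hx : TailC x) (n : ℕ) {s e : List ℕ}
    (hs : At (seqC x) (22 + n - s.length) s) (hok : extOk s e = true)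
    (he : ∀ a ∈ e, a = 1 ∨ a = 2 ∨ a = 3) :
    TailC (rightSeq (graft (seqC x) (22 + n) e) 22) := by
  have hS := graft_ternary hx.ternary he (22 + n)
  have hstr : Str (graft (seqC x) (22 + n) e) 14 := by
    refine ⟨fun i hi => ?_, (at_graft_of_le ?_).2 (str_seqC x).2⟩
    · rw [graft_of_lt _ _ (by omega)]
      exact (str_seqC x).1 i hi
    · rw [show wordP.length = 8 from rfl]; push_cast; omega
  have heq : graft (seqC x) (22 + n) e = seqC (rightSeq (graft (seqC x) (22 + n) e) 22) := by
    have := hstr.eq_seqC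
    simp only [sub_self, add_zero] at this
    exact this
  refine tailC_of_not_at (fun i => hS _) fun f hf k hk => ?_
  rw [← heq]
  rcases le_or_gt (k + f.length) (22 + n) with h | h
  · rw [at_graft_of_le h]
    exact hx.not_at hf hk
  · exact not_at_of_extOk ((at_graft_of_le (by omega)).2 hs) (at_graft _ _ _)
      (fun i hi => graft_of_ge _ _ hi) hok hf h

/-- After the first `n` letters the tail may be replaced by `e222…` or by `e221222…`. These differ
from each other, so one of them differs from `x`. -/
lemma TailC.exists_ne {x : ℕ → ℕ} (hx : TailC x) (n : ℕ) :
    ∃ y, TailC y ∧ (∀ i < n, y i = x i) ∧ y ≠ x := by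
  obtain ⟨s, hs, e, he, hok1, hok2⟩ := hx.avoids.exists_ext hx.ternary (22 + n)
  have hl : ∀ e ∈ extWords, ∀ a ∈ e ++ [2, 2, 1], a = 1 ∨ a = 2 ∨ a = 3 := by decide
  have h1 := tailC_graft hx n hs hok1 fun a ha => hl e he a (List.mem_append_left _ ha)
  have h2 := tailC_graft hx n hs hok2 (hl e he)
  have hag : ∀ e, ∀ i < n, rightSeq (graft (seqC x) (22 + n) e) 22 i = x i := fun e i hi => by
    rw [rightSeq, graft_of_lt _ _ (by omega)]
    exact congrFun (rightSeq_seqC x) i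
  by_cases hne : rightSeq (graft (seqC x) (22 + n) e) 22 = x
  · refine ⟨_, h2, hag _, fun heq => ?_⟩
    have h3 := congrFun (hne.trans heq.symm) (n + e.length + 2)
    rw [rightSeq, rightSeq, graft_of_ge _ _ (by push_cast; omega)] at h3
    have h4 := ((at_append _ _ _ _).1 (at_graft (seqC x) (22 + n) (e ++ [2, 2, 1]))).2.2.2.1
    rw [show (22 : ℤ) + n + e.length + 1 + 1 = 22 + ((n + e.length + 2 : ℕ) : ℤ) by
      push_cast; ring, ← h3] at h4
    exact absurd h4 (by decide)
  · exact ⟨_, h1, hag _, hne⟩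

lemma tailC_two : TailC fun _ => 2 := by
  have hr := rightSeq_seqC fun _ => 2
  refine tailC_of_not_at (fun _ => Or.inr (Or.inl rfl)) fun f hf k hk hat => ?_
  have hP := (str_seqC fun _ => 2).2
  rcases le_or_gt (k + f.length) 22 with h | h
  · have h1 := hP.infix hat hk (by rw [show wordP.length = 8 from rfl]; push_cast; omega)
    exact (by decide : ∀ f ∈ forbidden, ¬ f <:+: wordP) f hf h1
  · refine not_at_of_extOk (m := 22) (s := wordP) (e := []) hP trivial (fun i hi => ?_)
      (by decide +kernel) hf h hat
    have := congrFun hr (i - 22).toNat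
    rw [rightSeq] at this
    simp only [List.length_nil, Nat.cast_zero, add_zero] at hi
    rwa [show (22 : ℤ) + ((i - 22).toNat : ℤ) = i by omega] at this

/-! ### The set `C` -/

/-- A common past leaves only the right continued fraction, which determines its letters. -/
lemma eq_of_lam_eq {S T : ℤ → ℕ} (hS : ∀ i, 1 ≤ S i) (hT : ∀ i, 1 ≤ T i) (h : LeftPer S 14)
    (h' : LeftPer T 14) (heq : lam S 0 = lam T 0) : S = T := by
  have hlt : ∀ i < 14, S i = T i := fun i hi => by rw [h i hi, h' i hi]
  have h1 : leftSeq S (0 - 1) = leftSeq T (0 - 1) := by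
    funext n; exact hlt _ (by omega)
  rw [lam, lam, h1, add_left_inj] at heq
  have h2 := cfValue_injective (fun n => hS _) (fun n => hT _) heq
  funext i
  rcases lt_or_ge i 14 with hi | hi
  · exact hlt i hi
  · have : S (0 + i.toNat) = T (0 + i.toNat) := congrFun h2 i.toNat
    rwa [show (0 : ℤ) + (i.toNat : ℤ) = i by omega] at this

lemma seqC_injective : Function.Injective seqC := fun x y h => by
  rw [← rightSeq_seqC x, h, rightSeq_seqC]

lemma continuous_seqC : Continuous seqC := by
  refine continuous_pi fun i => ?_
  simp only [seqC, biSeq, prepend]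
  split_ifs
  · exact continuous_const
  · exact continuous_const
  · exact continuous_apply _

lemma isClosed_setOf_not_at (k : ℤ) (w : List ℕ) : IsClosed {S : ℤ → ℕ | ¬ At S k w} := by
  rw [← isOpen_compl_iff, isOpen_iff_mem_nhds]
  intro S hS
  filter_upwards [eventually_at_iff S k w] with T hT
  rw [Set.mem_compl_iff, Set.mem_ofPred_eq, hT]
  exact hS

lemma isCompact_tailC : IsCompact {x | TailC x} := by
  have h1 : {x | TailC x} = (Set.pi univ fun _ => ({1, 2, 3} : Set ℕ)) ∩
      ⋂ f ∈ forbidden, ⋂ k ≥ (14 : ℤ), seqC ⁻¹' {S | ¬ At S k f} := by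
    ext x
    simp only [Set.mem_inter_iff, Set.mem_univ_pi, Set.mem_iInter]
    exact ⟨fun hx => ⟨hx.1, fun f hf k hk => hx.not_at hf hk⟩,
      fun hx => tailC_of_not_at (fun n => mem_123.1 (hx.1 n)) hx.2⟩
  rw [h1]
  refine (isCompact_univ_pi fun _ => (Set.toFinite _).isCompact).inter_right ?_
  exact isClosed_biInter fun f _ => isClosed_biInter fun k _ =>
    (isClosed_setOf_not_at k f).preimage continuous_seqC

/-- The parametrization of `C`. -/
noncomputable def valC (x : {x | TailC x}) : ℝ := lam (seqC x) 0

lemma continuous_valC : Continuous valC :=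
  (continuousOn_lam 0).comp_continuous (continuous_seqC.comp continuous_subtype_val)
    fun x => TailC.ternary (x := (x : ℕ → ℕ)) x.2 |>.pos

lemma injective_valC : Function.Injective valC := fun x y h =>
  Subtype.ext (seqC_injective (eq_of_lam_eq (TailC.ternary x.2).pos (TailC.ternary y.2).pos
    (str_seqC _).1 (str_seqC _).1 h))

lemma range_valC : Set.range valC = setC := by
  ext v
  rw [mem_setC]
  exact ⟨fun ⟨x, hx⟩ => ⟨x, x.2, hx.symm⟩, fun ⟨x, hx, hv⟩ => ⟨⟨x, hx⟩, hv.symm⟩⟩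

lemma setC_nonempty : setC.Nonempty := ⟨_, mem_setC.2 ⟨_, tailC_two, rfl⟩⟩

lemma isCompact_setC : IsCompact setC := by
  have := isCompact_iff_compactSpace.1 isCompact_tailC
  rw [← range_valC]
  exact isCompact_range continuous_valC

lemma isTotallyDisconnected_setC : IsTotallyDisconnected setC := by
  have := isCompact_iff_compactSpace.1 isCompact_tailC
  rw [← range_valC]
  exact (continuous_valC.isClosedEmbedding injective_valC).isEmbedding.isTotallyDisconnected_range.2
    inferInstance

lemma perfect_setC : Perfect setC := by
  refine ⟨isCompact_setC.isClosed, fun v hv => ?_⟩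
  rw [← range_valC] at hv
  obtain ⟨x, rfl⟩ := hv
  rw [accPt_iff_nhds]
  intro U hU
  choose y hy1 hy2 hy3 using TailC.exists_ne x.2
  have hlim : Tendsto (fun n => (⟨y n, hy1 n⟩ : {x | TailC x})) atTop (𝓝 x) := by
    rw [tendsto_subtype_rng, tendsto_pi_nhds]
    intro i
    refine tendsto_const_nhds.congr' ?_
    filter_upwards [eventually_gt_atTop i] with n hn
    exact (hy2 n i hn).symm
  obtain ⟨n, hn⟩ := (((continuous_valC.tendsto x).comp hlim).eventually hU).exists
  refine ⟨_, ⟨hn, ?_⟩, fun h => hy3 n (congrArg Subtype.val (injective_valC h))⟩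
  rw [← range_valC]
  exact ⟨_, rfl⟩

/-! ### The sets `D` and `X` -/

lemma countable_setD : setD.Countable := by
  have : setD ⊆ Set.range fun s => lam (seqD (wordP ++ s ++ wordP.reverse)) 0 := fun v hv => by
    obtain ⟨s, -, hs⟩ := mem_setD.1 hv
    exact ⟨s, hs.symm⟩
  exact (Set.countable_range _).mono this

lemma WordD.ternary {s : List ℕ} (h : WordD s) :
    Ternary (seqD (wordP ++ s ++ wordP.reverse)) := by
  refine ternary_seqD fun a ha => ?_
  rw [List.mem_append, List.mem_append, List.mem_reverse] at ha
  have key : ∀ a ∈ wordP, a = 1 ∨ a = 2 ∨ a = 3 := by decide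
  rcases ha with (ha | ha) | ha
  · exact key a ha
  · exact mem_123.1 (h.1 a ha)
  · exact key a ha

/-- The transposed word `3212ω₁ᵀ1112` begins with the last four letters of a block `ω₁ᵀ`, hence five
letters into the first block after `w`. -/
lemma at_seqD_selfRep_reverse (w : List ℕ) :
    At (seqD w) (14 + w.length + 5) selfRep.reverse := by
  rw [at_iff_getD, length_selfRep_reverse]
  intro k hk
  have h1 := leftPer_rev_seqD w (-(14 + w.length + 5 + k)) (by omega)
  rw [rev, neg_neg] at h1
  rw [h1, show -(14 + (w.length : ℤ) + 5 + k) - -(13 + w.length) = -6 - k by ring]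
  exact (by decide : ∀ k < 17, per9 (-6 - (k : ℕ)) = selfRep.reverse.getD k 0) k hk

lemma finite_words (n : ℕ) : {s : List ℕ | (∀ a ∈ s, a ≤ 3) ∧ s.length ≤ n}.Finite := by
  refine ((List.finite_length_le (Fin 4) n).image (List.map Fin.val)).subset ?_
  rintro s ⟨h1, h2⟩
  refine ⟨s.map fun a => Fin.ofNat 4 a, by simpa using h2, ?_⟩
  rw [List.map_map]
  conv_rhs => rw [← List.map_id s]
  refine List.map_congr_left fun a ha => ?_
  have := h1 a ha
  simp [Fin.ofNat]
  omega

lemma finite_setX : setX.Finite := by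
  rw [setX]; exact Set.toFinite _

/-- Near an element of `D` there are only finitely many elements of `C ∪ D ∪ X`. -/
lemma exists_finite_near {m : ℝ} (hm : m ∈ setD) : ∃ F : Set ℝ, F.Finite ∧
    ∃ K : Set ℝ, IsCompact K ∧ m ∉ K ∧ setC ∪ setD ∪ setX ⊆ F ∪ K := by
  obtain ⟨s₀, hs₀, rfl⟩ := mem_setD.1 hm
  set w₀ := wordP ++ s₀ ++ wordP.reverse
  set P : ℤ := 14 + w₀.length + 5
  set K : Set (ℤ → ℕ) := {S | Ternary S} ∩ ((⋂ i < (14 : ℤ), {S | S i = per9 (i - 14)}) ∩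
    {S | ¬ At S P selfRep.reverse})
  have hK : IsCompact K := by
    refine isCompact_ternary.inter_right (IsClosed.inter ?_ (isClosed_setOf_not_at _ _))
    exact isClosed_biInter fun i _ => isClosed_eq (continuous_apply i) continuous_const
  have hmem : ∀ S, S ∈ K ↔ Ternary S ∧ LeftPer S 14 ∧ ¬ At S P selfRep.reverse := fun S => by
    simp only [K, Set.mem_inter_iff, Set.mem_iInter]
    rfl
  -- `K` collects the sequences without the transposed word at `P`, the place where the sequence of
  -- `s₀` has it. All of `C` lies there, and so does each element of `D` whose word `s` is so long
  -- that `P` falls inside its admissible middle part. Only short words `s` and `X` remain.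
  refine ⟨(fun s => lam (seqD (wordP ++ s ++ wordP.reverse)) 0) ''
    {s | (∀ a ∈ s, a ≤ 3) ∧ s.length ≤ (P + 3).toNat} ∪ setX,
    ((finite_words _).image _).union finite_setX, (fun S => lam S 0) '' K,
    hK.image_of_continuousOn ((continuousOn_lam 0).mono fun S hS => ((hmem S).1 hS).1.pos), ?_, ?_⟩
  · rintro ⟨S, hS, heq⟩
    obtain ⟨h1, h2, h3⟩ := (hmem S).1 hS
    rw [eq_of_lam_eq h1.pos hs₀.ternary.pos h2 (leftPer_seqD _) heq] at h3
    exact h3 (at_seqD_selfRep_reverse w₀)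
  · rintro v ((hv | hv) | hv)
    · obtain ⟨x, hx, rfl⟩ := mem_setC.1 hv
      refine Or.inr ⟨_, (hmem _).2 ⟨hx.ternary, (str_seqC x).1, ?_⟩, rfl⟩
      exact hx.not_at (mem_forbidden.2 (Or.inr (Or.inr rfl))) (by omega)
    · obtain ⟨s, hs, rfl⟩ := mem_setD.1 hv
      by_cases hl : s.length ≤ (P + 3).toNat
      · refine Or.inl (Or.inl ⟨s, ⟨fun a ha => ?_, hl⟩, rfl⟩)
        have := mem_123.1 (hs.1 a ha)
        omega
      · refine Or.inr ⟨_, (hmem _).2 ⟨hs.ternary, leftPer_seqD _, fun hat => ?_⟩, rfl⟩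
        refine hs.2.1 _ (mem_forbidden.2 (Or.inr (Or.inr rfl)))
          ((at_seqD _).infix hat (by omega) ?_)
        rw [length_selfRep_reverse]
        simp only [List.length_append]
        push_cast
        omega
    · exact Or.inl (Or.inr hv)

lemma isolated_of_mem_setD {m : ℝ} (hm : m ∈ setD) :
    ∃ ε > 0, ∀ y ∈ setC ∪ setD ∪ setX, |y - m| < ε → y = m := by
  obtain ⟨F, hF, K, hK, hmK, hsub⟩ := exists_finite_near hm
  have hcl : IsClosed (F \ {m} ∪ K) := (hF.subset Set.sdiff_subset).isClosed.union hK.isClosed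
  have hmem : (F \ {m} ∪ K)ᶜ ∈ 𝓝 m := hcl.isOpen_compl.mem_nhds (by simp [hmK])
  obtain ⟨ε, hε, hball⟩ := Metric.mem_nhds_iff.1 hmem
  refine ⟨ε, hε, fun y hy hlt => ?_⟩
  by_contra hne
  refine hball (Metric.mem_ball.2 hlt) ?_
  rcases hsub hy with h | h
  · exact Or.inl ⟨h, hne⟩
  · exact Or.inr h

lemma pointX_ne {u v : List ℕ} (hu : ∀ a ∈ u, a = 1 ∨ a = 2 ∨ a = 3)
    (hv : ∀ a ∈ v, a = 1 ∨ a = 2 ∨ a = 3) (k : ℕ)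
    (hk : k < ([2, 1, 2, 2] ++ u ++ [2, 2, 1, 2]).length)
    (hk' : k < ([2, 1, 2, 2] ++ v ++ [2, 2, 1, 2]).length)
    (hne : ([2, 1, 2, 2] ++ u ++ [2, 2, 1, 2]).getD k 0 ≠
      ([2, 1, 2, 2] ++ v ++ [2, 2, 1, 2]).getD k 0) : pointX u ≠ pointX v := by
  intro h
  rw [pointX_eq, pointX_eq] at h
  have ht : ∀ u : List ℕ, (∀ a ∈ u, a = 1 ∨ a = 2 ∨ a = 3) →
      Ternary (seqD ([2, 1, 2, 2] ++ u ++ [2, 2, 1, 2])) := fun u hu => ternary_seqD fun a ha => by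
    rw [List.mem_append, List.mem_append] at ha
    rcases ha with (ha | ha) | ha
    · exact (by decide : ∀ a ∈ [2, 1, 2, 2], a = 1 ∨ a = 2 ∨ a = 3) a ha
    · exact hu a ha
    · exact (by decide : ∀ a ∈ [2, 2, 1, 2], a = 1 ∨ a = 2 ∨ a = 3) a ha
  have heq := eq_of_lam_eq (ht u hu).pos (ht v hv).pos (leftPer_seqD _) (leftPer_seqD _) h
  have h1 := (at_iff_getD _ _ _).1 (at_seqD ([2, 1, 2, 2] ++ u ++ [2, 2, 1, 2])) k hk
  have h2 := (at_iff_getD _ _ _).1 (at_seqD ([2, 1, 2, 2] ++ v ++ [2, 2, 1, 2])) k hk'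
  rw [heq, h2] at h1
  exact hne h1.symm

lemma ncard_setX : setX.ncard = 3 := by
  rw [Set.ncard_eq_three]
  exact ⟨_, _, _, pointX_ne (by decide) (by decide) 8 (by decide) (by decide) (by decide),
    pointX_ne (by decide) (by decide) 8 (by decide) (by decide) (by decide),
    pointX_ne (by decide) (by decide) 10 (by decide) (by decide) (by decide), rfl⟩

/-! ### The spectra between `j₀` and `J` -/

lemma isCentral_of_mem {x : ℝ} (h : x ∈ setC ∪ setD ∪ setX) : IsCentral x := by
  rcases h with (h | h) | h
  · exact isCentral_of_mem_setC h
  · exact isCentral_of_mem_setD h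
  · exact isCentral_of_mem_setX h

lemma mem_of_mem_markovSpectrum {x : ℝ} (hx : x ∈ markovSpectrum) (h0 : j0 < x) (hJ : x < jL) :
    x ∈ setC ∪ setD ∪ setX := by
  obtain ⟨S, hS, hsup⟩ := exists_isSupLam hx
  exact mem_of_isSupLam hS hsup h0 hJ

lemma markovSpectrum_gap : markovSpectrum ∩ Ioo j0 jM = ∅ := by
  rw [Set.eq_empty_iff_forall_notMem]
  rintro x ⟨hx, h0, hj⟩
  obtain ⟨S, -, -, -, h, -⟩ := isCentral_of_mem
    (mem_of_mem_markovSpectrum hx h0 (hj.trans jM_lt_jL))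
  exact absurd hj (not_lt.2 h)

lemma markov_diff_lagrange :
    (markovSpectrum \ lagrangeSpectrum) ∩ Ico jM jL = setC ∪ setD ∪ setX := by
  ext x
  constructor
  · rintro ⟨⟨hx, -⟩, h1, h2⟩
    exact mem_of_mem_markovSpectrum hx (j0_lt_jM.trans_le h1) h2
  · intro hx
    obtain ⟨S, hS, hle, rfl, h1, h2⟩ := isCentral_of_mem hx
    refine ⟨⟨lam_mem_markovSpectrum hS.pos hle, fun hL => ?_⟩, h1, h2⟩
    have := lagrangeSpectrum_gap
    rw [Set.eq_empty_iff_forall_notMem] at this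
    exact this _ ⟨hL, j0_lt_jM.trans_le h1, h2⟩

lemma isolated_in_diff {m : ℝ} (hm : m ∈ setD) :
    ∃ ε > 0, ∀ y ∈ markovSpectrum \ lagrangeSpectrum, |y - m| < ε → y = m := by
  obtain ⟨ε, hε, h⟩ := isolated_of_mem_setD hm
  obtain ⟨S, -, -, -, h1, h2⟩ := isCentral_of_mem_setD hm
  -- The radius also keeps the neighbours in `(j₀, J)`, where every element of `M` belongs to `C ∪ D
  -- ∪ X`.
  refine ⟨min ε (min (m - j0) (jL - m)), lt_min hε (lt_min ?_ ?_), fun y hy hlt => ?_⟩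
  · linarith [j0_lt_jM]
  · linarith
  · rw [lt_min_iff, lt_min_iff] at hlt
    obtain ⟨h3, h4, h5⟩ := hlt
    rw [abs_lt] at h4 h5
    exact h y (mem_of_mem_markovSpectrum hy.1 (by linarith) (by linarith)) h3

end MarkovLagrange

theorem mainTheorem3 :
    -- the three explicit numbers are in the order j₀ < j < J
    MarkovLagrange.j0 < MarkovLagrange.jM ∧ MarkovLagrange.jM < MarkovLagrange.jL ∧
    -- the gaps of M and of L to the right of j₀
    MarkovLagrange.markovSpectrum ∩ Set.Ioo MarkovLagrange.j0 MarkovLagrange.jM = ∅ ∧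
    MarkovLagrange.lagrangeSpectrum ∩ Set.Ioo MarkovLagrange.j0 MarkovLagrange.jL = ∅ ∧
    -- the description of M \ L in the gap of L
    (MarkovLagrange.markovSpectrum \ MarkovLagrange.lagrangeSpectrum) ∩
        Set.Ico MarkovLagrange.jM MarkovLagrange.jL =
      MarkovLagrange.setC ∪ MarkovLagrange.setD ∪ MarkovLagrange.setX ∧
    -- C is a Cantor set
    MarkovLagrange.setC.Nonempty ∧ IsCompact MarkovLagrange.setC ∧
    Perfect MarkovLagrange.setC ∧ IsTotallyDisconnected MarkovLagrange.setC ∧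
    -- D is a countable set of isolated points of M \ L
    MarkovLagrange.setD.Countable ∧
    (∀ m ∈ MarkovLagrange.setD, ∃ ε > 0,
      ∀ y ∈ MarkovLagrange.markovSpectrum \ MarkovLagrange.lagrangeSpectrum,
        |y - m| < ε → y = m) ∧
    -- X consists of three points
    MarkovLagrange.setX.ncard = 3 := by
  exact ⟨MarkovLagrange.j0_lt_jM, MarkovLagrange.jM_lt_jL, MarkovLagrange.markovSpectrum_gap,
    MarkovLagrange.lagrangeSpectrum_gap, MarkovLagrange.markov_diff_lagrange,
    MarkovLagrange.setC_nonempty, MarkovLagrange.isCompact_setC, MarkovLagrange.perfect_setC,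
    MarkovLagrange.isTotallyDisconnected_setC, MarkovLagrange.countable_setD,
    fun _ hm => MarkovLagrange.isolated_in_diff hm, MarkovLagrange.ncard_setX⟩
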